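/- **Setup.** Let $k$ be a field of characteristic $0$. A *smooth variety* is a smooth separated scheme of finite type over $k$ (not necessarily connected); closed subvarieties are reduced closed subschemes. We consider smooth separated Deligne--Mumford stacks of finite type of the form $\mathcal Y=[U/\mathbb G_m^r]$, with $U$ a smooth variety ($r=0$ gives the smooth varieties), and closed substacks $X=[X_U/\mathbb G_m^r]$, with $X_U\subset U$ an invariant closed subvariety. *Invariants.* Let $\Gamma$ be a totally ordered set with a minimum. A *singularity invariant* $\mathrm{inv}$ assigns to each closed subvariety $X$ of a smooth variety $Y$ an upper semicontinuous function $\mathrm{inv}_X=\mathrm{inv}_{X\subset Y}:|X|\to\Gamma$ with $\mathrm{inv}_X(p)=\min\Gamma$ if and only if $X$ is nonsingular at $p$. It is *functorial* if $\mathrm{inv}_{\varphi^{-1}(X)}=\mathrm{inv}_X\circ\varphi$ for every smooth morphism $\varphi:Y_1\to Y$ of smooth varieties. It is *smooth* if for every $X\subset Y$ the locus of points of $X$ where $\mathrm{inv}_X$ attains its maximum is a smooth variety, with its reduced structure. A functorial invariant is defined on $[X_U/\mathbb G_m^r]\subset[U/\mathbb G_m^r]$ through the atlas $X_U\subset U$.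 We assume that for each $n$ the values that $\mathrm{inv}$ takes on closed substacks of stacks $\mathcal Y=[U/\mathbb G_m^r]$ as above, with $\dim\mathcal Y=\dim U-r\le n$, form a well-ordered subset of $\Gamma$ (this is automatic if $\Gamma$ is well-ordered). *Centers and blowups.* A *center* $\overline J$ on a smooth variety $Y$ is a decreasing sequence of ideal sheaves $(I_n)_{n\ge0}$ such that, Zariski locally on $Y$, either all $I_n=\mathcal O_Y$, or there are étale coordinates $x_1,\dots,x_d$ and integer weights $w_i>0$ for $i\le m$ (for some $0\le m\le d$) such that $I_n$ is generated by the monomials $x_1^{a_1}\cdots x_m^{a_m}$ with $\sum w_ia_i\ge n$; one writes $\overline J=(x_1^{1/w_1},\dots,x_m^{1/w_m})$. Its zero locus is $V(\overline J)=V(I_1)$. Put $$B=\operatorname{Spec}_Y\Big(\bigoplus_{n\in\mathbb Z}I_nT^n\Big)\ \ (I_n=\mathcal O_Y\text{ for }n\le0),\qquad s=T^{-1},\qquad V=V\Big(\bigoplus_{n>0}I_nT^n\Big),\qquad B_+=B\smallsetminus V,$$ so that $\{s\ne0\}=Y\times\mathbb G_m$; let $\mathbb G_m$ act on $B$ over $Y$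 with $s$ of weight $-1$. For $X\subset Y$ closed, $BX\subset B$ is the closure of $X\times\mathbb G_m$. The weighted blowups are $Bl_{\overline J}(Y)=[B_+/\mathbb G_m]$ and $Bl_{\overline J}(X)=[(BX\smallsetminus V)/\mathbb G_m]$. A center on $\mathcal Y=[U/\mathbb G_m^r]$ is an invariant center on $U$. Its weighted blowup is $[B_+/\mathbb G_m\times\mathbb G_m^r]$, formed from the space $B_+$ of $U$, where $\mathbb G_m^r$ acts compatibly with $B_+\to U$ and fixes $s$; $Bl_{\overline J}(X)$ is the corresponding quotient of $BX_U\smallsetminus V$. For $X\subset\mathcal Y$ and a center $\overline J$ on $\mathcal Y$ consider the conditions * (a) $V(\overline J)$ is the locus of points of $X$ where $\mathrm{inv}_X$ attains its maximum; * (b) $\max\mathrm{inv}_X=\max\mathrm{inv}_{BX}$ (both maxima exist). **Lemma.** Let $\mathrm{inv}$ be a smooth functorial singularity invariant as above. 1. Let $\mathcal Y$ be a smooth separated Deligne--Mumford stack of finite type $[U/\mathbb G_m^r]$, $X\subset\mathcal Y$ a closed substack, and $\overline J$ a center on $\mathcal Y$ satisfying (a) and (b). Then the torus action defining the weighted blowup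 exists, and, if $Bl_{\overline J}(X)$ is not empty, $\mathrm{inv}_{Bl_{\overline J}(X)}$ has a maximum and $$\max\mathrm{inv}_{Bl_{\overline J}(X)}<\max\mathrm{inv}_X.$$ 2. Assume that for every smooth separated Deligne--Mumford stack of finite type $\mathcal Y=[U/\mathbb G_m^r]$ and every closed substack $X\subset\mathcal Y$ with $X_U$ irreducible and singular there is a center on $\mathcal Y$ satisfying (a) and (b). Then embedded resolution of singularities holds: for every irreducible closed subvariety $X$ of a smooth variety $Y$ there are a smooth separated Deligne--Mumford stack of finite type $Y'=[U'/\mathbb G_m^{r'}]$ and a proper morphism $\pi:Y'\to Y$ which is an isomorphism over a dense open subset $Y_0\subset Y$ with $X\cap Y_0\neq\emptyset$, such that the strict transform of $X$, the closure of $\pi^{-1}(X\cap Y_0)$ with its reduced structure, is smooth. -/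

import Mathlib

open CategoryTheory Limits TopologicalSpace AlgebraicGeometry LaurentPolynomial

universe u v

namespace WeightedResolution
noncomputable section

/-- A decreasing multiplicative filtration of a commutative ring by ideals `I 0 = (1) ⊇ I 1 ⊇ ⋯`. -/
structure RingFiltration (A : Type u) [CommRing A] where
  ideal : ℕ → Ideal A
  ideal_zero : ideal 0 = ⊤
  antitone : Antitone ideal
  mul_le : ∀ m n, ideal m * ideal n ≤ ideal (m + n)

namespace RingFiltration

variable {A B : Type u} [CommRing A] [CommRing B] (I : RingFiltration A) (I' : RingFiltration B)

/-- The extended Rees algebra `⊕_{n ∈ ℤ} I_n T^n ⊆ A[T, T⁻¹]`, with `I_n = A` for `n ≤ 0`. -/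
def extendedRees : Subring (LaurentPolynomial A) where
  carrier := {p | ∀ n : ℤ, p.coeff n ∈ I.ideal n.toNat}
  zero_mem' n := by simp
  one_mem' n := by
    rw [← T_zero, T_apply]
    split_ifs with h
    · subst h; simp [I.ideal_zero]
    · exact Ideal.zero_mem _
  add_mem' hp hq n := by simpa using Ideal.add_mem _ (hp n) (hq n)
  neg_mem' hp n := by simpa using (hp n)
  mul_mem' {p q} hp hq n := by
    classical
    rw [AddMonoidAlgebra.coeff_mul]
    refine Ideal.sum_mem _ fun a _ ↦ Ideal.sum_mem _ fun b _ ↦ ?_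
    dsimp only
    split_ifs with h
    · subst h
      exact I.antitone (show (a + b).toNat ≤ a.toNat + b.toNat by omega)
        (I.mul_le _ _ (Ideal.mul_mem_mul (hp a) (hq b)))
    · exact Ideal.zero_mem _

lemma C_mul_T_mem {n : ℤ} {f : A} (hf : f ∈ I.ideal n.toNat) :
    C f * T n ∈ I.extendedRees := fun m ↦ by
  rw [← single_eq_C_mul_T, AddMonoidAlgebra.coeff_single, Finsupp.single_apply]
  split_ifs with h
  · subst h; exact hf
  · exact Ideal.zero_mem _

lemma C_mem (f : A) : C f ∈ I.extendedRees := by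
  simpa using I.C_mul_T_mem (n := 0) (f := f) (by simp [I.ideal_zero])

/-- The element `f T^n` of the extended Rees algebra, for `f ∈ I_n`. -/
def monomial (n : ℤ) (f : A) (hf : f ∈ I.ideal n.toNat) : I.extendedRees :=
  ⟨C f * T n, I.C_mul_T_mem hf⟩

/-- The inclusion of `A` as the degree `0` part of the extended Rees algebra. -/
def const : A →+* I.extendedRees := C.codRestrict _ I.C_mem

/-- The exceptional variable `s = T⁻¹`, the unit of `A` placed in degree `-1`. -/
def exceptional : I.extendedRees := I.monomial (-1) 1 (by simp [I.ideal_zero])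

variable {I I'}

/-- A ring map compatible with the filtrations induces a map of extended Rees algebras. -/
def map (φ : A →+* B) (h : ∀ n, I.ideal n ≤ (I'.ideal n).comap φ) :
    I.extendedRees →+* I'.extendedRees :=
  (AddMonoidAlgebra.mapRingHom ℤ φ).restrict _ _ fun p hp n ↦ by
    rw [AddMonoidAlgebra.coeff_mapRingHom]
    exact h _ (hp n)

lemma coeff_map (φ : A →+* B) (h : ∀ n, I.ideal n ≤ (I'.ideal n).comap φ)
    (p : I.extendedRees) (n : ℤ) : (map φ h p).1.coeff n = φ (p.1.coeff n) :=
  AddMonoidAlgebra.coeff_mapRingHom _ _ _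

lemma map_monomial (φ : A →+* B) (h : ∀ n, I.ideal n ≤ (I'.ideal n).comap φ) (n : ℤ) (f : A)
    (hf : f ∈ I.ideal n.toNat) : map φ h (I.monomial n f hf) = I'.monomial n (φ f) (h _ hf) := by
  refine Subtype.ext ?_
  change AddMonoidAlgebra.mapRingHom ℤ φ (C f * T n) = C (φ f) * T n
  rw [← single_eq_C_mul_T, ← single_eq_C_mul_T, AddMonoidAlgebra.mapRingHom_single]

lemma map_const (φ : A →+* B) (h : ∀ n, I.ideal n ≤ (I'.ideal n).comap φ) (f : A) :
    map φ h (I.const f) = I'.const (φ f) :=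
  Subtype.ext (AddMonoidAlgebra.mapRingHom_single _ _ _)

lemma map_exceptional (φ : A →+* B) (h : ∀ n, I.ideal n ≤ (I'.ideal n).comap φ) :
    map φ h I.exceptional = I'.exceptional := by
  rw [exceptional, map_monomial]
  simp [exceptional]

lemma coeff_const_mul (a : A) (p : I.extendedRees) (n : ℤ) :
    (I.const a * p).1.coeff n = a * p.1.coeff n := by
  change (C a * p.1).coeff n = _
  rw [← smul_eq_C_mul]; rfl

/-- The extended Rees algebra commutes with localization. -/
lemma isLocalization_map (φ : A →+* B) (f : A)
    (hφ : letI := φ.toAlgebra; IsLocalization.Away f B)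
    (h : ∀ n, (I.ideal n).map φ = I'.ideal n) :
    letI := (map φ (fun n ↦ Ideal.map_le_iff_le_comap.mp (h n).le) :
      I.extendedRees →+* I'.extendedRees).toAlgebra
    IsLocalization.Away (I.const f) I'.extendedRees := by
  let := φ.toAlgebra
  have hle : ∀ n, I.ideal n ≤ (I'.ideal n).comap φ := fun n ↦
    Ideal.map_le_iff_le_comap.mp (h n).le
  let alg := (map φ hle).toAlgebra
  have halg : ∀ p, algebraMap I.extendedRees I'.extendedRees p = map φ hle p := fun _ ↦ rfl
  change IsLocalization (.powers (I.const f)) I'.extendedRees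
  refine ⟨⟨?_, ?_, ?_⟩⟩
  · rintro ⟨_, N, rfl⟩
    simp only [map_pow]
    rw [halg, map_const]
    exact ((IsLocalization.Away.algebraMap_isUnit (S := B) f).map I'.const).pow N
  · intro p
    have key : ∀ n : ℤ, ∃ (N : ℕ) (g : A), g ∈ I.ideal n.toNat ∧
        φ f ^ N * p.1.coeff n = φ g := by
      intro n
      have h1 := p.2 n
      rw [← h] at h1
      obtain ⟨⟨g, ⟨_, N, rfl⟩⟩, hg⟩ :=
        (IsLocalization.mem_map_algebraMap_iff (.powers f) B).mp h1
      refine ⟨N, g, g.2, ?_⟩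
      rw [mul_comm, ← map_pow]
      exact hg
    choose N g hg hN using key
    let M := p.1.coeff.support.sup N
    have hM : ∀ n ∈ p.1.coeff.support, N n ≤ M := fun n hn ↦ Finset.le_sup hn
    let q : LaurentPolynomial A :=
      ∑ n ∈ p.1.coeff.support, AddMonoidAlgebra.single n (f ^ (M - N n) * g n)
    have hq : ∀ n, q.coeff n = if n ∈ p.1.coeff.support then f ^ (M - N n) * g n else 0 := by
      intro n
      simp only [q, AddMonoidAlgebra.coeff_sum, Finsupp.finsetSum_apply,
        AddMonoidAlgebra.coeff_single, Finsupp.single_apply, Finset.sum_ite_eq']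
    have hqm : q ∈ I.extendedRees := fun n ↦ by
      rw [hq]
      split_ifs
      · exact Ideal.mul_mem_left _ _ (hg n)
      · exact Ideal.zero_mem _
    refine ⟨(⟨q, hqm⟩, ⟨_, M, rfl⟩), Subtype.ext (LaurentPolynomial.ext fun n ↦ ?_)⟩
    simp only [map_pow]
    rw [halg, halg, map_const, coeff_map, ← map_pow, mul_comm, coeff_const_mul]
    dsimp only
    rw [hq]
    split_ifs with hn
    · rw [map_mul, ← hN n, ← mul_assoc, map_pow, ← pow_add, Nat.sub_add_cancel (hM n hn)]
    · rw [Finsupp.notMem_support_iff.mp hn, mul_zero, map_zero]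
  · intro p q hpq
    have key : ∀ n : ℤ, ∃ N : ℕ, f ^ N * p.1.coeff n = f ^ N * q.1.coeff n := by
      intro n
      have h1 : φ (p.1.coeff n) = φ (q.1.coeff n) := by
        rw [← coeff_map φ hle, ← coeff_map φ hle, ← halg, ← halg, hpq]
      obtain ⟨⟨_, N, rfl⟩, hN⟩ := (IsLocalization.eq_iff_exists (.powers f) B).mp h1
      exact ⟨N, hN⟩
    choose N hN using key
    let M := (p.1.coeff.support ∪ q.1.coeff.support).sup N
    refine ⟨⟨_, M, rfl⟩, Subtype.ext (LaurentPolynomial.ext fun n ↦ ?_)⟩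
    dsimp only
    rw [← map_pow, coeff_const_mul, coeff_const_mul]
    by_cases hn : n ∈ p.1.coeff.support ∪ q.1.coeff.support
    · have : N n ≤ M := Finset.le_sup hn
      rw [← Nat.sub_add_cancel this, pow_add, mul_assoc, mul_assoc, hN]
    · rw [Finset.mem_union, not_or, Finsupp.notMem_support_iff, Finsupp.notMem_support_iff] at hn
      rw [hn.1, hn.2]

end RingFiltration

/-- A decreasing multiplicative filtration of the structure sheaf by (quasi-coherent) ideal
sheaves `I 0 = 𝒪_Y ⊇ I 1 ⊇ ⋯`. -/
structure IdealFiltration (Y : Scheme.{u}) where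
  ideal : ℕ → Y.IdealSheafData
  ideal_zero : ideal 0 = ⊤
  antitone : Antitone ideal
  mul_le : ∀ m n, ideal m * ideal n ≤ ideal (m + n)

namespace IdealFiltration

open Scheme (AffineZariskiSite)

variable {Y : Scheme.{u}} (J : IdealFiltration Y)

/-- The filtration of `Γ(Y, U)` on an affine open `U`. -/
def sections (U : Y.AffineZariskiSite) : RingFiltration Γ(Y, U.1) where
  ideal n := (J.ideal n).ideal ⟨U.1, U.2⟩
  ideal_zero := by rw [J.ideal_zero]; rfl
  antitone _ _ h := J.antitone h _
  mul_le m n := J.mul_le m n _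

lemma sections_le_comap {U V : Y.AffineZariskiSite} (h : U ≤ V) (n : ℕ) :
    (J.sections V).ideal n ≤ ((J.sections U).ideal n).comap
      (Y.presheaf.map (homOfLE (AffineZariskiSite.toOpens_mono h)).op).hom :=
  (J.ideal n).ideal_le_comap_ideal (U := ⟨U.1, U.2⟩) (V := ⟨V.1, V.2⟩)
    (AffineZariskiSite.toOpens_mono h)

/-- The quasi-coherent algebra `⊕_{n ∈ ℤ} I_n T^n` on affine opens. -/
def reesPresheaf : (Y.AffineZariskiSite)ᵒᵖ ⥤ CommRingCat.{u} where
  obj U := CommRingCat.of (J.sections U.unop).extendedRees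
  map {V U} i := CommRingCat.ofHom (RingFiltration.map _ (J.sections_le_comap i.unop.le))
  map_id U := by
    ext p n
    refine (RingFiltration.coeff_map _ (J.sections_le_comap le_rfl) p n).trans ?_
    exact congr($(Y.presheaf.map_id _) (p.1.coeff n))
  map_comp {U V W} i j := by
    ext p n
    refine (RingFiltration.coeff_map _ (J.sections_le_comap (i ≫ j).unop.le) p n).trans ?_
    refine Eq.trans ?_ (RingFiltration.coeff_map _ (J.sections_le_comap j.unop.le) _ n).symm
    refine Eq.trans ?_
      (congrArg _ (RingFiltration.coeff_map _ (J.sections_le_comap i.unop.le) p n).symm)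
    rw [← CommRingCat.comp_apply, ← Y.presheaf.map_comp]
    rfl

/-- The structure map of the extended Rees algebra as an `𝒪_Y`-algebra. -/
def reesStructureMap :
    (AffineZariskiSite.toOpensFunctor Y).op ⋙ Y.presheaf ⟶ J.reesPresheaf where
  app U := CommRingCat.ofHom (J.sections U.unop).const
  naturality {U V} i := by
    ext f
    exact (RingFiltration.map_const _ (J.sections_le_comap i.unop.le) f).symm

lemma coequifibered_reesStructureMap : J.reesStructureMap.Coequifibered :=
  AffineZariskiSite.coequifibered_iff_forall_isLocalizationAway.mpr fun U f ↦
    RingFiltration.isLocalization_map (I := J.sections U) (I' := J.sections (U.basicOpen f)) _ f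
      (U.2.isLocalization_basicOpen f) fun n ↦ (J.ideal n).map_ideal_basicOpen ⟨U.1, U.2⟩ f

/-- The gluing datum for the relative spectrum of the extended Rees algebra. -/
def normalConeGluing : (AffineZariskiSite.directedCover Y).RelativeGluingData :=
  AffineZariskiSite.relativeGluingData J.coequifibered_reesStructureMap

instance : (J.normalConeGluing.functor ⋙ Scheme.forget).IsLocallyDirected :=
  Scheme.Cover.RelativeGluingData.instIsLocallyDirectedI₀CompFunctorForgetOfIsThin ..

/-- The deformation to the weighted normal cone `B = Spec_Y ⊕ I_n T^n`. -/
def normalCone : Scheme.{u} := J.normalConeGluing.glued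

/-- The structure morphism `σ : B ⟶ Y`. -/
def toBase : J.normalCone ⟶ Y := J.normalConeGluing.toBase

/-- The chart `Spec ⊕ I_n(U) T^n ⟶ B` over an affine open `U` of `Y`. -/
def chart (U : Y.AffineZariskiSite) :
    Spec (CommRingCat.of (J.sections U).extendedRees) ⟶ J.normalCone :=
  J.normalConeGluing.cover.f U

instance (U : Y.AffineZariskiSite) : IsOpenImmersion (J.chart U) :=
  J.normalConeGluing.cover.map_prop U

/-- The ring map `ℤ[X] → ⊕ I_n(U) T^n` sending `X` to the exceptional variable. -/
def parameter (U : Y.AffineZariskiSite) :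
    Polynomial (ULift.{u} ℤ) →+* (J.sections U).extendedRees :=
  Polynomial.eval₂RingHom ((Int.castRingHom _).comp ULift.ringEquiv.toRingHom)
    (J.sections U).exceptional

lemma map_comp_parameter {U V : Y.AffineZariskiSite} (h : U ≤ V) :
    (RingFiltration.map _ (J.sections_le_comap h)).comp (J.parameter V) = J.parameter U := by
  refine Polynomial.ringHom_ext (fun a ↦ ?_) ?_
  · simp [parameter]
  · simp only [parameter, RingHom.comp_apply, Polynomial.coe_eval₂RingHom, Polynomial.eval₂_X]
    exact RingFiltration.map_exceptional _ (J.sections_le_comap h)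

/-- The deformation parameter, as a morphism from `B` to the affine line. -/
def parameterMap : J.normalCone ⟶ Spec (CommRingCat.of (Polynomial (ULift.{u} ℤ))) :=
  colimit.desc J.normalConeGluing.functor
    { pt := Spec (CommRingCat.of (Polynomial (ULift.{u} ℤ)))
      ι :=
      { app U := Spec.map (CommRingCat.ofHom (J.parameter U))
        naturality U V i := by
          refine (Spec.map_comp _ _).symm.trans (Eq.trans ?_ (Category.comp_id _).symm)
          exact congrArg (fun φ ↦ Spec.map (CommRingCat.ofHom φ)) (J.map_comp_parameter i.le) } }

/-- The exceptional function `s` on `B`. -/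
def exceptional : Γ(J.normalCone, ⊤) :=
  J.parameterMap.appTop ((Scheme.ΓSpecIso _).inv (Polynomial.X (R := ULift.{u} ℤ)))

/-- The complement `B₊` of the vertex `V(⊕_{n > 0} I_n T^n)`: the union of the loci where some
`f T^n`, with `n > 0` and `f ∈ I_n`, is invertible. -/
def awayFromVertex : J.normalCone.Opens :=
  ⨆ (U : Y.AffineZariskiSite) (n : ℕ) (f : (J.sections U).ideal (n + 1)),
    J.chart U ''ᵁ PrimeSpectrum.basicOpen ((J.sections U).monomial (n + 1 : ℕ) f.1 f.2)

end IdealFiltration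
/-! ### Smooth varieties and closed subvarieties -/

variable {k : Type u} [Field k]

variable (k) in
/-- The category of schemes over the field `k`. -/
abbrev Sch : Type (u + 1) := Over (Spec (CommRingCat.of k))

/-- `Y` is a smooth separated scheme of finite type over `k`. -/
structure IsSmoothVariety (Y : Sch k) : Prop where
  smooth : Smooth Y.hom
  separated : IsSeparated Y.hom
  quasiCompact : QuasiCompact Y.hom

/-- `Y` is smooth over `k`, of dimension at most `n` at every point. -/
def IsSmoothOfDimLE (Y : Sch k) (n : ℕ) : Prop :=
  ∀ y : Y.left, ∃ (V : Y.left.Opens) (d : ℕ), y ∈ V ∧ d ≤ n ∧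
    SmoothOfRelativeDimension d (V.ι ≫ Y.hom)

/-- The reduced closed subscheme of `Y` with underlying set `X`. Closed subvarieties are reduced,
so they are represented by their underlying closed sets throughout. -/
def reducedSubscheme (Y : Sch k) (X : Closeds Y.left) : Scheme.{u} :=
  (Scheme.IdealSheafData.vanishingIdeal X).subscheme

/-- The closed immersion of the reduced closed subscheme on `X`. -/
def reducedSubschemeι (Y : Sch k) (X : Closeds Y.left) :
    reducedSubscheme Y X ⟶ Y.left :=
  (Scheme.IdealSheafData.vanishingIdeal X).subschemeι

/-- The reduced closed subscheme on `X` is smooth over `k`. -/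
def IsSmoothClosed (Y : Sch k) (X : Closeds Y.left) : Prop :=
  Smooth (reducedSubschemeι Y X ≫ Y.hom)

/-- The reduced closed subscheme on `X` is smooth over `k` in a neighbourhood of `p`. -/
def IsNonsingularAt (Y : Sch k) (X : Closeds Y.left) (p : Y.left) :
    Prop :=
  ∃ V : Y.left.Opens, p ∈ V ∧ Smooth ((reducedSubschemeι Y X ∣_ V) ≫ V.ι ≫ Y.hom)

/-! ### Centers -/

/-- The map from `k` to the functions on an open subset of a `k`-scheme. -/
def scalars (Y : Sch k) (U : Y.left.Opens) : k →+* Γ(Y.left, U) :=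
  (Y.left.presheaf.map (homOfLE le_top).op).hom.comp
    (Y.hom.appTop.hom.comp (Scheme.ΓSpecIso (CommRingCat.of k)).inv.hom)

/-- `x₁, …, x_d` are local coordinates on `U`: they define an étale morphism `U ⟶ 𝔸^d`. -/
def IsCoordinateSystem (Y : Sch k) (U : Y.left.Opens) {d : ℕ}
    (x : Fin d → Γ(Y.left, U)) : Prop :=
  (MvPolynomial.eval₂Hom (scalars Y U) x).Etale

/-- A (reduced) center `J̄` on `Y`, given by the ideals `I_n = {f : v_J̄(f) ≥ n}` of its monomial
valuation. Locally `J̄` is trivial (`v_J̄ = ∞`), or `J̄ = (x_i^{1/w_i} : w_i > 0)` for local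
coordinates `x_i` with weights `w_i`, i.e. `I_n` is generated by the monomials of
weighted degree at least `n`; the coordinates of weight `0` are those not occurring in `J̄`. -/
structure Center (Y : Sch k) extends IdealFiltration Y.left where
  locally_monomial : ∀ y : Y.left, ∃ U : Y.left.affineOpens, y ∈ U.1 ∧
    ((∀ n, (ideal n).ideal U = ⊤) ∨
      ∃ (d : ℕ) (x : Fin d → Γ(Y.left, U)) (w : Fin d → ℕ), IsCoordinateSystem Y U x ∧
        ∀ n, (ideal n).ideal U =
          Ideal.span {f | ∃ m : Fin d → ℕ, n ≤ ∑ i, w i * m i ∧ f = ∏ i, x i ^ m i})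

namespace Center

variable {Y : Sch k} (J : Center Y)

/-- The zero locus `V(J̄)`, where `v_J̄ > 0`. -/
def zeroLocus : Closeds Y.left := (J.ideal 1).support

/-- The deformation to the weighted normal cone `B`, as a `k`-scheme. -/
def cone : Sch k := Over.mk (J.toBase ≫ Y.hom)

/-- The morphism `σ : B ⟶ Y`. -/
def coneToBase : J.cone ⟶ Y := Over.homMk J.toBase

/-- `B₊ = B ∖ V`, as a `k`-scheme. -/
def puncturedCone : Sch k :=
  Over.mk (J.awayFromVertex.ι ≫ J.toBase ≫ Y.hom)

/-- The open immersion `B₊ ⟶ B`. -/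
def puncturedConeι : J.puncturedCone ⟶ J.cone := Over.homMk J.awayFromVertex.ι

/-- The proper transform `BX ⊆ B`: the closure of `X × 𝔾_m ⊆ Y × 𝔾_m = {s ≠ 0}`. -/
def coneTransform (X : Closeds Y.left) : Closeds J.cone.left :=
  Closeds.closure (J.toBase ⁻¹' (X : Set Y.left) ∩ (J.normalCone.basicOpen J.exceptional : Set J.normalCone))

/-- `BX ∖ V ⊆ B₊`. -/
def puncturedConeTransform (X : Closeds Y.left) : Closeds J.puncturedCone.left :=
  (J.coneTransform X).preimage J.puncturedConeι.left.continuous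

end Center

/-! ### Quotient stacks by tori -/

/-- The pullback of a tuple of invertible functions. -/
def pullbackUnits {S S' : Sch k} (g : S' ⟶ S) {r : ℕ}
    (t : Fin r → Γ(S.left, ⊤)ˣ) : Fin r → Γ(S'.left, ⊤)ˣ :=
  fun i ↦ Units.map g.left.appTop.hom.toMonoidHom (t i)

/-- An action of the torus `𝔾_m^r` on the `k`-scheme `U`, through functors of points: the group
`𝔾_m^r(S)` of `r`-tuples of invertible functions on `S` acts on `U(S)`, naturally in `S`. -/
structure TorusAction (r : ℕ) (U : Sch k) where
  smul : ∀ {S : Sch k}, (Fin r → Γ(S.left, ⊤)ˣ) → (S ⟶ U) → (S ⟶ U)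
  one_smul : ∀ {S : Sch k} (b : S ⟶ U), smul 1 b = b
  mul_smul : ∀ {S : Sch k} (t t' : Fin r → Γ(S.left, ⊤)ˣ) (b : S ⟶ U),
    smul (t * t') b = smul t (smul t' b)
  comp_smul : ∀ {S S' : Sch k} (g : S' ⟶ S) (t : Fin r → Γ(S.left, ⊤)ˣ) (b : S ⟶ U),
    g ≫ smul t b = smul (pullbackUnits g t) (g ≫ b)

variable (k) in
/-- The coordinate ring `k[x₁^±, …, x_r^±]` of `𝔾_m^r`. -/
abbrev torusRing (r : ℕ) : Type u :=
  Localization.Away (∏ i : Fin r, MvPolynomial.X i : MvPolynomial (Fin r) k)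

variable (k) in
/-- The torus `𝔾_m^r` over `k`. -/
def torus (r : ℕ) : Sch k :=
  Over.mk (Spec.map (CommRingCat.ofHom (algebraMap k (torusRing k r))))

lemma isUnit_coordinate (r : ℕ) (i : Fin r) :
    IsUnit (algebraMap (MvPolynomial (Fin r) k) (torusRing k r) (MvPolynomial.X i)) :=
  isUnit_of_dvd_unit (map_dvd _ (Finset.dvd_prod_of_mem _ (Finset.mem_univ i)))
    (IsLocalization.Away.algebraMap_isUnit _)

variable (k) in
/-- The universal `r`-tuple of invertible functions, on `𝔾_m^r`. -/
def torusCoordinates (r : ℕ) : Fin r → Γ((torus k r).left, ⊤)ˣ := fun i ↦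
  Units.map (Scheme.ΓSpecIso (CommRingCat.of (torusRing k r))).inv.hom.toMonoidHom
    (isUnit_coordinate r i).unit

variable (k) in
/-- A presentation of a quotient stack `[U / 𝔾_m^r]` over `k`. For `r = 0` this is the
scheme `U`. -/
structure QuotientStack where
  rank : ℕ
  atlas : Sch k
  action : TorusAction rank atlas

namespace QuotientStack

variable (𝒴 : QuotientStack k)

/-- The scheme of arrows `𝔾_m^r × U` of the action groupoid. -/
def arrows : Sch k := torus k 𝒴.rank ⨯ 𝒴.atlas

/-- The source map `(t, u) ↦ u`. -/
def source : 𝒴.arrows ⟶ 𝒴.atlas := prod.snd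

/-- The target map `(t, u) ↦ t • u`. -/
def target : 𝒴.arrows ⟶ 𝒴.atlas :=
  𝒴.action.smul (pullbackUnits (prod.fst : torus k 𝒴.rank ⨯ 𝒴.atlas ⟶ _)
    (torusCoordinates k 𝒴.rank)) prod.snd

/-- `[U / 𝔾_m^r]` is a smooth separated Deligne-Mumford stack of finite type over `k`: the atlas
is a smooth variety, and the diagonal of the stack (whose base change to `U × U` is
`𝔾_m^r × U ⟶ U × U`) is unramified and proper. -/
structure IsSmoothDM : Prop where
  atlas : IsSmoothVariety 𝒴.atlas
  unramified : FormallyUnramified (prod.lift 𝒴.source 𝒴.target).left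
  separated : IsProper (prod.lift 𝒴.source 𝒴.target).left

/-- The closed subset `X` of the atlas descends to a closed substack `[X / 𝔾_m^r]`. -/
def IsInvariant (X : Closeds 𝒴.atlas.left) : Prop :=
  X.preimage 𝒴.target.left.continuous = X.preimage 𝒴.source.left.continuous

/-- The center `J̄` on the atlas descends to a center on the stack. -/
def IsInvariantCenter (J : Center 𝒴.atlas) : Prop :=
  ∀ n, (J.ideal n).comap 𝒴.target.left = (J.ideal n).comap 𝒴.source.left

/-- The set of points `|[X / 𝔾_m^r]|`: points of `X` up to the action. -/
def Points (X : Closeds 𝒴.atlas.left) : Type u :=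
  Quot fun x y : X ↦ ∃ z : 𝒴.arrows.left, 𝒴.source.left z = x.1 ∧ 𝒴.target.left z = y.1

/-- The class in `|[X / 𝔾_m^r]|` of a point of `X`. -/
def Points.mk {𝒴 : QuotientStack k} {X : Closeds 𝒴.atlas.left} (p : X) : 𝒴.Points X :=
  Quot.mk _ p

/-- A morphism from `[U / 𝔾_m^r]` to a `k`-scheme: an invariant morphism from `U`. -/
structure Morphism (Y : Sch k) where
  hom : 𝒴.atlas ⟶ Y
  invariant : 𝒴.source ≫ hom = 𝒴.target ≫ hom

namespace Morphism

variable {𝒴} {Y : Sch k} (π : 𝒴.Morphism Y)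

/-- The base change `𝔾_m^r × U ⟶ U ×_Y U` of the diagonal of `[U / 𝔾_m^r]` over `Y`. -/
def diagonal : 𝒴.arrows ⟶ pullback π.hom π.hom :=
  pullback.lift 𝒴.source 𝒴.target π.invariant

/-- `[U / 𝔾_m^r] ⟶ Y` is proper. Closed substacks of a base change `[U ×_Y Z / 𝔾_m^r]` are given
by invariant closed subsets of `U ×_Y Z`. -/
structure IsProper : Prop where
  quasiCompact : QuasiCompact π.hom.left
  finiteType : LocallyOfFiniteType π.hom.left
  separated : AlgebraicGeometry.IsProper π.diagonal.left
  universallyClosed : ∀ {P Z : Sch k} (p : P ⟶ 𝒴.atlas) (q : P ⟶ Z)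
    (g : Z ⟶ Y), IsPullback p q π.hom g → ∀ C : Set P.left, IsClosed C →
    (∀ {S : Sch k} (t : Fin 𝒴.rank → Γ(S.left, ⊤)ˣ) (b b' : S ⟶ P),
      b' ≫ p = 𝒴.action.smul t (b ≫ p) → b' ≫ q = b ≫ q → b.left ⁻¹' C = b'.left ⁻¹' C) →
    IsClosed (q.left '' C)

/-- `[U / 𝔾_m^r] ⟶ Y` is an isomorphism over the open `V ⊆ Y`: over `V`, the atlas is a
`𝔾_m^r`-torsor. -/
structure IsIsoOver (V : Y.left.Opens) : Prop where
  smooth : Smooth (π.hom.left ∣_ V)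
  surjective : Surjective (π.hom.left ∣_ V)
  isIso : IsIso (π.diagonal.left ∣_ ((pullback.fst π.hom π.hom ≫ π.hom).left ⁻¹ᵁ V))

end Morphism

/-- A weighted blowup `Bl_J̄ [U / T] = [B₊ / 𝔾_m × T]`, `T = 𝔾_m^r`, along a center `J̄`
on `[U / T]`. The action of `𝔾_m × T` on `B₊` is the one for which `σ : B₊ ⟶ U` is equivariant
(with `𝔾_m` acting trivially on `U`) and the exceptional function `s` is `T`-invariant
and has `𝔾_m`-weight `-1`. These conditions determine it, because `(σ, s)` identifies
the dense open `{s ≠ 0}` of `B` with `U × 𝔾_m`. -/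
structure WeightedBlowup (J : Center 𝒴.atlas) where
  action : TorusAction (𝒴.rank + 1) J.puncturedCone
  equivariant : ∀ {S : Sch k} (t : Fin (𝒴.rank + 1) → Γ(S.left, ⊤)ˣ) (b : S ⟶ J.puncturedCone),
    action.smul t b ≫ J.puncturedConeι ≫ J.coneToBase =
      𝒴.action.smul (Fin.tail t) (b ≫ J.puncturedConeι ≫ J.coneToBase)
  weight : ∀ {S : Sch k} (t : Fin (𝒴.rank + 1) → Γ(S.left, ⊤)ˣ) (b : S ⟶ J.puncturedCone),
    (action.smul t b ≫ J.puncturedConeι).left.appTop J.exceptional =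
      ((t 0)⁻¹ : Γ(S.left, ⊤)ˣ) * (b ≫ J.puncturedConeι).left.appTop J.exceptional

/-- The weighted blowup as a stack. -/
def WeightedBlowup.stack {𝒴 : QuotientStack k} {J : Center 𝒴.atlas} (W : 𝒴.WeightedBlowup J) :
    QuotientStack k where
  rank := 𝒴.rank + 1
  atlas := J.puncturedCone
  action := W.action

end QuotientStack

/-- The embedded variety `X ⊆ Y` has an embedded resolution of singularities: a modification
`π : Y' ⟶ Y` (a proper morphism which is an isomorphism over a dense open), where `Y'` is
a smooth Deligne-Mumford stack, such that `π` is an isomorphism over the generic point of `X`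
and the strict transform of `X` is smooth. -/
def HasEmbeddedResolution (Y : Sch k) (X : Closeds Y.left) : Prop :=
  ∃ (Y' : QuotientStack k) (π : Y'.Morphism Y) (V : Y.left.Opens),
    Y'.IsSmoothDM ∧ π.IsProper ∧ π.IsIsoOver V ∧ Dense (V : Set Y.left) ∧
    ((X : Set Y.left) ∩ V).Nonempty ∧
    IsSmoothClosed Y'.atlas (Closeds.closure (π.hom.left ⁻¹' ((X : Set Y.left) ∩ V)))

/-! ### Singularity invariants -/

variable (k) in
/-- A rule giving a function on `X` for each closed subvariety `X` of a smooth variety `Y`, with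
values in a totally ordered set `Γ₀`, upper semicontinuous, and taking the value `min Γ₀` exactly at
the nonsingular points of `X`. (Values for other `k`-schemes `Y` are irrelevant.) See `IsWellOrdered`
for the well-ordering of the values. -/
structure SingularityInvariant (Γ₀ : Type*) [LinearOrder Γ₀] [OrderBot Γ₀] where
  val : ∀ (Y : Sch k) (X : Closeds Y.left), X → Γ₀
  upperSemicontinuous : ∀ (Y : Sch k) (X : Closeds Y.left), IsSmoothVariety Y →
    UpperSemicontinuous (val Y X)
  eq_bot_iff : ∀ (Y : Sch k) (X : Closeds Y.left), IsSmoothVariety Y → ∀ p : X,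
    val Y X p = ⊥ ↔ IsNonsingularAt Y X p.1

namespace SingularityInvariant

variable {Γ₀ : Type*} [LinearOrder Γ₀] [OrderBot Γ₀]
  (inv : SingularityInvariant k Γ₀)

/-- The invariant is compatible with smooth morphisms `φ : Y₁ ⟶ Y` and `X₁ = φ⁻¹(X)`. -/
def IsFunctorial : Prop :=
  ∀ (Y₁ Y : Sch k) (φ : Y₁ ⟶ Y), IsSmoothVariety Y₁ →
    IsSmoothVariety Y → Smooth φ.left → ∀ (X : Closeds Y.left)
    (p : X.preimage φ.left.continuous), inv.val Y₁ _ p = inv.val Y X ⟨φ.left p.1, p.2⟩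

/-- The invariant is smooth: its maximal loci are smooth. -/
def IsSmooth : Prop :=
  ∀ (Y : Sch k) (X Z : Closeds Y.left), IsSmoothVariety Y →
    (Z : Set Y.left) = {p | ∃ h : p ∈ X, ∀ q, inv.val Y X q ≤ inv.val Y X ⟨p, h⟩} →
    IsSmoothClosed Y Z

/-- The invariant of a closed substack `[X / 𝔾_m^r]` of `[U / 𝔾_m^r]`: its value at a point is the
value of the invariant at any point above it in the smooth atlas `X ⊆ U`; for a functorial
invariant the choice does not matter. -/
def onStack (𝒴 : QuotientStack k) (X : Closeds 𝒴.atlas.left) (q : 𝒴.Points X) : Γ₀ :=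
  inv.val 𝒴.atlas X (Quot.out q)

/-- In each dimension `n` the values of the invariant form a well-ordered set (this holds
whenever `Γ₀` is well-ordered). The dimension of `[U / 𝔾_m^r]` is `dim U - r`. -/
def IsWellOrdered : Prop :=
  ∀ n : ℕ, Set.IsWF {γ : Γ₀ | ∃ (𝒴 : QuotientStack k) (X : Closeds 𝒴.atlas.left) (q : 𝒴.Points X),
    𝒴.IsSmoothDM ∧ 𝒴.IsInvariant X ∧ IsSmoothOfDimLE 𝒴.atlas (n + 𝒴.rank) ∧
    inv.onStack 𝒴 X q = γ}

/-- `m = max inv_X`, for `X` a closed substack of `𝒴`. -/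
def IsMax (𝒴 : QuotientStack k) (X : Closeds 𝒴.atlas.left) (m : Γ₀) : Prop :=
  IsGreatest (Set.range (inv.onStack 𝒴 X)) m

/-- The center `J̄` satisfies the two conditions of the resolution criterion for `X ⊆ 𝒴`:
the zero locus of `J̄` is the maximal locus of `inv_X`, and `max inv_X = max inv_{BX}`. -/
structure Criterion (𝒴 : QuotientStack k) (X : Closeds 𝒴.atlas.left) (J : Center 𝒴.atlas) :
    Prop where
  zeroLocus_eq : (J.zeroLocus : Set 𝒴.atlas.left) =
    {p | ∃ h : p ∈ X, inv.IsMax 𝒴 X (inv.onStack 𝒴 X (QuotientStack.Points.mk ⟨p, h⟩))}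
  max_eq : ∃ m, inv.IsMax 𝒴 X m ∧
    IsGreatest (Set.range (inv.val J.cone (J.coneTransform X))) m

end SingularityInvariant

end
end WeightedResolution

namespace WeightedResolution
noncomputable section

/-! ### Étale algebras over normal domains; local irreducibility of smooth schemes -/

section

/-! Write R = ⊕ I_n T^n for the coordinate ring of B over an affine open of Y, and m for the common
maximum of the invariant on X and on BX. In monomial charts R is étale over a polynomial ring in the
x_i T^(w_i) and s (`RingFiltration.exists_etale_of_monomial`), and where the center is trivial R is
a Laurent polynomial ring; so B is smooth, of dimension one more than Y.

Strict decrease (`Center.not_hasVal_coneTransform`). Let Z ⊂ B be the locus where the invariant of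
BX equals m. It is smooth, hence locally irreducible (`exists_opens_eq_zero_of_mul_eq_zero`). On {s
≠ 0} = Y × 𝔾_m, functoriality and condition (a) identify Z with V(J̄) × 𝔾_m, so every f T^n with n >
0 vanishes there, and s · f T^n = 0 on all of Z. Suppose that Z has a point b outside the vertex,
with f T^n ≠ 0 at b. Then s = 0 at b. The invariant is constant along 𝔾_m-orbits, so Z contains the
generic point of the orbit closure of b, given by the homogeneous prime inside the prime of b; it
specializes to the point o of the vertex with s = 0 over the image y of b. Since y ∈ V(J̄), Z also
contains the generic point of the line with coordinate s in the vertex over y, and this line passes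
through o as well. Thus neither s nor f T^n vanishes on Z near o although their product does, which
contradicts local irreducibility. As B₊ is open in B, the invariant on the blowup stays below m.

Torus action. A morphism to B is determined by the morphism to Y and the pullback of s whenever the
latter is regular, and under a divisibility condition on the I_n it can be constructed from these
data. On torus × B the function s is regular by flatness, so the action is built at this universal
point and pulled back to all others.

The blowup remains in the given class of stacks, and proper over Y. Some f T^n with n > 0 is a unit
locally on B₊, and 𝔾_m scales it by t^n. In characteristic 0 this makes the stabilizers unramified;
over a valuation ring it makes t integral, because valuation rings are normal, and the diagonal is
proper. For properness over Y, a point of B₊ over an algebraically closed field K is scaled by a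
suitable root so that all x_i T^(w_i) become integral and one becomes 1; it then extends over the
valuation ring (`RingFiltration.exists_twist_integral`).

Resolution. For a singular irreducible strict transform, the center lies properly inside it; so the
blowup is an isomorphism over a smaller dense open set still meeting X, and the new strict transform
is the blowup of the old one, again irreducible. The bound on dim U - r does not change, so the
maxima decrease strictly in one well-ordered set and the process stops at a smooth strict transform.
-/

open TensorProduct in
/-- In an étale algebra over a normal domain, orthogonal elements are separated by an
idempotent. -/
theorem exists_idempotent_of_mul_eq_zero {P S : Type*} [CommRing P] [IsDomain P]
    [IsIntegrallyClosed P] [CommRing S] [Algebra P S] [Algebra.Etale P S] {x y : S}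
    (h : x * y = 0) : ∃ e : S, e * e = e ∧ x * e = x ∧ e * y = 0 := by
  let L := FractionRing P
  let T := S ⊗[P] L
  let alg : Algebra L T := Algebra.TensorProduct.rightAlgebra
  have et : Algebra.Etale L T :=
    .of_equiv (AlgEquiv.ofRingEquiv (f := (Algebra.TensorProduct.comm P L S).toRingEquiv)
      fun r ↦ rfl : L ⊗[P] S ≃ₐ[L] T)
  have red : IsReduced T := Algebra.FormallyUnramified.isReduced_of_field L T
  have fin : Module.Finite L T := Algebra.FormallyUnramified.finite_of_free L T
  have art : IsArtinianRing T := IsArtinianRing.of_finite L T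
  have flat : Module.Flat P S := inferInstance
  have inj : Function.Injective (algebraMap S T) := by
    have := Module.Flat.lTensor_preserves_injective_linearMap (M := S)
      (Algebra.linearMap P L) (IsFractionRing.injective P L)
    intro a b hab
    have h2 := @this (a ⊗ₜ 1) (b ⊗ₜ 1) (by simpa using! hab)
    simpa using congrArg (TensorProduct.rid P S) h2
  obtain ⟨n, z, hz⟩ := IsArtinian.exists_pow_succ_smul_dvd (algebraMap S T x) (1 : T)
  have hz' : (algebraMap S T x) * (algebraMap S T x * z) = algebraMap S T x := by
    have : ((algebraMap S T x) * (1 - algebraMap S T x * z)) ^ (n + 1) = 0 := by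
      have h0 : (algebraMap S T x) ^ n * (1 - algebraMap S T x * z) = 0 := by
        simp only [smul_eq_mul, mul_one, Nat.succ_eq_add_one] at hz
        linear_combination -hz
      rw [mul_pow]
      linear_combination (algebraMap S T x * (1 - algebraMap S T x * z) ^ n) * h0
    have := pow_eq_zero_iff (n.succ_ne_zero) |>.mp this
    rw [mul_sub, mul_one, sub_eq_zero] at this
    exact this.symm
  set e : T := algebraMap S T x * z with he
  have hee : e * e = e := by
    rw [he]; linear_combination z * hz'
  have hint : IsIntegral S e := by
    refine ⟨Polynomial.X ^ 2 - Polynomial.X, ?_, ?_⟩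
    · exact Polynomial.monic_X_pow_sub (Polynomial.degree_X_le.trans_lt (by norm_num))
    · simp [pow_two, hee]
  -- Integral closure commutes with smooth base change and P is its own integral closure in L, so
  -- the integral element e of T already lies in S.
  obtain ⟨w, hw⟩ := (TensorProduct.toIntegralClosure_bijective_of_smooth (R := P) (S := S)
    (B := L)).2 ⟨e, hint⟩
  have hmem : ∀ w : S ⊗[P] integralClosure P L, ∃ a : S,
      ((TensorProduct.toIntegralClosure P S L w : integralClosure S T) : T) = algebraMap S T a := by
    intro w
    induction w with
    | zero => exact ⟨0, by simp⟩
    | add x y hx hy =>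
      obtain ⟨a, ha⟩ := hx
      obtain ⟨b, hb⟩ := hy
      exact ⟨a + b, by rw [map_add, map_add, ← ha, ← hb]; rfl⟩
    | tmul s c =>
      obtain ⟨p, hp⟩ := IsIntegrallyClosed.isIntegral_iff.mp c.2
      refine ⟨p • s, ?_⟩
      change s ⊗ₜ[P] (c : L) = (p • s) ⊗ₜ[P] (1 : L)
      rw [← hp, TensorProduct.smul_tmul, Algebra.smul_def, mul_one]
  obtain ⟨a, ha⟩ := hmem w
  rw [hw] at ha
  change e = _ at ha
  refine ⟨a, inj ?_, inj ?_, inj ?_⟩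
  · rw [map_mul, ← ha, hee]
  · rw [map_mul, ← ha, hz']
  · rw [map_mul, ← ha, map_zero, he]
    rw [mul_right_comm, ← map_mul, h, map_zero, zero_mul]

lemma _root_.RingHom.Etale.exists_idempotent_of_mul_eq_zero {P S : Type*} [CommRing P] [IsDomain P]
    [IsIntegrallyClosed P] [CommRing S] {φ : P →+* S} (hφ : φ.Etale) {x y : S}
    (h : x * y = 0) : ∃ e : S, e * e = e ∧ x * e = x ∧ e * y = 0 := by
  let _ := φ.toAlgebra
  have : Algebra.Etale P S := hφ
  exact WeightedResolution.exists_idempotent_of_mul_eq_zero (P := P) h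

lemma isIntegrallyClosed_mvPolynomial_of_isField (σ : Type*) {A : Type*} [CommRing A]
    (h : IsField A) : IsIntegrallyClosed (MvPolynomial σ A) := by
  let _ : Field A := h.toField
  exact (inferInstance : IsIntegrallyClosed (MvPolynomial σ A))

/-- A scheme smooth over a field is locally irreducible. -/
theorem exists_opens_eq_zero_of_mul_eq_zero {k : Type u} [Field k] {Z : Scheme.{u}}
    (f : Z ⟶ Spec (CommRingCat.of k)) [Smooth f] (z : Z) (O : Z.Opens) (hz : z ∈ O)
    (g h : Γ(Z, O)) (hgh : g * h = 0) :
    ∃ (V : Z.Opens) (hV : V ≤ O), z ∈ V ∧ (Z.presheaf.map (homOfLE hV).op g = 0 ∨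
      Z.presheaf.map (homOfLE hV).op h = 0) := by
  obtain ⟨U, hU, V, hV, hzV, e, hst⟩ := Smooth.exists_isStandardSmooth (O.ι ≫ f) ⟨z, hz⟩
  obtain ⟨n, φ, -, hφ⟩ := hst.exists_etale_mvPolynomial
  -- Spec of a field has one point.
  have hUtop : U = ⊤ := by
    refine top_le_iff.mp fun p _ ↦ ?_
    have := Subsingleton.elim p ((O.ι ≫ f) ⟨z, hz⟩)
    rw [this]
    exact e hzV
  subst hUtop
  have hfield : IsField Γ(Spec (CommRingCat.of k), ⊤) :=
    (Scheme.ΓSpecIso (CommRingCat.of k)).commRingCatIsoToRingEquiv.toMulEquiv.isField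
      (Field.toIsField k)
  have hdom : IsDomain Γ(Spec (CommRingCat.of k), ⊤) := hfield.isDomain
  have hn := isIntegrallyClosed_mvPolynomial_of_isField (Fin n) hfield
  have hle : O.ι ''ᵁ V ≤ O := by
    rintro _ ⟨x, _, rfl⟩; exact x.2
  let ρ : Γ(Z, O) →+* Γ(Z, O.ι ''ᵁ V) := (Z.presheaf.map (homOfLE hle).op).hom
  obtain ⟨a, haa, hx, hy⟩ := hφ.exists_idempotent_of_mul_eq_zero (x := ρ g) (y := ρ h) (show ρ g * ρ h = 0 by rw [← map_mul, hgh, map_zero])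
  let a' : Γ(Z, O.ι ''ᵁ V) := a
  have hz' : z ∈ O.ι ''ᵁ V := ⟨⟨z, hz⟩, hzV, rfl⟩
  -- The stalk at z is local, so one of the two complementary idempotents is a unit near z; h dies
  -- where a' is invertible and g where 1 - a' is.
  have hcov : z ∈ Z.basicOpen a' ∨ z ∈ Z.basicOpen (1 - a') := by
    by_contra hcon
    rw [not_or, Scheme.mem_basicOpen _ _ _ hz', Scheme.mem_basicOpen _ _ _ hz'] at hcon
    obtain ⟨h1, h2⟩ := hcon
    rcases IsLocalRing.isUnit_or_isUnit_of_add_one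
      (a := Z.presheaf.germ _ z hz' a') (b := Z.presheaf.germ _ z hz' (1 - a'))
      (by rw [← map_add, add_sub_cancel, map_one]) with h3 | h3
    · exact h1 h3
    · exact h2 h3
  have key : ∀ (c b : Γ(Z, O.ι ''ᵁ V)), c * b = 0 →
      Z.presheaf.map (homOfLE (Z.basicOpen_le c)).op b = 0 := fun c b hcb ↦ by
    have hu := RingedSpace.isUnit_res_basicOpen Z.toRingedSpace c
    have h3 := congrArg (Z.presheaf.map (homOfLE (Z.basicOpen_le c)).op).hom hcb
    rw [map_mul, map_zero] at h3
    exact (hu.mul_right_eq_zero).mp h3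
  rcases hcov with hc | hc
  · refine ⟨Z.basicOpen a', (Z.basicOpen_le _).trans hle, hc, Or.inr ?_⟩
    have := key a' (ρ h) hy
    rwa [← homOfLE_comp (Z.basicOpen_le a') hle, op_comp, Functor.map_comp]
  · refine ⟨Z.basicOpen (1 - a'), (Z.basicOpen_le _).trans hle, hc, Or.inl ?_⟩
    have := key (1 - a') (ρ g) (by
      have hx' : ρ g * a' = ρ g := hx
      rw [sub_mul, one_mul, mul_comm, hx', sub_self])
    rwa [← homOfLE_comp (Z.basicOpen_le (1 - a')) hle, op_comp, Functor.map_comp]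

end

/-! ### The extended Rees algebra: universal property and grading coaction -/

section

namespace RingFiltration

variable {A : Type u} [CommRing A] (I : RingFiltration A)

lemma monomial_congr {n : ℤ} {f g : A} (h : f = g) (hf : f ∈ I.ideal n.toNat) :
    I.monomial n f hf = I.monomial n g (h ▸ hf) := by subst h; rfl

lemma const_eq_monomial (f : A) :
    I.const f = I.monomial 0 f (by simp [I.ideal_zero]) :=
  Subtype.ext (by simp [const, monomial, T_zero])

lemma coeff_monomial (n : ℤ) (f : A) (hf : f ∈ I.ideal n.toNat) (m : ℤ) :
    (I.monomial n f hf).1.coeff m = if n = m then f else 0 := by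
  change (C f * T n : LaurentPolynomial A).coeff m = _
  rw [← single_eq_C_mul_T, AddMonoidAlgebra.coeff_single, Finsupp.single_apply]

lemma monomial_mul_monomial (n m : ℤ) (f g : A) (hf : f ∈ I.ideal n.toNat)
    (hg : g ∈ I.ideal m.toNat) :
    I.monomial n f hf * I.monomial m g hg = I.monomial (n + m) (f * g)
      (I.antitone (show (n + m).toNat ≤ n.toNat + m.toNat by omega)
        (I.mul_le _ _ (Ideal.mul_mem_mul hf hg))) :=
  Subtype.ext <| by
    change C f * T n * (C g * T m) = C (f * g) * T (n + m)
    rw [T_add, map_mul]; ring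

lemma exceptional_pow (n : ℕ) :
    I.exceptional ^ n = I.monomial (-n) 1 (by simp [I.ideal_zero]) := by
  refine Subtype.ext ?_
  change (C 1 * T (-1) : LaurentPolynomial A) ^ n = C 1 * T (-n)
  rw [map_one, one_mul, one_mul, T_pow]; simp

lemma monomial_eq_const_mul_exceptional_pow (n : ℕ) (f : A) (h) :
    I.monomial (-n) f h = I.const f * I.exceptional ^ n := by
  rw [exceptional_pow, const_eq_monomial, monomial_mul_monomial]
  simp

lemma monomial_mul_exceptional_pow (n : ℕ) (f : A) (h : f ∈ I.ideal n) :
    I.monomial n f h * I.exceptional ^ n = I.const f := by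
  rw [exceptional_pow, monomial_mul_monomial, const_eq_monomial]
  refine Subtype.ext ?_
  change C (f * 1) * T ((n : ℤ) + -n) = C f * T 0
  simp

/-- Induction principle for the extended Rees algebra. -/
lemma extendedRees_induction {p : I.extendedRees → Prop} (h0 : p 0)
    (hadd : ∀ a b, p a → p b → p (a + b)) (hmon : ∀ n f hf, p (I.monomial n f hf))
    (x : I.extendedRees) : p x := by
  obtain ⟨x, hx⟩ := x
  suffices ∀ (s : Finset ℤ) (x : LaurentPolynomial A) (hx : x ∈ I.extendedRees),
      x.coeff.support ⊆ s → p ⟨x, hx⟩ from this _ x hx le_rfl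
  intro s
  induction s using Finset.induction_on with
  | empty =>
    intro x hx hs
    have : x = 0 := LaurentPolynomial.ext fun n ↦ by
      have : n ∉ x.coeff.support := fun h ↦ by simpa using hs h
      simpa using this
    subst this
    exact h0
  | insert n s hn ih =>
    intro x hx hs
    let y := x - C (x.coeff n) * T n
    have hy : y ∈ I.extendedRees := sub_mem hx (I.C_mul_T_mem (hx n))
    have hyc : ∀ m, y.coeff m = x.coeff m - if n = m then x.coeff n else 0 := fun m ↦ by
      change (x - C (x.coeff n) * T n).coeff m = _
      rw [AddMonoidAlgebra.coeff_sub, Finsupp.sub_apply, ← single_eq_C_mul_T,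
        AddMonoidAlgebra.coeff_single, Finsupp.single_apply]
    have h1 := ih y hy fun m hm ↦ by
      rw [Finsupp.mem_support_iff, hyc] at hm
      have hnm : n ≠ m := by rintro rfl; simp at hm
      rw [if_neg hnm, sub_zero] at hm
      exact (Finset.mem_insert.mp (hs (Finsupp.mem_support_iff.mpr hm))).resolve_left hnm.symm
    have h2 := hadd _ _ h1 (hmon n (x.coeff n) (hx n))
    convert h2 using 1
    refine Subtype.ext ?_
    change x = y + C (x.coeff n) * T n
    simp [y]

/-- In A[T, T⁻¹] the element s is the unit T⁻¹. -/
lemma exceptional_regular {p : I.extendedRees} (h : I.exceptional * p = 0) : p = 0 := by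
  refine Subtype.ext ?_
  have h1 : (C 1 * T (-1) : LaurentPolynomial A) * p.1 = 0 := congrArg Subtype.val h
  have h2 : (T 1 : LaurentPolynomial A) * ((C 1 * T (-1)) * p.1) = p.1 := by
    rw [map_one, one_mul, ← mul_assoc, ← T_add]; simp
  rw [← h2, h1, mul_zero]; rfl

variable {I} {S : Type*} [CommRing S]

lemma mul_pow_cancel {c : S} (hc : ∀ x, c * x = 0 → x = 0) (n : ℕ) {x y : S}
    (h : x * c ^ n = y * c ^ n) : x = y := by
  rw [← sub_eq_zero] at h ⊢
  rw [← sub_mul] at h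
  generalize x - y = z at h
  induction n generalizing z with
  | zero => simpa using h
  | succ n ih => exact ih _ (hc _ (by rw [← h]; ring))

/-- Ring maps out of the extended Rees algebra are determined by their values on `A` and `s`,
if the image of `s` is regular. -/
lemma ringHom_ext {φ ψ : I.extendedRees →+* S} (hc : ∀ x, φ I.exceptional * x = 0 → x = 0)
    (h1 : ∀ a, φ (I.const a) = ψ (I.const a)) (h2 : φ I.exceptional = ψ I.exceptional) :
    φ = ψ := by
  ext x
  induction x using I.extendedRees_induction with
  | h0 => simp
  | hadd a b ha hb => rw [map_add, map_add, ha, hb]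
  | hmon n f hf =>
    obtain ⟨n, rfl | rfl⟩ := n.eq_nat_or_neg
    · refine mul_pow_cancel hc n ?_
      conv_rhs => rw [h2]
      rw [← map_pow, ← map_pow, ← map_mul, ← map_mul]
      have := I.monomial_mul_exceptional_pow n f hf
      rw [this, h1]
    · rw [monomial_eq_const_mul_exceptional_pow, map_mul, map_mul, map_pow, map_pow, h1, h2]

lemma exists_ringHom_comp_eq {R S L : Type*} [CommRing R] [CommRing S] [CommRing L] {j : S →+* L}
    (hj : Function.Injective j) (Φ : R →+* L) (h : ∀ x, Φ x ∈ j.range) :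
    ∃ φ : R →+* S, ∀ x, j (φ x) = Φ x := by
  choose φ hφ using h
  exact ⟨⟨⟨⟨φ, hj (by simp [hφ])⟩, fun x y ↦ hj (by simp [hφ])⟩, hj (by simp [hφ]),
    fun x y ↦ hj (by simp [hφ])⟩, hφ⟩

/-- The universal property of the extended Rees algebra among algebras in which `s` is regular. -/
lemma exists_lift (g : A →+* S) (c : S) (hc : ∀ x, c * x = 0 → x = 0)
    (h : ∀ n, ∀ f ∈ I.ideal n, c ^ n ∣ g f) :
    ∃ φ : I.extendedRees →+* S, (∀ a, φ (I.const a) = g a) ∧ φ I.exceptional = c := by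
  -- In S[1/c] there is no choice: f T^n must go to g(f) c^(-n). The divisibility hypothesis puts
  -- these values back into S, which embeds in S[1/c] because c is regular.
  let L := Localization.Away c
  have hinj : Function.Injective (algebraMap S L) := by
    rw [injective_iff_map_eq_zero]
    intro x hx
    obtain ⟨⟨_, n, rfl⟩, hn⟩ := (IsLocalization.map_eq_zero_iff (.powers c) L x).mp hx
    refine mul_pow_cancel hc n (y := 0) ?_
    rw [mul_comm, zero_mul]; exact hn
  let w : Lˣ := (IsLocalization.Away.algebraMap_isUnit (S := L) c).unit
  have hw : (w : L) = algebraMap S L c := rfl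
  obtain ⟨Φ, hm⟩ : ∃ Φ : LaurentPolynomial A →+* L,
      ∀ f n, Φ (C f * T n) = algebraMap S L (g f) * (w⁻¹ ^ n : Lˣ) :=
    ⟨LaurentPolynomial.eval₂ ((algebraMap S L).comp g) w⁻¹,
      fun f n ↦ LaurentPolynomial.eval₂_C_mul_T _ _ _ _⟩
  have hΦ : ∀ x : I.extendedRees, Φ x.1 ∈ (algebraMap S L).range := by
    intro x
    induction x using I.extendedRees_induction with
    | h0 => exact ⟨0, by simp⟩
    | hadd a b ha hb => exact (map_add Φ _ _ ▸ add_mem ha hb : Φ (a.1 + b.1) ∈ _)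
    | hmon n f hf =>
      change Φ (C f * T n) ∈ _
      rw [hm]
      obtain ⟨n, rfl | rfl⟩ := n.eq_nat_or_neg
      · obtain ⟨d, hd⟩ := h n f hf
        refine ⟨d, ?_⟩
        rw [hd, map_mul, map_pow, ← hw]
        simp [mul_assoc, mul_comm _ (algebraMap S L d), ← mul_pow]
      · refine ⟨g f * c ^ n, ?_⟩
        simp [← hw]
  obtain ⟨φ, hφ⟩ := exists_ringHom_comp_eq hinj (Φ.comp I.extendedRees.subtype) hΦ
  refine ⟨φ, fun a ↦ hinj ?_, hinj ?_⟩
  · refine (hφ _).trans ((congrArg Φ (?_ : (I.const a).1 = C a * T 0)).trans ((hm a 0).trans ?_))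
    · rw [T_zero, mul_one]; rfl
    · simp
  · exact (hφ _).trans ((hm 1 (-1)).trans (by simp [hw]))

lemma map_monomial_mul_pow (φ : I.extendedRees →+* S) (n : ℕ) (f : A) (hf : f ∈ I.ideal n) :
    φ (I.monomial n f hf) * φ I.exceptional ^ n = φ (I.const f) := by
  rw [← map_pow, ← map_mul, monomial_mul_exceptional_pow]


lemma map_monomial_neg (φ : I.extendedRees →+* S) (n : ℕ) (f : A) (h) :
    φ (I.monomial (-n) f h) = φ (I.const f) * φ I.exceptional ^ n := by
  rw [monomial_eq_const_mul_exceptional_pow, map_mul, map_pow]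

lemma T_regular {R : Type*} [CommRing R] {c : R} (hc : ∀ x, c * x = 0 → x = 0) (n : ℤ)
    (x : LaurentPolynomial R) (h : C c * T n * x = 0) : x = 0 := by
  have h1 : C c * x = 0 := by
    have h2 : (T (-n) : LaurentPolynomial R) * (C c * T n * x) = C c * x := by
      rw [mul_right_comm, mul_comm, mul_assoc, ← T_add]; simp
    rw [← h2, h, mul_zero]
  refine LaurentPolynomial.ext fun m ↦ hc _ ?_
  have := congrArg (fun p : LaurentPolynomial R ↦ p.coeff m) h1
  simpa [← smul_eq_C_mul] using this

variable (I) in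
-- The universal property applied with s going to s T⁻¹. The required divisibility comes from f = (f
-- T^n) s^n and s^n = (s T⁻¹)^n T^n, where the last T is the new variable.
lemma exists_coaction : ∃ φ : I.extendedRees →+* LaurentPolynomial I.extendedRees,
    (∀ a, φ (I.const a) = C (I.const a)) ∧
      φ I.exceptional = C I.exceptional * T (-1) := by
  refine exists_lift (C.comp I.const) _ (T_regular (fun x ↦ I.exceptional_regular) _)
    fun n f hf ↦ ⟨C (I.monomial n f hf) * T n, ?_⟩
  rw [mul_pow, T_pow, RingHom.comp_apply, ← I.monomial_mul_exceptional_pow n f hf, map_mul, map_pow]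
  have : (T (↑n * -1) * T ↑n : LaurentPolynomial I.extendedRees) = 1 := by
    rw [← T_add]; simp
  linear_combination (-(C I.exceptional ^ n * C (I.monomial n f hf))) * this

variable (I) in
/-- The coaction of `𝔾_m` on the extended Rees algebra defining its grading. -/
def coaction : I.extendedRees →+* LaurentPolynomial I.extendedRees := I.exists_coaction.choose

lemma coaction_const (a : A) : I.coaction (I.const a) = C (I.const a) :=
  I.exists_coaction.choose_spec.1 a

lemma coaction_exceptional : I.coaction I.exceptional = C I.exceptional * T (-1) :=
  I.exists_coaction.choose_spec.2

lemma coaction_monomial (n : ℤ) (f : A) (hf : f ∈ I.ideal n.toNat) :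
    I.coaction (I.monomial n f hf) = C (I.monomial n f hf) * T n := by
  obtain ⟨n, rfl | rfl⟩ := n.eq_nat_or_neg
  · refine mul_pow_cancel (T_regular (fun x ↦ I.exceptional_regular) (-1)) n ?_
    rw [← coaction_exceptional, map_monomial_mul_pow, coaction_const, coaction_exceptional,
      ← I.monomial_mul_exceptional_pow n f hf, mul_pow, T_pow, map_mul, map_pow]
    have : (T (↑n * -1) * T ↑n : LaurentPolynomial I.extendedRees) = 1 := by
      rw [← T_add]; simp
    linear_combination (-(C I.exceptional ^ n * C (I.monomial n f hf))) * this
  · rw [map_monomial_neg, coaction_const, coaction_exceptional,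
      monomial_eq_const_mul_exceptional_pow, mul_pow, T_pow, map_mul, map_pow]
    simp [mul_assoc]

/-- The coaction spreads an element into its homogeneous components, so membership in a prime pulled
back along it can be tested degree by degree. -/
lemma coeff_coaction (x : I.extendedRees) (n : ℤ) :
    (I.coaction x).coeff n = I.monomial n (x.1.coeff n) (x.2 n) := by
  induction x using I.extendedRees_induction with
  | h0 => 
    refine Subtype.ext ?_
    simp [monomial]
  | hadd a b ha hb =>
    rw [map_add, AddMonoidAlgebra.coeff_add, Finsupp.add_apply, ha, hb]
    refine Subtype.ext ?_
    change C _ * T n + C _ * T n = C (a.1.coeff n + b.1.coeff n) * T n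
    rw [map_add, add_mul]
  | hmon m f hf =>
    rw [coaction_monomial, ← single_eq_C_mul_T, AddMonoidAlgebra.coeff_single,
      Finsupp.single_apply]
    refine Subtype.ext ?_
    split_ifs with h
    · subst h
      change C f * T m = C ((I.monomial m f hf).1.coeff m) * T m
      rw [coeff_monomial, if_pos rfl]
    · change 0 = C ((I.monomial m f hf).1.coeff n) * T n
      rw [coeff_monomial, if_neg h]; simp

variable (I) in
/-- The automorphism of `R[t, t⁻¹]`, for `R` the extended Rees algebra, extending the coaction. -/
lemma exists_coaction_equiv : ∃ e : LaurentPolynomial I.extendedRees ≃+*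
    LaurentPolynomial I.extendedRees, ∀ x, e (C x) = I.coaction x := by
  -- The inverse coaction, sending s to s T. Extended by fixing T, it inverts the extension of the
  -- coaction; both composites are checked on constants and on s.
  obtain ⟨φ, h1, h2⟩ : ∃ φ : I.extendedRees →+* LaurentPolynomial I.extendedRees,
      (∀ a, φ (I.const a) = C (I.const a)) ∧ φ I.exceptional = C I.exceptional * T 1 := by
    refine exists_lift (C.comp I.const) _ (T_regular (fun x ↦ I.exceptional_regular) _)
      fun n f hf ↦ ⟨C (I.monomial n f hf) * T (-n), ?_⟩
    rw [mul_pow, T_pow, RingHom.comp_apply, ← I.monomial_mul_exceptional_pow n f hf, map_mul,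
      map_pow]
    have : (T (↑n * 1) * T (-n) : LaurentPolynomial I.extendedRees) = 1 := by
      rw [← T_add]; simp
    linear_combination (-(C I.exceptional ^ n * C (I.monomial n f hf))) * this
  let t : (LaurentPolynomial I.extendedRees)ˣ := ⟨T 1, T (-1), by rw [← T_add]; simp,
    by rw [← T_add]; simp⟩
  have ht : ∀ n : ℤ, ((t ^ n : (LaurentPolynomial I.extendedRees)ˣ) :
      LaurentPolynomial I.extendedRees) = T n := fun n ↦ by
    obtain ⟨n, rfl | rfl⟩ := n.eq_nat_or_neg
    · simp [t, T_pow]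
    · simp [t, T_pow, ← inv_pow]
  let e := LaurentPolynomial.eval₂ I.coaction t
  let e' := LaurentPolynomial.eval₂ φ t
  have heC : ∀ x, e (C x) = I.coaction x := fun x ↦ by simp [e]
  have heC' : ∀ x, e' (C x) = φ x := fun x ↦ by simp [e']
  have heT : ∀ n : ℤ, e (T n) = T n := fun n ↦ by rw [eval₂_T, ht]
  have heT' : ∀ n : ℤ, e' (T n) = T n := fun n ↦ by rw [eval₂_T, ht]
  have k1 : e.comp φ = C := by
    refine ringHom_ext ?_ ?_ ?_
    · have : (e.comp φ) I.exceptional = C I.exceptional * T 0 := by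
        rw [RingHom.comp_apply, h2, map_mul, heC, heT, coaction_exceptional, mul_assoc, ← T_add]
        simp
      rw [this]
      exact T_regular (fun x ↦ I.exceptional_regular) _
    · intro a; rw [RingHom.comp_apply, h1, heC, coaction_const]
    · rw [RingHom.comp_apply, h2, map_mul, heC, heT, coaction_exceptional, mul_assoc, ← T_add]
      simp
  have k2 : e'.comp I.coaction = C := by
    refine ringHom_ext ?_ ?_ ?_
    · have : (e'.comp I.coaction) I.exceptional = C I.exceptional * T 0 := by
        rw [RingHom.comp_apply, coaction_exceptional, map_mul, heC', heT', h2, mul_assoc, ← T_add]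
        simp
      rw [this]
      exact T_regular (fun x ↦ I.exceptional_regular) _
    · intro a; rw [RingHom.comp_apply, coaction_const, heC', h1]
    · rw [RingHom.comp_apply, coaction_exceptional, map_mul, heC', heT', h2, mul_assoc, ← T_add]
      simp
  have k3 : ∀ x, e (e' x) = x := fun x ↦ by
    induction x using LaurentPolynomial.induction_on' with
    | add p q hp hq => rw [map_add, map_add, hp, hq]
    | C_mul_T n a =>
      rw [map_mul, map_mul, heC', heT', heT]
      exact congrArg (· * T n) (RingHom.congr_fun k1 a)
  have k4 : ∀ x, e' (e x) = x := fun x ↦ by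
    induction x using LaurentPolynomial.induction_on' with
    | add p q hp hq => rw [map_add, map_add, hp, hq]
    | C_mul_T n a =>
      rw [map_mul, map_mul, heC, heT, heT']
      exact congrArg (· * T n) (RingHom.congr_fun k2 a)
  exact ⟨{ e with invFun := e', left_inv := k4, right_inv := k3 }, heC⟩

variable (I) in
/-- Inverting `s` in the extended Rees algebra gives the Laurent polynomial ring. -/
lemma isLocalization_subtype :
    letI := I.extendedRees.subtype.toAlgebra
    IsLocalization.Away I.exceptional (LaurentPolynomial A) := by
  let _ := I.extendedRees.subtype.toAlgebra
  have halg : ∀ x : I.extendedRees, algebraMap I.extendedRees (LaurentPolynomial A) x = x.1 :=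
    fun _ ↦ rfl
  have hs : ∀ n : ℕ, (I.exceptional ^ n).1 = T (-n) := fun n ↦ by
    rw [exceptional_pow]; simp [monomial]
  refine ⟨⟨?_, ?_, ?_⟩⟩
  · rintro ⟨_, n, rfl⟩
    dsimp only
    rw [halg, hs]
    exact isUnit_T _
  · intro p
    -- Multiplication by s^N moves p into degrees at most 0, where the ideals are all of A.
    let N := p.coeff.support.sup Int.toNat
    have hN : ∀ n ∈ p.coeff.support, n.toNat ≤ N := fun n hn ↦ Finset.le_sup hn
    refine ⟨(⟨p * T (-N), fun n ↦ ?_⟩, ⟨_, N, rfl⟩), ?_⟩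
    · have : (p * T (-N)).coeff n = p.coeff (n + N) := by
        rw [T, AddMonoidAlgebra.coeff_mul_single_apply]; simp
      rw [this]
      by_cases h : n + N ∈ p.coeff.support
      · have := hN _ h
        have : n.toNat = 0 := by omega
        rw [this, I.ideal_zero]; trivial
      · rw [Finsupp.notMem_support_iff.mp h]; exact zero_mem _
    · dsimp only
      rw [halg, halg, hs]
  · intro x y h
    exact ⟨1, by rw [Subtype.ext h]⟩

end RingFiltration

end

/-! ### Monomial filtrations in étale coordinates -/

section

namespace RingFiltration

variable {A : Type u} [CommRing A] {I : RingFiltration A}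

open TensorProduct in
-- Here P is to be the ring of the coordinates x_i, Q that of the x'_i and s, and θ the substitution
-- x_i = s^(w_i) x'_i. The extended Rees algebra is the base change S = Q ⊗_P A, hence étale over Q.
-- The map S → R is the obvious one. Its inverse comes from the universal property of R, since s
-- stays regular on the flat Q-algebra S.
lemma etale_of_monomial_aux {d : ℕ} {P Q : Type u} [CommRing P] [CommRing Q] {X : Fin d → P}
    {w : Fin d → ℕ} {s : Q} {x' : Fin d → Q} {φ : P →+* A} {θ : P →+* Q}
    {ψ : Q →+* I.extendedRees} (hφ : φ.Etale) (hs : ∀ q, s * q = 0 → q = 0)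
    (hI : ∀ n, I.ideal n =
      Ideal.span {f | ∃ m : Fin d → ℕ, n ≤ ∑ i, w i * m i ∧ f = ∏ i, φ (X i) ^ m i})
    (hθ : ∀ i, θ (X i) = s ^ w i * x' i) (hψs : ψ s = I.exceptional)
    (hψ : ψ.comp θ = I.const.comp φ)
    (hQ : ∀ T : Subring Q, s ∈ T → (∀ i, x' i ∈ T) → θ.range ≤ T → T = ⊤) : ψ.Etale := by
  algebraize [φ, θ, ψ, I.const, I.const.comp φ]
  have : IsScalarTower P Q I.extendedRees := .of_algebraMap_eq' hψ.symm
  have : Algebra.Etale P A := hφ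
  let S := Q ⊗[P] A
  have : Algebra.Etale Q S := inferInstance
  have : Module.Flat Q S := inferInstance
  have hPA : ∀ p, algebraMap P A p = φ p := fun _ ↦ rfl
  have hPQ : ∀ p, algebraMap P Q p = θ p := fun _ ↦ rfl
  have hsw : ∀ p : P, (1 : Q) ⊗ₜ[P] φ p = θ p ⊗ₜ[P] (1 : A) := fun p ↦ by
    rw [← hPA, ← hPQ, Algebra.algebraMap_eq_smul_one, Algebra.algebraMap_eq_smul_one,
      TensorProduct.smul_tmul]
  have hc : ∀ x : S, algebraMap Q S s * x = 0 → x = 0 := by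
    have h1 : IsSMulRegular Q s := fun a b hab ↦ by
      rw [← sub_eq_zero]; exact hs _ (by rw [mul_sub, sub_eq_zero]; exact hab)
    have h2 : IsSMulRegular S (algebraMap Q S s) := IsSMulRegular.of_flat h1
    intro x hx
    exact h2 (by simpa using hx)
  let g : A →+* S := (Algebra.TensorProduct.includeRight : A →ₐ[P] S).toRingHom
  have hg : ∀ p, g (φ p) = algebraMap Q S (θ p) := hsw
  -- A monomial of weighted degree at least n acquires a factor s^n in S.
  obtain ⟨χ, hχ1, hχ2⟩ := exists_lift (I := I) g (algebraMap Q S s) hc fun n f hf ↦ by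
    rw [hI] at hf
    rw [← Ideal.mem_span_singleton, ← Ideal.mem_comap]
    revert f
    change Ideal.span _ ≤ _
    rw [Ideal.span_le]
    rintro _ ⟨m, hm, rfl⟩
    rw [SetLike.mem_coe, Ideal.mem_comap, Ideal.mem_span_singleton]
    simp only [map_prod, map_pow, hg, hθ, map_mul, mul_pow, Finset.prod_mul_distrib, ← pow_mul,
      Finset.prod_pow_eq_pow_sum]
    exact (pow_dvd_pow _ hm).mul_right _
  let ψ' : S →ₐ[Q] I.extendedRees := Algebra.TensorProduct.lift (Algebra.ofId Q _)
    (⟨I.const, fun p ↦ by rfl⟩ : A →ₐ[P] I.extendedRees) (fun _ _ ↦ Commute.all _ _)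
  have hψ'1 : ∀ q, ψ' (algebraMap Q S q) = ψ q := fun q ↦ ψ'.commutes q
  have hψ'2 : ∀ a, ψ' (g a) = I.const a := fun a ↦ by
    have := Algebra.TensorProduct.lift_tmul (Algebra.ofId Q _)
      (⟨I.const, fun p ↦ by rfl⟩ : A →ₐ[P] I.extendedRees) (fun _ _ ↦ Commute.all _ _) 1 a
    rw [map_one, one_mul] at this
    exact this
  have hinv1 : ψ'.toRingHom.comp χ = RingHom.id _ := by
    have h2 : (ψ'.toRingHom.comp χ) I.exceptional = I.exceptional := by
      rw [RingHom.comp_apply, hχ2]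
      exact (hψ'1 s).trans hψs
    refine ringHom_ext ?_ ?_ ?_
    · rw [h2]; exact fun x ↦ I.exceptional_regular
    · intro a
      rw [RingHom.comp_apply, hχ1]
      exact hψ'2 a
    · exact h2
  have hinv2 : ∀ q, χ (ψ q) = algebraMap Q S q := by
    have hθr : ∀ p, χ (ψ (θ p)) = algebraMap Q S (θ p) := fun p ↦ by
      rw [show ψ (θ p) = I.const (φ p) from RingHom.congr_fun hψ p, hχ1, hg]
    -- It suffices to compare on the generators of Q; for x'_i the equality is that for x_i after
    -- cancelling the regular element s^(w_i).
    have := hQ ((χ.comp ψ).eqLocus (algebraMap Q S)) (by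
      change χ (ψ s) = _
      rw [hψs, hχ2]) (fun i ↦ by
      change χ (ψ (x' i)) = _
      refine mul_pow_cancel hc (w i) ?_
      have := hθr (X i)
      rw [hθ, map_mul, map_mul, map_mul, map_pow, map_pow, map_pow, hψs, hχ2] at this
      rw [mul_comm, this, mul_comm]) (by
      rintro _ ⟨p, rfl⟩
      exact hθr p)
    intro q
    exact (this ▸ Subring.mem_top q : q ∈ (χ.comp ψ).eqLocus (algebraMap Q S))
  have hinv3 : ∀ y, χ (ψ' y) = y := fun y ↦ by
    induction y using TensorProduct.induction_on with
    | zero => simp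
    | add a b ha hb => rw [map_add, map_add, ha, hb]
    | tmul q a =>
      have : q ⊗ₜ[P] a = algebraMap Q S q * g a := by
        change q ⊗ₜ[P] a = (q ⊗ₜ[P] 1) * (1 ⊗ₜ[P] a)
        simp
      rw [this, map_mul, map_mul, hψ'1, hψ'2, hinv2, hχ1]
  let e : S ≃ₐ[Q] I.extendedRees := AlgEquiv.ofBijective ψ'
    ⟨fun a b hab ↦ by rw [← hinv3 a, ← hinv3 b, hab],
      fun r ↦ ⟨χ r, RingHom.congr_fun hinv1 r⟩⟩
  exact (Algebra.Etale.of_equiv e : Algebra.Etale Q I.extendedRees)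

/-- The extended Rees algebra of a filtration by monomials in étale coordinates is étale over the
polynomial ring in the transformed coordinates `x_i T^{w_i}` and `s`. -/
theorem exists_etale_of_monomial {k : Type u} [CommRing k] {d : ℕ} (w : Fin d → ℕ)
    (φ : MvPolynomial (Fin d) k →+* A) (hφ : φ.Etale)
    (hI : ∀ n, I.ideal n = Ideal.span {f | ∃ m : Fin d → ℕ, n ≤ ∑ i, w i * m i ∧
      f = ∏ i, φ (MvPolynomial.X i) ^ m i}) :
    ∃ ψ : Polynomial (MvPolynomial (Fin d) k) →+* I.extendedRees, ψ.Etale ∧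
      ∀ c, ψ (Polynomial.C (MvPolynomial.C c)) = I.const (φ (MvPolynomial.C c)) := by
  have hmem : ∀ i, φ (MvPolynomial.X i) ∈ I.ideal (w i) := fun i ↦ by
    rw [hI]
    refine Ideal.subset_span ⟨Pi.single i 1, ?_, ?_⟩
    · simp [Pi.single_apply]
    · simp [Pi.single_apply, pow_ite]
  let x' : Fin d → I.extendedRees := fun i ↦ I.monomial (w i : ℕ) (φ (MvPolynomial.X i)) (hmem i)
  let ψ₀ : MvPolynomial (Fin d) k →+* I.extendedRees :=
    MvPolynomial.eval₂Hom (I.const.comp (φ.comp MvPolynomial.C)) x'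
  let ψ : Polynomial (MvPolynomial (Fin d) k) →+* I.extendedRees :=
    Polynomial.eval₂RingHom ψ₀ I.exceptional
  let θ : MvPolynomial (Fin d) k →+* Polynomial (MvPolynomial (Fin d) k) :=
    MvPolynomial.eval₂Hom (Polynomial.C.comp MvPolynomial.C)
      fun i ↦ Polynomial.X ^ w i * Polynomial.C (MvPolynomial.X i)
  have hθC : ∀ c, θ (MvPolynomial.C c) = Polynomial.C (MvPolynomial.C c) := fun c ↦ by simp [θ]
  refine ⟨ψ, etale_of_monomial_aux (X := MvPolynomial.X) (w := w) (s := Polynomial.X)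
    (x' := fun i ↦ Polynomial.C (MvPolynomial.X i)) (θ := θ) hφ ?_ hI ?_ ?_ ?_ ?_, ?_⟩
  · intro q hq
    refine Polynomial.ext fun n ↦ ?_
    have := congrArg (fun p ↦ p.coeff (n + 1)) hq
    simpa [mul_comm Polynomial.X, Polynomial.coeff_mul_X] using this
  · intro i; simp [θ]
  · simp [ψ]
  · refine MvPolynomial.ringHom_ext (fun c ↦ ?_) (fun i ↦ ?_)
    · simp [ψ, ψ₀, θ]
    · simp only [RingHom.comp_apply, θ, MvPolynomial.eval₂Hom_X', map_mul, map_pow]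
      simp only [ψ, Polynomial.coe_eval₂RingHom, Polynomial.eval₂_X, Polynomial.eval₂_C, ψ₀,
        MvPolynomial.eval₂Hom_X', x']
      rw [mul_comm, monomial_mul_exceptional_pow]
  · intro T h1 h2 h3
    have h4 : ∀ p : MvPolynomial (Fin d) k, Polynomial.C p ∈ T := fun p ↦ by
      induction p using MvPolynomial.induction_on with
      | C a => rw [← hθC]; exact h3 ⟨_, rfl⟩
      | add p q hp hq => rw [map_add]; exact add_mem hp hq
      | mul_X p i hp => rw [map_mul]; exact mul_mem hp (h2 i)
    refine top_le_iff.mp fun q _ ↦ ?_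
    induction q using Polynomial.induction_on with
    | C a => exact h4 a
    | add p q hp hq => exact add_mem (hp trivial) (hq trivial)
    | monomial n a h => exact mul_mem (h4 a) (pow_mem h1 _)
  · intro c; simp [ψ, ψ₀]

end RingFiltration

end

section

/-! ### Morphisms to affine schemes -/

/-- The morphism to an affine scheme given by a ring map to global sections. -/
def toSpec {Z : Scheme.{u}} {R : Type u} [CommRing R] (φ : R →+* Γ(Z, ⊤)) :
    Z ⟶ Spec (CommRingCat.of R) :=
  Z.toSpecΓ ≫ Spec.map (CommRingCat.ofHom φ)

section toSpec

variable {Z Z' : Scheme.{u}} {R S : Type u} [CommRing R] [CommRing S]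

lemma toSpec_appTop (φ : R →+* Γ(Z, ⊤)) (r : R) :
    (toSpec φ).appTop ((Scheme.ΓSpecIso (CommRingCat.of R)).inv r) = φ r := by
  have h : (Scheme.ΓSpecIso (CommRingCat.of R)).inv ≫ (toSpec φ).appTop = CommRingCat.ofHom φ := by
    rw [toSpec, Scheme.Hom.comp_appTop, ← Scheme.ΓSpecIso_inv_naturality_assoc,
      Scheme.toSpecΓ_appTop, Iso.inv_hom_id, Category.comp_id]
  exact congr($h r)

lemma toSpec_injective {φ ψ : R →+* Γ(Z, ⊤)} (h : toSpec φ = toSpec ψ) : φ = ψ := by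
  ext r
  rw [← toSpec_appTop, h, toSpec_appTop]

lemma exists_eq_toSpec (g : Z ⟶ Spec (CommRingCat.of R)) : ∃ φ : R →+* Γ(Z, ⊤), g = toSpec φ := by
  refine ⟨((Scheme.ΓSpecIso (CommRingCat.of R)).inv ≫ g.appTop).hom, ?_⟩
  rw [toSpec, CommRingCat.ofHom_hom, Spec.map_comp, ← Scheme.toSpecΓ_naturality_assoc]
  simp [toSpecΓ_SpecMap_ΓSpecIso_inv]

lemma comp_toSpec (g : Z' ⟶ Z) (φ : R →+* Γ(Z, ⊤)) :
    g ≫ toSpec φ = toSpec (g.appTop.hom.comp φ) := by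
  rw [toSpec, Scheme.toSpecΓ_naturality_assoc, ← Spec.map_comp]; rfl

lemma toSpec_comp_map (φ : R →+* Γ(Z, ⊤)) (ψ : S →+* R) :
    toSpec φ ≫ Spec.map (CommRingCat.ofHom ψ) = toSpec (φ.comp ψ) := by
  rw [toSpec, Category.assoc, ← Spec.map_comp]; rfl

lemma toSpec_preimage_basicOpen (φ : R →+* Γ(Z, ⊤)) (r : R) :
    toSpec φ ⁻¹ᵁ (PrimeSpectrum.basicOpen r : (Spec (CommRingCat.of R)).Opens) =
      Z.basicOpen (φ r) :=
  (Scheme.Hom.comp_preimage _ _ _).trans (Z.toSpecΓ_preimage_basicOpen (φ r))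

lemma toSpec_spec (φ : R →+* S) :
    toSpec ((Scheme.ΓSpecIso (CommRingCat.of S)).inv.hom.comp φ) =
      Spec.map (CommRingCat.ofHom φ) := by
  rw [toSpec, CommRingCat.ofHom_comp, Spec.map_comp, CommRingCat.ofHom_hom,
    toSpecΓ_SpecMap_ΓSpecIso_inv_assoc]

end toSpec

/-! ### Regular sections -/

/-- A global section is regular if its germs are nonzerodivisors. -/
def IsRegularSection {Z : Scheme.{u}} (c : Γ(Z, ⊤)) : Prop :=
  ∀ z : Z, ∀ x : Z.presheaf.stalk z, Z.presheaf.germ ⊤ z trivial c * x = 0 → x = 0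

namespace IsRegularSection

variable {Z Z' : Scheme.{u}} {c : Γ(Z, ⊤)}

lemma eq_zero (hc : IsRegularSection c) {x : Γ(Z, ⊤)} (h : c * x = 0) : x = 0 := by
  refine TopCat.Presheaf.section_ext Z.sheaf _ _ _ fun z hz ↦ ?_
  refine (hc z _ ?_).trans (map_zero (Z.presheaf.germ ⊤ z hz).hom).symm
  change _ * Z.presheaf.germ ⊤ z hz x = 0
  rw [← map_mul, h, map_zero]

lemma of_isUnit (hc : IsUnit c) : IsRegularSection c := fun z x h ↦ by
  have := hc.map (Z.presheaf.germ ⊤ z trivial).hom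
  exact (this.mul_right_eq_zero).mp h

lemma mul {c' : Γ(Z, ⊤)} (hc : IsRegularSection c) (hc' : IsRegularSection c') :
    IsRegularSection (c * c') := fun z x h ↦ by
  rw [map_mul, mul_assoc] at h
  exact hc' z x (hc z _ h)

lemma germ_appTop (g : Z' ⟶ Z) (z : Z') (c : Γ(Z, ⊤)) :
    Z'.presheaf.germ ⊤ z trivial (g.appTop c) =
      g.stalkMap z (Z.presheaf.germ ⊤ (g z) trivial c) :=
  (Scheme.Hom.germ_stalkMap_apply g ⊤ z trivial c).symm

/-- A nonzerodivisor stays one after a flat map of stalks. This covers open restrictions and the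
projections torus × B → B; for an arbitrary morphism to B, the pullback of s may well be zero. -/
lemma comp_flat (hc : IsRegularSection c) (g : Z' ⟶ Z) [Flat g] :
    IsRegularSection (g.appTop c) := fun z x h ↦ by
  have hf := Flat.stalkMap g z
  algebraize [(g.stalkMap z).hom]
  have h1 : IsSMulRegular (Z.presheaf.stalk (g z)) (Z.presheaf.germ ⊤ (g z) trivial c) :=
    fun a b hab ↦ by
      rw [← sub_eq_zero]; exact hc _ _ (by rw [mul_sub, sub_eq_zero]; exact hab)
  have h2 : IsSMulRegular (Z'.presheaf.stalk z) (algebraMap _ (Z'.presheaf.stalk z)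
    (Z.presheaf.germ ⊤ (g z) trivial c)) := IsSMulRegular.of_flat h1
  refine h2 ?_
  simp only [smul_eq_mul, mul_zero]
  rw [germ_appTop] at h
  exact h

lemma of_forall_exists (h : ∀ z : Z, ∃ (U : Scheme.{u}) (f : U ⟶ Z) (_ : IsOpenImmersion f),
    z ∈ f.opensRange ∧ IsRegularSection (f.appTop c)) : IsRegularSection c := by
  intro z x hx
  obtain ⟨U, f, _, ⟨y, rfl⟩, hy⟩ := h z
  have := hy y (f.stalkMap y x) (by rw [germ_appTop, ← map_mul, hx, map_zero])
  exact (ConcreteCategory.bijective_of_isIso (f.stalkMap y)).1 (this.trans (map_zero _).symm)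

lemma spec {R : Type u} [CommRing R] {r : R} (hr : ∀ x, r * x = 0 → x = 0) :
    IsRegularSection ((Scheme.ΓSpecIso (CommRingCat.of R)).inv r) := by
  intro (z : PrimeSpectrum R) x h
  let alg : Algebra R ((Spec (CommRingCat.of R)).presheaf.stalk z) :=
    inferInstanceAs (Algebra R ((Spec.structureSheaf R).presheaf.stalk z))
  have : IsLocalization.AtPrime ((Spec (CommRingCat.of R)).presheaf.stalk z) z.asIdeal :=
    inferInstanceAs
      (IsLocalization.AtPrime ((Spec.structureSheaf R).presheaf.stalk z) z.asIdeal)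
  obtain ⟨⟨a, t⟩, ha⟩ := IsLocalization.surj z.asIdeal.primeCompl x
  have h0 : (Spec (CommRingCat.of R)).presheaf.germ ⊤ z trivial
      ((Scheme.ΓSpecIso (CommRingCat.of R)).inv r) = algebraMap R _ r := rfl
  rw [h0] at h
  have h1 : algebraMap R ((Spec (CommRingCat.of R)).presheaf.stalk z) (r * a) = 0 := by
    rw [map_mul, ← ha, ← mul_assoc, h, zero_mul]
  obtain ⟨v, hv⟩ := (IsLocalization.map_eq_zero_iff z.asIdeal.primeCompl _ _).mp h1
  have h2 := hr (v * a) (by rw [← hv]; ring)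
  have h3 : algebraMap R ((Spec (CommRingCat.of R)).presheaf.stalk z) a = 0 :=
    (IsLocalization.map_eq_zero_iff z.asIdeal.primeCompl _ _).mpr ⟨v, h2⟩
  dsimp only at ha
  rw [h3] at ha
  exact ((IsLocalization.map_units _ t).mul_left_eq_zero).mp ha

end IsRegularSection

/-! ### Points of the deformation to the weighted normal cone -/

namespace IdealFiltration

open Scheme (AffineZariskiSite)

variable {Y : Scheme.{u}} (J : IdealFiltration Y)

lemma chart_toBase (U : Y.AffineZariskiSite) : J.chart U ≫ J.toBase =
    Spec.map (CommRingCat.ofHom (J.sections U).const) ≫ U.2.fromSpec :=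
  J.normalConeGluing.ι_toBase U

lemma toBase_preimage (U : Y.AffineZariskiSite) :
    J.toBase ⁻¹ᵁ U.1 = (J.chart U).opensRange := by
  have := J.normalConeGluing.toBase_preimage_eq_opensRange_ι U
  rw [show ((AffineZariskiSite.directedCover Y).f U).opensRange = U.1 from
    Scheme.Opens.opensRange_ι _] at this
  exact this

lemma chart_parameterMap (U : Y.AffineZariskiSite) :
    J.chart U ≫ J.parameterMap = Spec.map (CommRingCat.ofHom (J.parameter U)) :=
  colimit.ι_desc _ _

lemma chart_exceptional (U : Y.AffineZariskiSite) :
    (J.chart U).appTop J.exceptional =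
      (Scheme.ΓSpecIso (CommRingCat.of (J.sections U).extendedRees)).inv
        (J.sections U).exceptional := by
  have h1 : (J.chart U).appTop J.exceptional = (J.chart U ≫ J.parameterMap).appTop
      ((Scheme.ΓSpecIso _).inv (Polynomial.X (R := ULift.{u} ℤ))) := by
    rw [Scheme.Hom.comp_appTop]; rfl
  have h2 := Scheme.ΓSpecIso_inv_naturality (CommRingCat.ofHom (J.parameter U))
  rw [h1, chart_parameterMap]
  refine (congr($h2 (Polynomial.X (R := ULift.{u} ℤ)))).symm.trans ?_
  change (Scheme.ΓSpecIso (CommRingCat.of (J.sections U).extendedRees)).inv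
    (J.parameter U Polynomial.X) = _
  simp [parameter]

instance isAffineHom_toBase : IsAffineHom J.toBase := by
  refine ⟨fun U hU ↦ ?_⟩
  let W : Y.AffineZariskiSite := ⟨U, hU⟩
  have h := J.toBase_preimage W
  change J.toBase ⁻¹ᵁ U = _ at h
  rw [h]
  exact isAffineOpen_opensRange (J.chart W)

lemma exists_mem_affine (y : Y) : ∃ U : Y.AffineZariskiSite, y ∈ U.1 := by
  obtain ⟨U, hU⟩ := TopologicalSpace.Opens.mem_iSup.mp
      ((iSup_affineOpens_eq_top Y).ge (Set.mem_univ y))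
  exact ⟨U, hU⟩

lemma isRegularSection_exceptional : IsRegularSection J.exceptional := by
  refine .of_forall_exists fun z ↦ ?_
  obtain ⟨U, hU⟩ := exists_mem_affine (J.toBase z)
  refine ⟨_, J.chart U, inferInstance, ?_, ?_⟩
  · rw [← toBase_preimage]; exact hU
  · rw [chart_exceptional]
    exact .spec fun x ↦ (J.sections U).exceptional_regular

section Points

variable {Z Z' : Scheme.{u}} (U : Y.AffineZariskiSite)

variable {J U} in
/-- The morphism to the chart of `B` over `U` given by a ring map on the extended Rees algebra. -/
def ofRingHom (φ : (J.sections U).extendedRees →+* Γ(Z, ⊤)) : Z ⟶ J.normalCone :=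
  toSpec φ ≫ J.chart U

variable {J U}

lemma exists_eq_ofRingHom (b : Z ⟶ J.normalCone) (h : ∀ z, J.toBase (b z) ∈ U.1) :
    ∃ φ : (J.sections U).extendedRees →+* Γ(Z, ⊤), b = ofRingHom φ := by
  have hr : Set.range b ⊆ Set.range (J.chart U) := by
    rintro _ ⟨z, rfl⟩
    have : b z ∈ (J.chart U).opensRange := by rw [← toBase_preimage]; exact h z
    exact this
  obtain ⟨φ, hφ⟩ := exists_eq_toSpec (IsOpenImmersion.lift (J.chart U) b hr)
  exact ⟨φ, by rw [ofRingHom, ← hφ, IsOpenImmersion.lift_fac]⟩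

lemma ofRingHom_injective {φ ψ : (J.sections U).extendedRees →+* Γ(Z, ⊤)}
    (h : ofRingHom φ = ofRingHom ψ) : φ = ψ :=
  toSpec_injective ((cancel_mono (J.chart U)).mp h)

lemma comp_ofRingHom (g : Z' ⟶ Z) (φ : (J.sections U).extendedRees →+* Γ(Z, ⊤)) :
    g ≫ ofRingHom φ = ofRingHom (g.appTop.hom.comp φ) := by
  rw [ofRingHom, ← Category.assoc, comp_toSpec]; rfl

lemma ofRingHom_toBase (φ : (J.sections U).extendedRees →+* Γ(Z, ⊤)) :
    ofRingHom φ ≫ J.toBase = toSpec (φ.comp (J.sections U).const) ≫ U.2.fromSpec := by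
  rw [ofRingHom, Category.assoc, chart_toBase, ← Category.assoc, toSpec_comp_map]

lemma ofRingHom_exceptional (φ : (J.sections U).extendedRees →+* Γ(Z, ⊤)) :
    (ofRingHom φ).appTop J.exceptional = φ (J.sections U).exceptional := by
  rw [ofRingHom, Scheme.Hom.comp_appTop, CommRingCat.comp_apply, chart_exceptional, toSpec_appTop]

lemma comp_const_eq_of_toBase_eq {φ ψ : (J.sections U).extendedRees →+* Γ(Z, ⊤)}
    (h : ofRingHom φ ≫ J.toBase = ofRingHom ψ ≫ J.toBase) :
    φ.comp (J.sections U).const = ψ.comp (J.sections U).const := by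
  rw [ofRingHom_toBase, ofRingHom_toBase] at h
  exact toSpec_injective ((cancel_mono U.2.fromSpec).mp h)

/-- Morphisms to `B` are determined by the induced morphism to `Y` and the pullback of `s`,
if the latter is regular. -/
lemma hom_ext_of_isRegularSection {b b' : Z ⟶ J.normalCone}
    (hb : b ≫ J.toBase = b' ≫ J.toBase)
    (hs : b.appTop J.exceptional = b'.appTop J.exceptional)
    (hreg : IsRegularSection (b.appTop J.exceptional)) : b = b' := by
  refine Scheme.hom_ext_of_forall _ _ fun z ↦ ?_
  obtain ⟨U, hU⟩ := exists_mem_affine (J.toBase (b z))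
  let O : Z.Opens := (b ≫ J.toBase) ⁻¹ᵁ U.1
  refine ⟨O, hU, ?_⟩
  obtain ⟨φ, hφ⟩ := exists_eq_ofRingHom (U := U) (O.ι ≫ b) fun x ↦ x.2
  obtain ⟨ψ, hψ⟩ := exists_eq_ofRingHom (U := U) (O.ι ≫ b') fun x ↦ by
    have : (b ≫ J.toBase) x.1 ∈ U.1 := x.2
    rw [hb] at this
    exact this
  have h1 : (O.ι ≫ b).appTop J.exceptional = (O.ι ≫ b').appTop J.exceptional := by
    rw [Scheme.Hom.comp_appTop, Scheme.Hom.comp_appTop, CommRingCat.comp_apply,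
      CommRingCat.comp_apply, hs]
  have hreg' : IsRegularSection ((O.ι ≫ b).appTop J.exceptional) := by
    rw [Scheme.Hom.comp_appTop, CommRingCat.comp_apply]; exact hreg.comp_flat _
  rw [hφ, hψ]
  rw [hφ, ofRingHom_exceptional] at hreg'
  rw [hφ, hψ, ofRingHom_exceptional, ofRingHom_exceptional] at h1
  congr 1
  refine RingFiltration.ringHom_ext (fun x ↦ hreg'.eq_zero) ?_ h1
  refine RingHom.congr_fun (comp_const_eq_of_toBase_eq (φ := φ) (ψ := ψ) ?_)
  rw [← hφ, ← hψ, Category.assoc, hb, Category.assoc]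

end Points

end IdealFiltration

end

/-! ### Pullback of the filtration and lifts of morphisms to B -/

section

section IdealSheaf

variable {Y Z S : Scheme.{u}} (I : Y.IdealSheafData)

lemma ideal_comap_opensRange (j : S ⟶ Y) [IsOpenImmersion j] [IsAffine S] (U : Y.affineOpens)
    (h : j ''ᵁ ⊤ = U.1) :
    (I.comap j).ideal ⟨⊤, isAffineOpen_top S⟩ =
      (I.ideal U).map (j.appLE U.1 ⊤ (by rw [← h]; exact (j.preimage_image_eq ⊤).ge)).hom := by
  obtain rfl : (⟨j ''ᵁ ⊤, (isAffineOpen_top S).image_of_isOpenImmersion j⟩ : Y.affineOpens) = U :=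
    Subtype.ext h
  rw [Scheme.IdealSheafData.ideal_comap_of_isOpenImmersion]
  have h1 : j.appLE (j ''ᵁ ⊤) ⊤ (j.preimage_image_eq ⊤).ge = (j.appIso ⊤).hom := by
    rw [Scheme.Hom.appIso_hom']
  rw [h1]
  exact (Ideal.map_comap_of_equiv (j.appIso ⊤).commRingCatIsoToRingEquiv).symm

/-- The adjunction between `comap` and `map` of ideal sheaves, read on global sections, gives both
inclusions. -/
lemma ideal_comap_of_isAffine [IsAffine S] [IsAffine Z] (I : S.IdealSheafData) (a : Z ⟶ S) :
    (I.comap a).ideal ⟨⊤, isAffineOpen_top Z⟩ =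
      (I.ideal ⟨⊤, isAffineOpen_top S⟩).map a.appTop.hom := by
  apply le_antisymm
  · let K := Scheme.IdealSheafData.equivOfIsAffine.symm
      ((I.ideal ⟨⊤, isAffineOpen_top S⟩).map a.appTop.hom)
    have hK : K.ideal ⟨⊤, isAffineOpen_top Z⟩ = _ :=
      Scheme.IdealSheafData.equivOfIsAffine.apply_symm_apply _
    rw [← hK]
    suffices I.comap a ≤ K from this _
    rw [← Scheme.IdealSheafData.le_map_iff_comap_le]
    refine Scheme.IdealSheafData.le_of_isAffine ?_
    rw [Scheme.IdealSheafData.ideal_map_of_isAffineHom, ← Ideal.map_le_iff_le_comap]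
    exact hK.ge
  · rw [Ideal.map_le_iff_le_comap]
    have := (I.le_map_comap (f := a)) ⟨⊤, isAffineOpen_top S⟩
    rw [Scheme.IdealSheafData.ideal_map_of_isAffineHom] at this
    exact this

lemma appTop_comp_apply (f : S ⟶ Z) (g : Z ⟶ Y) (x : Γ(Y, ⊤)) :
    (f ≫ g).appTop x = f.appTop (g.appTop x) := rfl

lemma section_ext_of_forall {c c' : Γ(Z, ⊤)} (h : ∀ z : Z, ∃ O : Z.Opens, z ∈ O ∧
    O.ι.appTop c = O.ι.appTop c') : c = c' := by
  refine TopCat.Presheaf.section_ext Z.sheaf _ _ _ fun z hz' ↦ ?_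
  obtain ⟨O, hz, h1⟩ := h z
  obtain ⟨y, rfl⟩ : ∃ y : O.toScheme, O.ι y = z := ⟨⟨z, hz⟩, rfl⟩
  have h2 := (IsRegularSection.germ_appTop O.ι y c).symm.trans ((congrArg _ h1).trans
    (IsRegularSection.germ_appTop O.ι y c'))
  exact (ConcreteCategory.bijective_of_isIso (O.ι.stalkMap y)).1 h2

/-- This translates equality of pulled back ideal sheaves, the form in which invariance of a center
is given, into divisibility statements about ring maps. -/
lemma ideal_comap_toSpec_fromSpec [IsAffine Z] (U : Y.affineOpens) (g : Γ(Y, U.1) →+* Γ(Z, ⊤)) :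
    (I.comap (toSpec g ≫ U.2.fromSpec)).ideal ⟨⊤, isAffineOpen_top Z⟩ = (I.ideal U).map g := by
  have : IsOpenImmersion U.2.fromSpec := U.2.isOpenImmersion_fromSpec
  rw [Scheme.IdealSheafData.comap_comp, ideal_comap_of_isAffine,
    ideal_comap_opensRange I U.2.fromSpec U
      ((Scheme.Hom.image_top_eq_opensRange _).trans U.2.opensRange_fromSpec), Ideal.map_map]
  congr 1
  ext r
  refine Eq.trans ?_ (toSpec_appTop g r)
  refine congrArg (toSpec g).appTop ?_
  have h : U.2.fromSpec.appLE U.1 ⊤ (by rw [U.2.fromSpec_preimage_self]) =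
      (Scheme.ΓSpecIso Γ(Y, U.1)).inv := by
    rw [Scheme.Hom.appLE, U.2.fromSpec_app_of_le U.1 le_rfl]
    simp only [homOfLE_refl, op_id, CategoryTheory.Functor.map_id, Category.id_comp,
      Category.assoc]
    rw [← Functor.map_comp]
    exact (congrArg _ ((Spec Γ(Y, U.1)).presheaf.map_id _)).trans (Category.comp_id _)
  exact congr($h r)

end IdealSheaf

namespace IdealFiltration

open Scheme (AffineZariskiSite)

variable {Y Z : Scheme.{u}} (J : IdealFiltration Y)

lemma exists_eq_toSpec_fromSpec (y : Z ⟶ Y) (U : Y.AffineZariskiSite) (h : ∀ z, y z ∈ U.1) :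
    ∃ g : Γ(Y, U.1) →+* Γ(Z, ⊤), y = toSpec g ≫ U.2.fromSpec := by
  have hr : Set.range y ⊆ Set.range U.2.fromSpec := by
    rintro _ ⟨z, rfl⟩
    rw [U.2.range_fromSpec]; exact h z
  obtain ⟨g, hg⟩ := exists_eq_toSpec (IsOpenImmersion.lift U.2.fromSpec y hr)
  exact ⟨g, by rw [← hg, IsOpenImmersion.lift_fac]⟩

/-- A morphism to `Y` lifts to `B`, with `s` pulling back to a given regular section `c`, as soon
as the pullback of `I_n` is locally divisible by `c ^ n`. -/
lemma exists_lift_toBase (y : Z ⟶ Y) (c : Γ(Z, ⊤)) (hc : IsRegularSection c)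
    (h : ∀ z : Z, ∃ (U : Y.AffineZariskiSite) (O : Z.Opens) (g : Γ(Y, U.1) →+* Γ(O.toScheme, ⊤)),
      z ∈ O ∧ O.ι ≫ y = toSpec g ≫ U.2.fromSpec ∧
        ∀ n, ∀ f ∈ (J.sections U).ideal n, O.ι.appTop c ^ n ∣ g f) :
    ∃ b : Z ⟶ J.normalCone, b ≫ J.toBase = y ∧ b.appTop J.exceptional = c := by
  choose U O g hz hy hg using h
  have hloc : ∀ z, ∃ b : (O z).toScheme ⟶ J.normalCone, b ≫ J.toBase = (O z).ι ≫ y ∧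
      b.appTop J.exceptional = (O z).ι.appTop c := fun z ↦ by
    obtain ⟨φ, h1, h2⟩ := RingFiltration.exists_lift (I := J.sections (U z)) (g z)
      ((O z).ι.appTop c) (fun x ↦ (hc.comp_flat (O z).ι).eq_zero) (hg z)
    refine ⟨ofRingHom φ, ?_, ?_⟩
    · rw [ofRingHom_toBase, hy]
      congr 2
      exact RingHom.ext h1
    · rw [ofRingHom_exceptional, h2]
  choose b hb hs using hloc
  have hO : iSup O = ⊤ := top_le_iff.mp fun z _ ↦ TopologicalSpace.Opens.mem_iSup.mpr ⟨z, hz z⟩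
  let 𝒰 := Z.openCoverOfIsOpenCover O hO
  -- The local lifts agree on overlaps because c stays regular there, so that a lift is determined
  -- by its projection to Y and the value of s.
  have hcomp : ∀ i j, pullback.fst (O i).ι (O j).ι ≫ b i = pullback.snd _ _ ≫ b j := by
    intro i j
    have e : (pullback.fst (O i).ι (O j).ι ≫ b i).appTop J.exceptional =
        (pullback.fst (O i).ι (O j).ι ≫ (O i).ι).appTop c := by
      rw [appTop_comp_apply, appTop_comp_apply, hs]
    have e' : (pullback.snd (O i).ι (O j).ι ≫ b j).appTop J.exceptional =
        (pullback.snd (O i).ι (O j).ι ≫ (O j).ι).appTop c := by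
      rw [appTop_comp_apply, appTop_comp_apply, hs]
    refine J.hom_ext_of_isRegularSection ?_ ?_ ?_
    · rw [Category.assoc, Category.assoc, hb, hb]
      exact pullback.condition_assoc y
    · rw [e, e', pullback.condition]
    · rw [e]; exact hc.comp_flat _
  have hfac : ∀ z, (O z).ι ≫ 𝒰.glueMorphisms b hcomp = b z := 𝒰.ι_glueMorphisms b hcomp
  refine ⟨𝒰.glueMorphisms b hcomp, ?_, ?_⟩
  · refine Scheme.hom_ext_of_forall _ _ fun z ↦ ⟨O z, hz z, ?_⟩
    exact (Category.assoc _ _ _).symm.trans ((congrArg (· ≫ J.toBase) (hfac z)).trans (hb z))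
  · refine section_ext_of_forall fun z ↦ ⟨O z, hz z, ?_⟩
    rw [← hs z]
    exact (appTop_comp_apply (O z).ι _ _).symm.trans
      (congrArg (fun g : (O z).toScheme ⟶ J.normalCone ↦ g.appTop J.exceptional) (hfac z))

/-- Any morphism to `Y` pulling back the filtration in the same way as the projection of a point
`b` of `B` lifts to `B`, with `s` multiplied by a given unit. -/
lemma exists_lift_of_comap_eq (b : Z ⟶ J.normalCone) (y : Z ⟶ Y) (c : Γ(Z, ⊤)ˣ)
    (hb : IsRegularSection (b.appTop J.exceptional))
    (h : ∀ n, (J.ideal n).comap y = (J.ideal n).comap (b ≫ J.toBase)) :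
    ∃ b' : Z ⟶ J.normalCone, b' ≫ J.toBase = y ∧
      b'.appTop J.exceptional = c * b.appTop J.exceptional := by
  refine J.exists_lift_toBase y _ (.mul (.of_isUnit c.isUnit) hb) fun z ↦ ?_
  obtain ⟨U, hU⟩ := exists_mem_affine (y z)
  obtain ⟨U', hU'⟩ := exists_mem_affine (J.toBase (b z))
  obtain ⟨_, ⟨O, hO, rfl⟩, hzO, hle⟩ := Z.isBasis_affineOpens.exists_subset_of_mem_open
    (show z ∈ (y ⁻¹ᵁ U.1 ⊓ (b ≫ J.toBase) ⁻¹ᵁ U'.1 : Z.Opens) from ⟨hU, hU'⟩)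
    (y ⁻¹ᵁ U.1 ⊓ (b ≫ J.toBase) ⁻¹ᵁ U'.1).2
  let O : Z.Opens := O
  have : IsAffine O.toScheme := hO
  obtain ⟨g, hg⟩ := exists_eq_toSpec_fromSpec (O.ι ≫ y) U fun x ↦ (hle x.2).1
  obtain ⟨φ, hφ⟩ := exists_eq_ofRingHom (U := U') (O.ι ≫ b) fun x ↦ (hle x.2).2
  refine ⟨U, O, g, hzO, hg, fun n f hf ↦ ?_⟩
  have h1 := congrArg (fun K : Z.IdealSheafData ↦
    (K.comap O.ι).ideal ⟨⊤, isAffineOpen_top O.toScheme⟩) (h n)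
  dsimp only at h1
  rw [← Scheme.IdealSheafData.comap_comp, ← Scheme.IdealSheafData.comap_comp, hg,
    ← Category.assoc, hφ, ofRingHom_toBase] at h1
  have h2 : g f ∈ ((J.ideal n).ideal ⟨U.1, U.2⟩).map g := Ideal.mem_map_of_mem g hf
  rw [← ideal_comap_toSpec_fromSpec (J.ideal n) ⟨U.1, U.2⟩ g] at h2
  have h3 := h1.le h2
  rw [ideal_comap_toSpec_fromSpec (J.ideal n) ⟨U'.1, U'.2⟩] at h3
  -- Along b one has f' = (f' T^n) s^n, so the pullback of I_n lies in (s^n). The pullback along y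
  -- is the same ideal.
  have h4 : ((J.ideal n).ideal ⟨U'.1, U'.2⟩).map (φ.comp (J.sections U').const) ≤
      Ideal.span {φ (J.sections U').exceptional ^ n} := by
    rw [Ideal.map_le_iff_le_comap]
    intro f' hf'
    rw [Ideal.mem_comap, Ideal.mem_span_singleton, RingHom.comp_apply,
      ← RingFiltration.map_monomial_mul_pow φ n f' hf']
    exact Dvd.intro_left _ rfl
  have h5 := Ideal.mem_span_singleton.mp (h4 h3)
  rw [map_mul, ← appTop_comp_apply, hφ, ofRingHom_exceptional, mul_pow]
  exact (((c.isUnit.map O.ι.appTop.hom).pow n).mul_left_dvd).mpr h5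

end IdealFiltration

end

/-! ### The complement of the vertex in a chart -/

section

/-- Clearing denominators: g a^N comes from some f in I_n(A), and a is a unit in B, so f T^n
survives modulo q as well. -/
lemma RingFiltration.exists_map_monomial_notMem {A B : Type u} [CommRing A] [CommRing B]
    {I : RingFiltration A} {I' : RingFiltration B} (φ : A →+* B) (a : A)
    (hφ : letI := φ.toAlgebra; IsLocalization.Away a B)
    (h : ∀ n, (I.ideal n).map φ = I'.ideal n) (h' : ∀ n, I.ideal n ≤ (I'.ideal n).comap φ)
    (q : Ideal I'.extendedRees) [q.IsPrime] (n : ℕ) (g : B) (hg : g ∈ I'.ideal n)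
    (hq : I'.monomial n g hg ∉ q) :
    ∃ (f : A) (hf : f ∈ I.ideal n), map φ h' (I.monomial n f hf) ∉ q := by
  let _ := φ.toAlgebra
  have hg' := hg
  rw [← h] at hg'
  obtain ⟨⟨⟨f, hf⟩, ⟨_, N, rfl⟩⟩, hN⟩ :=
    (IsLocalization.mem_map_algebraMap_iff (.powers a) B).mp hg'
  refine ⟨f, hf, fun hp ↦ ?_⟩
  change g * φ (a ^ N) = φ f at hN
  have h2 : I'.monomial n g hg * I'.const (φ (a ^ N)) = map φ h' (I.monomial n f hf) := by
    rw [const_eq_monomial, monomial_mul_monomial, map_monomial]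
    refine Subtype.ext ?_
    change C (g * φ (a ^ N)) * T ((n : ℤ) + 0) = C (φ f) * T (n : ℤ)
    rw [hN, add_zero]
  rw [← h2] at hp
  refine (Ideal.IsPrime.mem_or_mem ‹_› hp).elim hq fun h3 ↦ ?_
  refine Ideal.IsPrime.ne_top ‹_› (Ideal.eq_top_of_isUnit_mem q h3 ?_)
  rw [map_pow]
  exact ((IsLocalization.Away.algebraMap_isUnit (S := B) a).pow N).map I'.const

namespace IdealFiltration

open Scheme (AffineZariskiSite)

variable {Y Z : Scheme.{u}} (J : IdealFiltration Y)

/-- Restriction of sections of the extended Rees algebra. -/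
def restrict {U V : Y.AffineZariskiSite} (h : U ≤ V) :
    (J.sections V).extendedRees →+* (J.sections U).extendedRees :=
  RingFiltration.map _ (J.sections_le_comap h)

lemma chart_comp {U V : Y.AffineZariskiSite} (h : U ≤ V) :
    Spec.map (CommRingCat.ofHom (J.restrict h)) ≫ J.chart V = J.chart U :=
  colimit.w J.normalConeGluing.functor (homOfLE h)

/-- B₊ is a union over all affine opens, but at a point of the chart over U the sections over U
suffice. An element from another chart is restricted to an open that is basic in both, and its
denominator is then cleared. -/
lemma chart_mem_awayFromVertex (U : Y.AffineZariskiSite)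
    (p : PrimeSpectrum (J.sections U).extendedRees) :
    J.chart U p ∈ J.awayFromVertex ↔ ∃ (n : ℕ) (f : Γ(Y, U.1)) (hf : f ∈ (J.sections U).ideal (n + 1)),
      (J.sections U).monomial (n + 1 : ℕ) f hf ∉ p.asIdeal := by
  constructor
  · intro h
    simp only [awayFromVertex, TopologicalSpace.Opens.mem_iSup] at h
    obtain ⟨U', n, ⟨f', hf'⟩, p', hp', he⟩ := h
    have hy : J.toBase (J.chart U p) ∈ U.1 := by
      change _ ∈ J.toBase ⁻¹ᵁ U.1
      rw [toBase_preimage]; exact ⟨p, rfl⟩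
    have hy' : J.toBase (J.chart U p) ∈ U'.1 := by
      change _ ∈ J.toBase ⁻¹ᵁ U'.1
      rw [toBase_preimage]; exact ⟨p', he⟩
    obtain ⟨a, a', haa, hya⟩ := exists_basicOpen_le_affine_inter U.2 U'.2 _ ⟨hy, hy'⟩
    have hWU : U.basicOpen a ≤ U := ⟨a, rfl⟩
    have hWU' : U.basicOpen a ≤ U' := ⟨a', haa.symm⟩
    obtain ⟨q, hq⟩ : J.chart U p ∈ (J.chart (U.basicOpen a)).opensRange := by
      rw [← toBase_preimage]; exact hya
    rw [← J.chart_comp hWU] at hq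
    have hqp : Spec.map (CommRingCat.ofHom (J.restrict hWU)) q = p :=
      (J.chart U).isOpenEmbedding.injective hq
    rw [← hqp] at he
    change _ = J.chart U _ at he
    have hqp' : Spec.map (CommRingCat.ofHom (J.restrict hWU')) q = p' := by
      refine (J.chart U').isOpenEmbedding.injective ?_
      refine Eq.trans ?_ he.symm
      rw [← Scheme.Hom.comp_apply, ← Scheme.Hom.comp_apply, chart_comp, chart_comp]
    have h1 : J.restrict hWU' ((J.sections U').monomial (n + 1 : ℕ) f' hf') ∉ q.asIdeal := by
      rw [← hqp'] at hp'
      exact hp'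
    rw [restrict, RingFiltration.map_monomial] at h1
    have hprime : q.asIdeal.IsPrime := q.2
    obtain ⟨f, hf, h2⟩ := RingFiltration.exists_map_monomial_notMem (I := J.sections U)
      (I' := J.sections (U.basicOpen a)) _ a (U.2.isLocalization_basicOpen a)
      (fun n ↦ (J.ideal n).map_ideal_basicOpen ⟨U.1, U.2⟩ a) (J.sections_le_comap hWU)
      q.asIdeal (n + 1) _ _ h1
    refine ⟨n, f, hf, fun hp ↦ h2 ?_⟩
    rw [← hqp] at hp
    exact hp
  · rintro ⟨n, f, hf, hp⟩
    simp only [awayFromVertex, TopologicalSpace.Opens.mem_iSup]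
    exact ⟨U, n, ⟨f, hf⟩, p, hp, rfl⟩

lemma ofRingHom_mem_awayFromVertex {U : Y.AffineZariskiSite}
    (φ : (J.sections U).extendedRees →+* Γ(Z, ⊤)) (z : Z) :
    ofRingHom φ z ∈ J.awayFromVertex ↔ ∃ (n : ℕ) (f : Γ(Y, U.1))
      (hf : f ∈ (J.sections U).ideal (n + 1)),
      z ∈ Z.basicOpen (φ ((J.sections U).monomial (n + 1 : ℕ) f hf)) := by
  simp only [← toSpec_preimage_basicOpen]
  exact J.chart_mem_awayFromVertex U (toSpec φ z)

end IdealFiltration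

end

section

/-! ### Relative dimension -/

section RelativeDimension

/-- The presentation with no relations, whose Jacobian condition is vacuous. -/
instance isStandardSmoothOfRelativeDimension_mvPolynomial (R : Type*) [CommRing R] (d : ℕ) :
    Algebra.IsStandardSmoothOfRelativeDimension d R (MvPolynomial (Fin d) R) := by
  let P : Algebra.SubmersivePresentation R (MvPolynomial (Fin d) R) (Fin d) PEmpty.{1} :=
    { Algebra.Generators.mvPolynomial R (Fin d) with
      relation := PEmpty.elim
      span_range_relation_eq_ker := by
        rw [Set.range_eq_empty, Ideal.span_empty]
        exact Algebra.Generators.ker_mvPolynomial.symm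
      map := PEmpty.elim
      map_inj := fun a ↦ a.elim
      jacobian_isUnit := by
        refine Algebra.PreSubmersivePresentation.isUnit_jacobian_iff_aevalDifferential_bijective _
          |>.mpr ⟨fun _ _ _ ↦ Subsingleton.elim _ _, fun x ↦ ⟨0, Subsingleton.elim _ _⟩⟩ }
  exact P.isStandardSmoothOfRelativeDimension (by simp [Algebra.Presentation.dimension])

lemma isStandardSmoothOfRelativeDimension_polynomialC (R : Type*) [CommRing R] :
    (Polynomial.C : R →+* Polynomial R).IsStandardSmoothOfRelativeDimension 1 := by
  have h : Algebra.IsStandardSmoothOfRelativeDimension 1 R (Polynomial R) :=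
    .of_algEquiv 1 ((MvPolynomial.renameEquiv R (Equiv.ofUnique (Fin 1) PUnit.{1})).trans
      (MvPolynomial.uniqueAlgEquiv R PUnit.{1}))
  rw [← RingHom.isStandardSmoothOfRelativeDimension_algebraMap] at h
  exact h

lemma isStandardSmoothOfRelativeDimension_laurentC (R : Type*) [CommRing R] :
    (C : R →+* LaurentPolynomial R).IsStandardSmoothOfRelativeDimension 1 := by
  have h : (algebraMap (Polynomial R) (LaurentPolynomial R)).IsStandardSmoothOfRelativeDimension 0 :=
    RingHom.IsStandardSmoothOfRelativeDimension.algebraMap_isLocalizationAway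
      (Polynomial.X : Polynomial R)
  have h' := h.comp (isStandardSmoothOfRelativeDimension_polynomialC R)
  have e : (algebraMap (Polynomial R) (LaurentPolynomial R)).comp Polynomial.C =
      (C : R →+* LaurentPolynomial R) := by
    ext r
    simp [LaurentPolynomial.algebraMap_eq_toLaurent]
  rw [e] at h'
  exact h'

/-- The rank of the free module of differentials recovers the relative dimension. -/
lemma _root_.RingHom.IsStandardSmoothOfRelativeDimension.eq {R S : Type*} [CommRing R] [CommRing S]
    [Nontrivial S] {m n : ℕ} {f : R →+* S} (hm : f.IsStandardSmoothOfRelativeDimension m)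
    (hn : f.IsStandardSmoothOfRelativeDimension n) : m = n := by
  algebraize [f]
  have h1 := Algebra.IsStandardSmoothOfRelativeDimension.rank_kaehlerDifferential (R := R) (S := S) m
  have h2 := Algebra.IsStandardSmoothOfRelativeDimension.rank_kaehlerDifferential (R := R) (S := S) n
  exact_mod_cast h1.symm.trans h2

/-- Both dimensions are visible on localizations at elements t, t' outside one maximal ideal. The
localization at t t' is nonzero, and there the ranks of differentials must agree. -/
lemma _root_.RingHom.Locally.relativeDimension_eq {R S : Type u} [CommRing R] [CommRing S]
    [Nontrivial S] {m n : ℕ} {f : R →+* S}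
    (hm : RingHom.Locally (RingHom.IsStandardSmoothOfRelativeDimension m) f)
    (hn : RingHom.Locally (RingHom.IsStandardSmoothOfRelativeDimension n) f) : m = n := by
  obtain ⟨p, hp⟩ := Ideal.exists_maximal S
  have key : ∀ {n : ℕ}, RingHom.Locally (RingHom.IsStandardSmoothOfRelativeDimension n) f →
      ∃ t ∉ p, ((algebraMap S (Localization.Away t)).comp
        f).IsStandardSmoothOfRelativeDimension n := by
    rintro n ⟨s, hs, h⟩
    obtain ⟨t, ht, htp⟩ : ∃ t ∈ s, t ∉ p := by
      by_contra! hc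
      exact hp.ne_top (top_le_iff.mp (hs ▸ Ideal.span_le.mpr hc))
    exact ⟨t, htp, h t ht⟩
  obtain ⟨t, ht, hm⟩ := key hm
  obtain ⟨t', ht', hn⟩ := key hn
  let S₁ := Localization.Away t
  let S₂ := Localization.Away t'
  let T := Localization.Away (algebraMap S S₁ t')
  let g : S₂ →+* T := IsLocalization.Away.lift t' (g := algebraMap S T)
    (IsLocalization.Away.algebraMap_isUnit (S := T) (algebraMap S S₁ t'))
  let _ := g.toAlgebra
  have : IsScalarTower S S₂ T := .of_algebraMap_eq fun x ↦ by
    simp [RingHom.algebraMap_toAlgebra, g]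
  have h2 : IsLocalization.Away (algebraMap S S₂ t) T := IsLocalization.Away.commutes S₂ S₁ T t' t
  have h3 : IsLocalization.Away (t * t') T := IsLocalization.Away.mul' S₁ T t t'
  have : Nontrivial T := by
    rw [← not_subsingleton_iff_nontrivial, IsLocalization.subsingleton_iff (S := T) (M := .powers (t * t'))]
    rintro ⟨N, hN⟩
    have : (t * t') ^ N ∈ p := by
      change (t * t') ^ N = 0 at hN
      rw [hN]; exact p.zero_mem
    exact (hp.isPrime.mem_or_mem (hp.isPrime.mem_of_pow_mem _ this)).elim ht ht'
  have h4 := (RingHom.IsStandardSmoothOfRelativeDimension.algebraMap_isLocalizationAway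
    (R := S₁) (Rᵣ := T) (algebraMap S S₁ t')).comp hm
  have h5 := (RingHom.IsStandardSmoothOfRelativeDimension.algebraMap_isLocalizationAway
    (R := S₂) (Rᵣ := T) (algebraMap S S₂ t)).comp hn
  rw [← RingHom.comp_assoc, ← IsScalarTower.algebraMap_eq, zero_add] at h4 h5
  exact h4.eq h5

/-- The relative dimension at a point is well defined. -/
lemma relativeDimension_unique {k : Type u} [CommRing k] {X : Scheme.{u}}
    (f : X ⟶ Spec (CommRingCat.of k)) (x : X) {m n : ℕ} [hm : SmoothOfRelativeDimension m f]
    [hn : SmoothOfRelativeDimension n f] : m = n := by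
  obtain ⟨_, ⟨V, hV, rfl⟩, hxV, -⟩ :=
    X.isBasis_affineOpens.exists_subset_of_mem_open (Set.mem_univ x) isOpen_univ
  have h1 := HasRingHomProperty.appLE (P := @SmoothOfRelativeDimension m) f hm
    ⟨⊤, isAffineOpen_top _⟩ ⟨V, hV⟩ le_top
  have h2 := HasRingHomProperty.appLE (P := @SmoothOfRelativeDimension n) f hn
    ⟨⊤, isAffineOpen_top _⟩ ⟨V, hV⟩ le_top
  have : Nontrivial Γ(X, V) := by
    have : Nonempty V := ⟨x, hxV⟩
    infer_instance
  exact h1.relativeDimension_eq h2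

end RelativeDimension

end

/-! ### Smoothness and dimension of B -/

section

open Scheme (AffineZariskiSite)

instance isZariskiLocalAtSource_smooth : IsZariskiLocalAtSource @Smooth.{u} :=
  HasRingHomProperty.instIsZariskiLocalAtSource (Q := RingHom.Smooth)

lemma smoothOfRelativeDimension_specMap {R S : Type u} [CommRing R] [CommRing S] {n : ℕ}
    {f : R →+* S} (h : f.IsStandardSmoothOfRelativeDimension n) :
    SmoothOfRelativeDimension n (Spec.map (CommRingCat.ofHom f)) :=
  (HasRingHomProperty.Spec_iff (P := @SmoothOfRelativeDimension n)).mpr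
    (RingHom.locally_of RingHom.isStandardSmoothOfRelativeDimension_respectsIso _ h)

lemma SmoothOfRelativeDimension.of_range_subset {S X Y : Scheme.{u}} (f : X ⟶ Y) (V : X.Opens)
    {n : ℕ} (h : SmoothOfRelativeDimension n (V.ι ≫ f)) (j : S ⟶ X) [IsOpenImmersion j]
    (hj : ∀ s, j s ∈ V) : SmoothOfRelativeDimension n (j ≫ f) := by
  have hr : Set.range j ⊆ Set.range V.ι := by
    rintro _ ⟨s, rfl⟩
    rw [Scheme.Opens.range_ι]
    exact hj s
  let l := IsOpenImmersion.lift V.ι j hr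
  have hl : l ≫ V.ι = j := IsOpenImmersion.lift_fac _ _ _
  have : IsOpenImmersion (l ≫ V.ι) := hl ▸ inferInstance
  have : IsOpenImmersion l := IsOpenImmersion.of_comp l V.ι
  rw [← hl, Category.assoc, ← zero_add n]
  exact smoothOfRelativeDimension_comp ..

lemma exists_smoothOfRelativeDimension {X Y : Scheme.{u}} (f : X ⟶ Y) [Smooth f] (x : X) :
    ∃ (V : X.Opens) (n : ℕ), x ∈ V ∧ SmoothOfRelativeDimension n (V.ι ≫ f) := by
  obtain ⟨U, hU, V, hV, hxV, e, h⟩ := Smooth.exists_isStandardSmooth f x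
  obtain ⟨n, hn⟩ : ∃ n, (f.appLE U V e).hom.IsStandardSmoothOfRelativeDimension n := by
    let _ := (f.appLE U V e).hom.toAlgebra
    obtain ⟨ι, σ, h1, h2, ⟨P⟩⟩ := h
    exact ⟨P.dimension, ⟨ι, σ, h1, h2, P, rfl⟩⟩
  have h1 : SmoothOfRelativeDimension n (Spec.map (f.appLE U V e)) :=
    smoothOfRelativeDimension_specMap hn
  refine ⟨V, n, hxV, ?_⟩
  have h2 : V.ι ≫ f = hV.isoSpec.hom ≫ Spec.map (f.appLE U V e) ≫ hU.fromSpec := by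
    rw [IsAffineOpen.SpecMap_appLE_fromSpec f hU hV e, IsAffineOpen.isoSpec_hom,
      IsAffineOpen.toSpecΓ_fromSpec_assoc]
  have : IsOpenImmersion hU.fromSpec := hU.isOpenImmersion_fromSpec
  have h3 : SmoothOfRelativeDimension (n + 0) (Spec.map (f.appLE U V e) ≫ hU.fromSpec) :=
    smoothOfRelativeDimension_comp ..
  rw [h2, ← zero_add n]
  exact smoothOfRelativeDimension_comp (hg := h3) ..

variable {k : Type u} [Field k] {Y : Sch k}

lemma fromSpec_hom (U : Y.left.AffineZariskiSite) :
    U.2.fromSpec ≫ Y.hom = Spec.map (CommRingCat.ofHom (scalars Y U.1)) := by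
  obtain ⟨φ, hφ⟩ := exists_eq_toSpec (R := k) Y.hom
  rw [hφ, comp_toSpec, ← toSpec_spec]
  congr 1
  ext c
  have h1 : scalars Y U.1 c = Y.left.presheaf.map (homOfLE le_top).op (φ c) := by
    rw [← toSpec_appTop φ c, ← hφ]
    rfl
  rw [RingHom.comp_apply, RingHom.comp_apply, h1]
  have h2 : U.2.fromSpec.appTop = Y.left.presheaf.map (homOfLE le_top).op ≫
      (Scheme.ΓSpecIso Γ(Y.left, U.1)).inv := by
    refine (U.2.fromSpec_app_of_le ⊤ le_top).trans ?_
    exact congrArg _ ((congrArg _ ((Spec Γ(Y.left, U.1)).presheaf.map_id _)).trans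
      (Category.comp_id _))
  exact congr($h2 (φ c))


namespace Center

variable (J : Center Y)

lemma chart_hom (U : Y.left.AffineZariskiSite) :
    J.chart U ≫ J.toBase ≫ Y.hom =
      Spec.map (CommRingCat.ofHom ((J.sections U).const.comp (scalars Y U.1))) := by
  rw [← Category.assoc, J.chart_toBase, Category.assoc, fromSpec_hom, ← Spec.map_comp]
  rfl

/-- Where the center is trivial the chart is the product of an open subset of Y with 𝔾_m. In a
monomial chart with d coordinates it is étale over affine (d + 1)-space, and d = n because Y is
étale over affine d-space there. -/
lemma exists_chart_smoothOfRelativeDimension (y : Y.left) (V : Y.left.Opens) (hy : y ∈ V) (n : ℕ)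
    (hV : SmoothOfRelativeDimension n (V.ι ≫ Y.hom)) :
    ∃ U : Y.left.AffineZariskiSite, y ∈ U.1 ∧
      SmoothOfRelativeDimension (n + 1) (J.chart U ≫ J.toBase ≫ Y.hom) := by
  obtain ⟨U, hyU, htriv | ⟨d, x, w, hx, hI⟩⟩ := J.locally_monomial y
  · obtain ⟨_, ⟨W, hW, rfl⟩, hyW, hle⟩ :=
      Y.left.isBasis_affineOpens.exists_subset_of_mem_open (show y ∈ (U.1 ⊓ V : Y.left.Opens) from
        ⟨hyU, hy⟩) (U.1 ⊓ V).2
    let W' : Y.left.AffineZariskiSite := ⟨W, hW⟩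
    refine ⟨W', hyW, ?_⟩
    have htop : ∀ n, (J.sections W').ideal n = ⊤ := fun n ↦ by
      change (J.ideal n).ideal ⟨W, hW⟩ = ⊤
      rw [← (J.ideal n).map_ideal (U := ⟨W, hW⟩) (V := U) (hle.trans inf_le_left), htriv,
        Ideal.map_top]
    have hR : (J.sections W').extendedRees = ⊤ := top_le_iff.mp fun x _ m ↦ by
      rw [htop]; trivial
    let e : LaurentPolynomial Γ(Y.left, W) ≃+* (J.sections W').extendedRees :=
      Subring.topEquiv.symm.trans (RingEquiv.subringCongr hR.symm)
    have h1 : (J.sections W').const.IsStandardSmoothOfRelativeDimension 1 := by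
      have := (RingHom.IsStandardSmoothOfRelativeDimension.equiv e).comp
        (isStandardSmoothOfRelativeDimension_laurentC Γ(Y.left, W))
      exact this
    have h2 := smoothOfRelativeDimension_specMap h1
    have : IsOpenImmersion W'.2.fromSpec := W'.2.isOpenImmersion_fromSpec
    have h3 := SmoothOfRelativeDimension.of_range_subset Y.hom V hV W'.2.fromSpec fun s ↦
      (hle (show W'.2.fromSpec s ∈ W by
        have : W'.2.fromSpec s ∈ Set.range W'.2.fromSpec := ⟨s, rfl⟩
        rwa [W'.2.range_fromSpec] at this)).2
    rw [← Category.assoc, J.chart_toBase, Category.assoc, add_comm]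
    exact smoothOfRelativeDimension_comp ..
  · let W : Y.left.AffineZariskiSite := ⟨U.1, U.2⟩
    refine ⟨W, hyU, ?_⟩
    let φ : MvPolynomial (Fin d) k →+* Γ(Y.left, W.1) := MvPolynomial.eval₂Hom (scalars Y W.1) x
    have hφ : φ.Etale := hx
    have hφC : ∀ c, φ (MvPolynomial.C c) = scalars Y W.1 c := fun c ↦ by simp [φ]
    obtain ⟨ψ, hψ, hψC⟩ := RingFiltration.exists_etale_of_monomial (I := J.sections W) w φ hφ
      fun n ↦ by
        refine (hI n).trans ?_
        simp [φ]
        rfl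
    have hC := smoothOfRelativeDimension_specMap ((RingHom.isStandardSmoothOfRelativeDimension_algebraMap (R := k) (S := MvPolynomial (Fin d) k) d).mpr inferInstance)
    have hφ' : Etale (Spec.map (CommRingCat.ofHom φ)) :=
      (HasRingHomProperty.Spec_iff (P := @Etale)).mpr hφ
    have hψ' : Etale (Spec.map (CommRingCat.ofHom ψ)) :=
      (HasRingHomProperty.Spec_iff (P := @Etale)).mpr hψ
    have hP := smoothOfRelativeDimension_specMap
      (isStandardSmoothOfRelativeDimension_polynomialC (MvPolynomial (Fin d) k))
    have h1 : SmoothOfRelativeDimension (0 + (1 + d)) (J.chart W ≫ J.toBase ≫ Y.hom) := by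
      have e : J.chart W ≫ J.toBase ≫ Y.hom = Spec.map (CommRingCat.ofHom ψ) ≫
          Spec.map (CommRingCat.ofHom Polynomial.C) ≫
            Spec.map (CommRingCat.ofHom (algebraMap k (MvPolynomial (Fin d) k))) := by
        rw [chart_hom, ← Spec.map_comp, ← Spec.map_comp]
        congr 1
        refine CommRingCat.hom_ext (RingHom.ext fun c ↦ ?_)
        exact (congrArg _ (hφC c).symm).trans (hψC c).symm
      rw [e]
      exact smoothOfRelativeDimension_comp (hg := smoothOfRelativeDimension_comp ..) ..
    have h2 : SmoothOfRelativeDimension (0 + d) (W.2.fromSpec ≫ Y.hom) := by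
      have e : W.2.fromSpec ≫ Y.hom = Spec.map (CommRingCat.ofHom φ) ≫
          Spec.map (CommRingCat.ofHom (algebraMap k (MvPolynomial (Fin d) k))) := by
        rw [fromSpec_hom, ← Spec.map_comp]
        congr 1
        ext c
        exact (hφC c).symm
      rw [e]
      exact smoothOfRelativeDimension_comp ..
    have : IsOpenImmersion W.2.fromSpec := W.2.isOpenImmersion_fromSpec
    obtain ⟨s, hs⟩ : y ∈ Set.range W.2.fromSpec := by rw [W.2.range_fromSpec]; exact hyU
    let O := W.2.fromSpec ⁻¹ᵁ V
    have h3 : SmoothOfRelativeDimension n ((O.ι ≫ W.2.fromSpec) ≫ Y.hom) :=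
      SmoothOfRelativeDimension.of_range_subset Y.hom V hV _ fun s ↦ s.2
    have h4 : SmoothOfRelativeDimension (0 + (0 + d)) ((O.ι ≫ W.2.fromSpec) ≫ Y.hom) := by
      rw [Category.assoc]
      exact smoothOfRelativeDimension_comp ..
    -- The number of coordinates and the prescribed dimension n are compared on a common
    -- neighbourhood of y.
    have hn := relativeDimension_unique ((O.ι ≫ W.2.fromSpec) ≫ Y.hom) ⟨s, by
      change W.2.fromSpec s ∈ V
      rw [hs]; exact hy⟩ (hm := h3) (hn := h4)
    rw [hn]
    rw [show 0 + (0 + d) + 1 = 0 + (1 + d) by ring]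
    exact h1

lemma isSmoothVariety_cone (hY : IsSmoothVariety Y) : IsSmoothVariety J.cone where
  smooth := by
    have := hY.smooth
    refine (IsZariskiLocalAtSource.iff_of_iSup_eq_top (P := @Smooth.{u})
      (fun U : {U : Y.left.AffineZariskiSite // Smooth (J.chart U ≫ J.toBase ≫ Y.hom)} ↦
        (J.chart U.1).opensRange) ?_).mpr fun ⟨U, hU⟩ ↦ ?_
    · refine top_le_iff.mp fun b _ ↦ ?_
      obtain ⟨V, n, hV, hs⟩ := exists_smoothOfRelativeDimension Y.hom (J.toBase b)
      obtain ⟨U, hU, h⟩ := J.exists_chart_smoothOfRelativeDimension _ V hV n hs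
      refine TopologicalSpace.Opens.mem_iSup.mpr ⟨⟨U, h.smooth⟩, ?_⟩
      rw [← J.toBase_preimage]
      exact hU
    · have : (J.chart U).opensRange.ι = (J.chart U).isoOpensRange.inv ≫ J.chart U := by simp
      change Smooth ((J.chart U).opensRange.ι ≫ J.toBase ≫ Y.hom)
      rw [this, Category.assoc]
      infer_instance
  separated := by
    have := hY.separated
    change IsSeparated (J.toBase ≫ Y.hom)
    infer_instance
  quasiCompact := by
    have := hY.quasiCompact
    change QuasiCompact (J.toBase ≫ Y.hom)
    infer_instance

lemma isSmoothOfDimLE_cone {n : ℕ} (hn : IsSmoothOfDimLE Y n) : IsSmoothOfDimLE J.cone (n + 1) := by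
  intro b
  obtain ⟨V, d, hV, hd, hs⟩ := hn (J.toBase b)
  obtain ⟨U, hU, h⟩ := J.exists_chart_smoothOfRelativeDimension _ V hV d hs
  refine ⟨(J.chart U).opensRange, d + 1, ?_, by omega, ?_⟩
  · rw [← J.toBase_preimage]
    exact hU
  · have : (J.chart U).opensRange.ι = (J.chart U).isoOpensRange.inv ≫ J.chart U := by simp
    change SmoothOfRelativeDimension _ ((J.chart U).opensRange.ι ≫ J.toBase ≫ Y.hom)
    rw [this, Category.assoc, ← zero_add (d + 1)]
    exact smoothOfRelativeDimension_comp ..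

end Center

lemma IsSmoothVariety.isLocallyNoetherian {Y : Sch k} (hY : IsSmoothVariety Y) :
    IsLocallyNoetherian Y.left := by
  have := hY.smooth
  exact LocallyOfFiniteType.isLocallyNoetherian Y.hom

lemma IsSmoothVariety.compactSpace {Y : Sch k} (hY : IsSmoothVariety Y) : CompactSpace Y.left := by
  have := hY.quasiCompact
  exact QuasiCompact.compactSpace_of_compactSpace Y.hom

lemma IsSmoothVariety.noetherianSpace {Y : Sch k} (hY : IsSmoothVariety Y) :
    NoetherianSpace Y.left := by
  have := hY.isLocallyNoetherian
  have := hY.compactSpace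
  have : IsNoetherian Y.left := {}
  infer_instance

lemma IsSmoothVariety.of_isOpenImmersion {Y Y' : Sch k} (hY : IsSmoothVariety Y) (j : Y' ⟶ Y)
    [IsOpenImmersion j.left] : IsSmoothVariety Y' := by
  have := hY.isLocallyNoetherian
  have h : Y'.hom = j.left ≫ Y.hom := (Over.w j).symm
  have := hY.smooth
  have := hY.separated
  have := hY.quasiCompact
  constructor <;> rw [h] <;> infer_instance

lemma IsSmoothOfDimLE.of_isOpenImmersion {Y Y' : Sch k} {n : ℕ} (hY : IsSmoothOfDimLE Y n)
    (j : Y' ⟶ Y) [IsOpenImmersion j.left] : IsSmoothOfDimLE Y' n := by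
  intro y
  obtain ⟨V, d, hV, hd, hs⟩ := hY (j.left y)
  refine ⟨j.left ⁻¹ᵁ V, d, hV, hd, ?_⟩
  rw [← Over.w j, ← Category.assoc]
  exact SmoothOfRelativeDimension.of_range_subset _ V hs _ fun s ↦ s.2

namespace Center

variable (J : Center Y)

instance : IsOpenImmersion J.puncturedConeι.left :=
  inferInstanceAs (IsOpenImmersion J.awayFromVertex.ι)

lemma isSmoothVariety_puncturedCone (hY : IsSmoothVariety Y) : IsSmoothVariety J.puncturedCone :=
  (J.isSmoothVariety_cone hY).of_isOpenImmersion J.puncturedConeι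

lemma isSmoothOfDimLE_puncturedCone {n : ℕ} (hn : IsSmoothOfDimLE Y n) :
    IsSmoothOfDimLE J.puncturedCone (n + 1) :=
  (J.isSmoothOfDimLE_cone hn).of_isOpenImmersion J.puncturedConeι

end Center

end

section

open Scheme (AffineZariskiSite)

/-! ### Homogeneous primes of the extended Rees algebra -/

namespace RingFiltration

variable {A : Type u} [CommRing A] {I : RingFiltration A}

/-- The prime of elements all of whose homogeneous components lie in `p`. -/
lemma exists_homogeneous_prime (p : PrimeSpectrum I.extendedRees) :
    ∃ q : PrimeSpectrum (LaurentPolynomial I.extendedRees),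
      q.asIdeal.comap C = p.asIdeal ∧
      ∀ r, r ∈ q.asIdeal.comap I.coaction ↔ ∀ n, I.monomial n (r.1.coeff n) (r.2 n) ∈ p.asIdeal := by
  -- q is the extension of p to R[T, T⁻¹], the generic point of 𝔾_m × {p}. Its image under the
  -- action is the generic point of the orbit closure of p.
  let L := LaurentPolynomial (I.extendedRees ⧸ p.asIdeal)
  let θ : LaurentPolynomial I.extendedRees →+* L :=
    AddMonoidAlgebra.mapRingHom ℤ (Ideal.Quotient.mk p.asIdeal)
  have hθ : ∀ x n, (θ x).coeff n = Ideal.Quotient.mk _ (x.coeff n) := fun x n ↦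
    AddMonoidAlgebra.coeff_mapRingHom _ _ _
  have hp : p.asIdeal.IsPrime := p.2
  have hL : IsDomain L := inferInstance
  refine ⟨⟨RingHom.ker θ, RingHom.ker_isPrime θ⟩, ?_, fun r ↦ ?_⟩
  · ext r
    rw [Ideal.mem_comap, RingHom.mem_ker, LaurentPolynomial.ext_iff, ← Ideal.Quotient.eq_zero_iff_mem]
    simp only [hθ]
    refine ⟨fun h ↦ ?_, fun h n ↦ ?_⟩
    · simpa [← T_zero] using h 0
    · by_cases hn : n = 0
      · subst hn; simp [h]
      · simp [hn]
  · rw [Ideal.mem_comap, RingHom.mem_ker, LaurentPolynomial.ext_iff]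
    refine forall_congr' fun n ↦ ?_
    rw [hθ, coeff_coaction, ← Ideal.Quotient.eq_zero_iff_mem]
    rfl

/-- A prime containing `s` gives rise to the map `R ⟶ (A / p ∩ A)[s]`. -/
lemma exists_ringHom_polynomial (p : PrimeSpectrum I.extendedRees) (hs : I.exceptional ∈ p.asIdeal) :
    ∃ ψ : I.extendedRees →+* Polynomial (A ⧸ p.asIdeal.comap I.const),
      (∀ a, ψ (I.const a) = Polynomial.C (Ideal.Quotient.mk _ a)) ∧ ψ I.exceptional = Polynomial.X ∧
      ∀ r : I.extendedRees, (ψ r).coeff 0 = Ideal.Quotient.mk _ (r.1.coeff 0) := by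
  have hp : p.asIdeal.IsPrime := p.2
  -- Since s ∈ p, the factorization f = (f T^(n+1)) s^(n+1) puts f in p. So I_n vanishes in the
  -- quotient for n > 0, and divisibility by powers of the variable is automatic.
  have hmem : ∀ n, ∀ f ∈ I.ideal (n + 1), f ∈ p.asIdeal.comap I.const := fun n f hf ↦ by
    rw [Ideal.mem_comap, ← I.monomial_mul_exceptional_pow (n + 1) f hf, pow_succ, ← mul_assoc]
    exact Ideal.mul_mem_left _ _ hs
  have hX : ∀ x : Polynomial (A ⧸ p.asIdeal.comap I.const), Polynomial.X * x = 0 → x = 0 :=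
    fun x hx ↦ (mul_eq_zero.mp hx).resolve_left Polynomial.X_ne_zero
  obtain ⟨ψ, h1, h2⟩ := exists_lift (I := I) (Polynomial.C.comp (Ideal.Quotient.mk (p.asIdeal.comap I.const)))
    Polynomial.X hX fun n f hf ↦ by
      cases n with
      | zero => simp
      | succ n =>
        rw [RingHom.comp_apply, Ideal.Quotient.eq_zero_iff_mem.mpr (hmem n f hf), map_zero]
        exact dvd_zero _
  replace h1 : ∀ a, ψ (I.const a) = Polynomial.C (Ideal.Quotient.mk _ a) := h1
  refine ⟨ψ, h1, h2, fun r ↦ ?_⟩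
  induction r using I.extendedRees_induction with
  | h0 => simp
  | hadd a b ha hb => simp [ha, hb]
  | hmon n f hf =>
    rw [coeff_monomial]
    obtain ⟨n, rfl | rfl⟩ := n.eq_nat_or_neg
    · cases n with
      | zero =>
        have : I.monomial (0 : ℕ) f hf = I.const f := (I.const_eq_monomial f).symm
        rw [this, h1]
        simp
      | succ n =>
        have h3 := map_monomial_mul_pow ψ (n + 1) f hf
        rw [h1, h2, Ideal.Quotient.eq_zero_iff_mem.mpr (hmem n f hf), map_zero] at h3
        have h4 := (mul_eq_zero.mp h3).resolve_right (pow_ne_zero _ Polynomial.X_ne_zero)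
        rw [h4, if_neg (by omega)]
        simp
    · rw [map_monomial_neg, h1, h2, Polynomial.coeff_C_mul, Polynomial.coeff_X_pow]
      by_cases hn : n = 0
      · subst hn; simp
      · rw [if_neg (Ne.symm hn), if_neg (by omega)]
        simp

end RingFiltration

lemma exists_point_of_notMem_exceptional {A : Type u} [CommRing A] {I : RingFiltration A}
    (p : PrimeSpectrum I.extendedRees) (hs : I.exceptional ∉ p.asIdeal) :
    ∃ q : PrimeSpectrum (LaurentPolynomial A), p = PrimeSpectrum.comap I.extendedRees.subtype q := by
  let _ := I.extendedRees.subtype.toAlgebra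
  have := I.isLocalization_subtype
  have h := PrimeSpectrum.localization_away_comap_range (LaurentPolynomial A) I.exceptional
  have hp : p ∈ (PrimeSpectrum.basicOpen I.exceptional : Set (PrimeSpectrum I.extendedRees)) := hs
  rw [← h] at hp
  obtain ⟨q, hq⟩ := hp
  exact ⟨q, hq.symm⟩

lemma isReduced_subscheme_vanishingIdeal {Y : Scheme.{u}} (X : Closeds Y) :
    IsReduced (Scheme.IdealSheafData.vanishingIdeal X).subscheme := by
  let 𝒰 := (Scheme.IdealSheafData.vanishingIdeal X).subschemeCover
  have h (i : Y.affineOpens) : _root_.IsReduced (𝒰.X i) := by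
    have h : ((Scheme.IdealSheafData.vanishingIdeal X).ideal i).IsRadical :=
      PrimeSpectrum.isRadical_vanishingIdeal _
    exact (Ideal.isRadical_iff_quotient_reduced _).mp h
  have : ∀ i, IsReduced (𝒰.openCover.X i) := fun i ↦ by
    have := h i
    exact inferInstanceAs (IsReduced (Spec (𝒰.X i)))
  exact IsReduced.of_openCover _ 𝒰.openCover

variable {k : Type u} [Field k]

/-! ### Functoriality of the invariant -/

section Functoriality

variable {Γ₀ : Type*} [LinearOrder Γ₀] [OrderBot Γ₀] {inv : SingularityInvariant k Γ₀}

variable (inv) in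
/-- The invariant of `X` at `p` is defined, and equal to `m`. -/
def SingularityInvariant.HasVal (Y : Sch k) (X : Closeds Y.left) (p : Y.left) (m : Γ₀) : Prop :=
  ∃ h : p ∈ X, inv.val Y X ⟨p, h⟩ = m

lemma SingularityInvariant.IsFunctorial.hasVal_comp (h : inv.IsFunctorial) {W Y : Sch k}
    (hW : IsSmoothVariety W) (hY : IsSmoothVariety Y) (a : W ⟶ Y) [Smooth a.left]
    (X : Closeds Y.left) (w : W.left) (m : Γ₀) :
    inv.HasVal W (X.preimage a.left.continuous) w m ↔ inv.HasVal Y X (a.left w) m :=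
  exists_congr fun hw ↦ by rw [← h W Y a hW hY inferInstance X ⟨w, hw⟩]

/-- Two smooth morphisms from one W transport the invariant between two pairs with the same pullback
to W. This serves for the 𝔾_m-orbits in B, for {s ≠ 0} = Y × 𝔾_m, and for source and target of the
arrow groupoid. -/
lemma SingularityInvariant.IsFunctorial.hasVal_iff (h : inv.IsFunctorial) {W Y₁ Y₂ : Sch k}
    (hW : IsSmoothVariety W) (h₁ : IsSmoothVariety Y₁) (h₂ : IsSmoothVariety Y₂)
    (a : W ⟶ Y₁) (b : W ⟶ Y₂) [Smooth a.left] [Smooth b.left]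
    (X₁ : Closeds Y₁.left) (X₂ : Closeds Y₂.left)
    (hX : a.left ⁻¹' (X₁ : Set Y₁.left) = b.left ⁻¹' (X₂ : Set Y₂.left)) (w : W.left) (m : Γ₀) :
    inv.HasVal Y₁ X₁ (a.left w) m ↔ inv.HasVal Y₂ X₂ (b.left w) m := by
  have hX' : X₁.preimage a.left.continuous = X₂.preimage b.left.continuous := SetLike.coe_injective hX
  rw [← h.hasVal_comp hW h₁ a, ← h.hasVal_comp hW h₂ b, hX']

lemma isSmoothVariety_of_isAffine {W Y : Sch k} (hY : IsSmoothVariety Y) [IsAffine W.left]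
    (a : W ⟶ Y) [Smooth a.left] : IsSmoothVariety W where
  smooth := by
    have := hY.smooth
    rw [← Over.w a]
    infer_instance
  separated := inferInstance
  quasiCompact := inferInstance

/-- Smooth morphisms are open, and preimage under an open continuous map commutes with closure.
Hence transforms defined as closures are compatible with smooth pullback. -/
lemma preimage_closure_inter {W B : Scheme.{u}} (a : W ⟶ B) [Smooth a] (S : Set B) :
    a ⁻¹' (closure S) = closure (a ⁻¹' S) :=
  a.isOpenMap.preimage_closure_eq_closure_preimage a.continuous S

end Functoriality

/-! ### The locus of maximal invariant on BX -/

namespace Center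

variable {Y : Sch k} (J : Center Y)

lemma mem_basicOpen_exceptional (U : Y.left.AffineZariskiSite)
    (p : PrimeSpectrum (J.sections U).extendedRees) :
    J.chart U p ∈ J.normalCone.basicOpen J.exceptional ↔
      (J.sections U).exceptional ∉ p.asIdeal := by
  change p ∈ J.chart U ⁻¹ᵁ J.normalCone.basicOpen J.exceptional ↔ _
  rw [Scheme.preimage_basicOpen_top, J.chart_exceptional]
  rw [basicOpen_eq_of_affine]
  simp
  rfl

lemma toBase_chart (U : Y.left.AffineZariskiSite)
    (p : PrimeSpectrum (J.sections U).extendedRees) :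
    J.toBase (J.chart U p) = U.2.fromSpec (PrimeSpectrum.comap (J.sections U).const p) := by
  have h := congrArg (fun g : Spec (CommRingCat.of (J.sections U).extendedRees) ⟶ Y.left ↦ g p)
    (J.chart_toBase U)
  exact h

lemma toBase_mem_zeroLocus (U : Y.left.AffineZariskiSite)
    (p : PrimeSpectrum (J.sections U).extendedRees) :
    J.toBase (J.chart U p) ∈ J.zeroLocus ↔
      ∀ f ∈ (J.sections U).ideal 1, (J.sections U).const f ∈ p.asIdeal := by
  rw [toBase_chart]
  have hmem : U.2.fromSpec (PrimeSpectrum.comap (J.sections U).const p) ∈ U.1 := by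
    have : U.2.fromSpec (PrimeSpectrum.comap (J.sections U).const p) ∈ Set.range U.2.fromSpec :=
      ⟨_, rfl⟩
    rwa [U.2.range_fromSpec] at this
  rw [zeroLocus, Scheme.IdealSheafData.mem_support_iff_of_mem (U := ⟨U.1, U.2⟩) hmem,
    Scheme.mem_zeroLocus_iff]
  refine forall₂_congr fun f _ ↦ ?_
  have h2 : PrimeSpectrum.comap (J.sections U).const p ∈ U.2.fromSpec ⁻¹ᵁ Y.left.basicOpen f ↔
      PrimeSpectrum.comap (J.sections U).const p ∈ PrimeSpectrum.basicOpen f := by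
    rw [U.2.fromSpec_preimage_basicOpen]
    rfl
  refine (not_congr h2).trans ?_
  rw [PrimeSpectrum.mem_basicOpen, not_not]
  rfl

lemma chart_comp_toBase_hom_eq {U : Y.left.AffineZariskiSite} {R : Type u} [CommRing R]
    {φ ψ : (J.sections U).extendedRees →+* R}
    (h : ∀ a, φ ((J.sections U).const a) = ψ ((J.sections U).const a)) :
    (Spec.map (CommRingCat.ofHom φ) ≫ J.chart U) ≫ J.toBase =
      (Spec.map (CommRingCat.ofHom ψ) ≫ J.chart U) ≫ J.toBase := by
  rw [Category.assoc, Category.assoc, J.chart_toBase, ← Category.assoc, ← Category.assoc,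
    ← Spec.map_comp, ← Spec.map_comp]
  congr 2
  exact CommRingCat.hom_ext (RingHom.ext fun a ↦ h a)

variable {Γ₀ : Type*} [LinearOrder Γ₀] [OrderBot Γ₀] {inv : SingularityInvariant k Γ₀}

/-- The invariant of `BX` agrees at points which are related by the action of `𝔾_m`. -/
lemma hasVal_coneTransform_coaction (hinv : inv.IsFunctorial) (hY : IsSmoothVariety Y)
    (X : Closeds Y.left) (U : Y.left.AffineZariskiSite)
    (q : PrimeSpectrum (LaurentPolynomial (J.sections U).extendedRees)) (m : Γ₀) :
    inv.HasVal J.cone (J.coneTransform X) (J.chart U (PrimeSpectrum.comap C q)) m ↔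
      inv.HasVal J.cone (J.coneTransform X)
        (J.chart U (PrimeSpectrum.comap (J.sections U).coaction q)) m := by
  have hB := J.isSmoothVariety_cone hY
  have hC := (isStandardSmoothOfRelativeDimension_laurentC (J.sections U).extendedRees)
  -- The coaction is the inclusion of constants followed by an automorphism of R[T, T⁻¹], so it is
  -- just as smooth.
  have hco : (J.sections U).coaction.IsStandardSmoothOfRelativeDimension 1 := by
    obtain ⟨e, he⟩ := (J.sections U).exists_coaction_equiv
    have := (RingHom.IsStandardSmoothOfRelativeDimension.equiv e).comp hC
    have h2 : (e : _ →+* _).comp C = (J.sections U).coaction := RingHom.ext he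
    rwa [h2] at this
  have hC' := (smoothOfRelativeDimension_specMap hC).smooth
  have hco' := (smoothOfRelativeDimension_specMap hco).smooth
  have hbase : (Spec.map (CommRingCat.ofHom C) ≫ J.chart U) ≫ J.toBase =
      (Spec.map (CommRingCat.ofHom (J.sections U).coaction) ≫ J.chart U) ≫ J.toBase :=
    J.chart_comp_toBase_hom_eq fun a ↦ ((J.sections U).coaction_const a).symm
  let W : Sch k := Over.mk ((Spec.map (CommRingCat.ofHom
    (C : (J.sections U).extendedRees →+* LaurentPolynomial (J.sections U).extendedRees)) ≫
      J.chart U) ≫ J.toBase ≫ Y.hom)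
  let a : W ⟶ J.cone := Over.homMk (Spec.map (CommRingCat.ofHom C) ≫ J.chart U) rfl
  let b : W ⟶ J.cone := Over.homMk (Spec.map (CommRingCat.ofHom (J.sections U).coaction) ≫
    J.chart U) (by
      refine (Category.assoc _ _ _).symm.trans ?_
      refine Eq.trans ?_ (Category.assoc _ _ _)
      exact congrArg (· ≫ Y.hom) hbase.symm)
  have : IsAffine W.left := inferInstanceAs (IsAffine (Spec _))
  have ha : Smooth a.left := smooth_comp (Spec.map (CommRingCat.ofHom C)) (J.chart U)
  have hb : Smooth b.left :=
    smooth_comp (Spec.map (CommRingCat.ofHom (J.sections U).coaction)) (J.chart U)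
  refine hinv.hasVal_iff (isSmoothVariety_of_isAffine hB a) hB hB a b _ _ ?_ q m
  refine (preimage_closure_inter a.left _).trans
    (Eq.trans ?_ (preimage_closure_inter b.left _).symm)
  congr 1
  ext q'
  have h1 : J.toBase (a.left q') = J.toBase (b.left q') :=
    congrArg (fun g : W.left ⟶ Y.left ↦ g q') hbase
  have h2 : a.left q' ∈ J.normalCone.basicOpen J.exceptional ↔
      b.left q' ∈ J.normalCone.basicOpen J.exceptional := by
    refine (J.mem_basicOpen_exceptional U (PrimeSpectrum.comap C q')).trans (Iff.trans ?_
      (J.mem_basicOpen_exceptional U (PrimeSpectrum.comap (J.sections U).coaction q')).symm)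
    have hq : (q' : PrimeSpectrum (LaurentPolynomial (J.sections U).extendedRees)).asIdeal.IsPrime :=
      PrimeSpectrum.isPrime _
    refine not_congr ?_
    change C (J.sections U).exceptional ∈ (q' : PrimeSpectrum _).asIdeal ↔
      (J.sections U).coaction (J.sections U).exceptional ∈ (q' : PrimeSpectrum _).asIdeal
    rw [RingFiltration.coaction_exceptional, Ideal.mul_unit_mem_iff_mem _ (isUnit_T _)]
  refine and_congr ?_ h2
  change J.toBase (a.left q') ∈ X ↔ J.toBase (b.left q') ∈ X
  rw [h1]

/-- On the locus where `s ≠ 0` the invariant of `BX` is that of `X`. -/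
lemma hasVal_coneTransform_subtype (hinv : inv.IsFunctorial) (hY : IsSmoothVariety Y)
    (X : Closeds Y.left) (U : Y.left.AffineZariskiSite)
    (p : PrimeSpectrum (J.sections U).extendedRees) (hp : (J.sections U).exceptional ∉ p.asIdeal)
    (m : Γ₀) :
    inv.HasVal J.cone (J.coneTransform X) (J.chart U p) m ↔
      inv.HasVal Y X (J.toBase (J.chart U p)) m := by
  obtain ⟨q, rfl⟩ := exists_point_of_notMem_exceptional p hp
  have hB := J.isSmoothVariety_cone hY
  have hC := (smoothOfRelativeDimension_specMap
    (isStandardSmoothOfRelativeDimension_laurentC Γ(Y.left, U.1))).smooth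
  have hsub : IsOpenImmersion (Spec.map (CommRingCat.ofHom (J.sections U).extendedRees.subtype)) := by
    let _ := (J.sections U).extendedRees.subtype.toAlgebra
    have := (J.sections U).isLocalization_subtype
    exact IsOpenImmersion.of_isLocalization (J.sections U).exceptional
  have hfrom : IsOpenImmersion U.2.fromSpec := U.2.isOpenImmersion_fromSpec
  have hbase : (Spec.map (CommRingCat.ofHom (J.sections U).extendedRees.subtype) ≫ J.chart U) ≫
      J.toBase = Spec.map (CommRingCat.ofHom C) ≫ U.2.fromSpec := by
    rw [Category.assoc, J.chart_toBase, ← Category.assoc, ← Spec.map_comp]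
    rfl
  let W : Sch k := Over.mk ((Spec.map (CommRingCat.ofHom (J.sections U).extendedRees.subtype) ≫
      J.chart U) ≫ J.toBase ≫ Y.hom)
  let a : W ⟶ J.cone := Over.homMk (Spec.map (CommRingCat.ofHom
    (J.sections U).extendedRees.subtype) ≫ J.chart U) rfl
  have : IsAffine W.left := inferInstanceAs (IsAffine (Spec _))
  have ha : Smooth a.left :=
    smooth_comp (Spec.map (CommRingCat.ofHom (J.sections U).extendedRees.subtype)) (J.chart U)
  let b : W ⟶ Y := a ≫ J.coneToBase
  have hb : Smooth b.left := by
    change Smooth ((Spec.map (CommRingCat.ofHom (J.sections U).extendedRees.subtype) ≫ J.chart U) ≫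
      J.toBase)
    rw [hbase]
    infer_instance
  refine hinv.hasVal_iff (isSmoothVariety_of_isAffine hB a) hB hY a b _ _ ?_ q m
  have h1 : b.left ⁻¹' (X : Set Y.left) = closure (b.left ⁻¹' (X : Set Y.left)) :=
    (X.isClosed.preimage b.left.continuous).closure_eq.symm
  refine (preimage_closure_inter a.left _).trans (Eq.trans ?_ h1.symm)
  congr 1
  ext q'
  refine ⟨fun h ↦ h.1, fun h ↦ ⟨h, ?_⟩⟩
  refine (J.mem_basicOpen_exceptional U (PrimeSpectrum.comap
    (J.sections U).extendedRees.subtype q')).mpr fun h0 ↦ ?_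
  have hq : (q' : PrimeSpectrum (LaurentPolynomial Γ(Y.left, U.1))).asIdeal.IsPrime :=
    PrimeSpectrum.isPrime _
  have h2 : C 1 * T (-1) ∈ (q' : PrimeSpectrum (LaurentPolynomial Γ(Y.left, U.1))).asIdeal := h0
  rw [map_one, one_mul] at h2
  exact hq.ne_top (Ideal.eq_top_of_isUnit_mem _ h2 (isUnit_T _))

/-- By semicontinuity the locus where the invariant is at least m is closed, and under the bound it
is the locus where it equals m. -/
lemma isClosed_hasVal {B : Sch k} (hB : IsSmoothVariety B) (X : Closeds B.left) {m : Γ₀}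
    (hm : ∀ x, inv.val B X x ≤ m) : IsClosed {p | inv.HasVal B X p m} := by
  have h1 : IsClosed (inv.val B X ⁻¹' Set.Ici m) :=
    (inv.upperSemicontinuous B X hB).isClosed_preimage m
  have h2 := X.isClosed.isClosedEmbedding_subtypeVal.isClosedMap _ h1
  convert! h2 using 1
  ext p
  constructor
  · rintro ⟨h, rfl⟩
    exact ⟨⟨p, h⟩, le_rfl, rfl⟩
  · rintro ⟨x, hx, rfl⟩
    exact ⟨x.2, le_antisymm (hm x) hx⟩

variable {J} in
/-- The maximal value of the invariant is not attained away from the vertex. -/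
theorem not_hasVal_coneTransform (hinv : inv.IsFunctorial) (hsm : inv.IsSmooth)
    (hY : IsSmoothVariety Y) {X : Closeds Y.left} {m : Γ₀}
    (hJ : ∀ p, p ∈ J.zeroLocus ↔ inv.HasVal Y X p m)
    (hmax : ∀ x, inv.val J.cone (J.coneTransform X) x ≤ m)
    (b : J.cone.left) (hb : b ∈ J.awayFromVertex) :
    ¬ inv.HasVal J.cone (J.coneTransform X) b m := by
  intro hval
  have hB := J.isSmoothVariety_cone hY
  let Z : Closeds J.cone.left := ⟨_, isClosed_hasVal hB _ hmax⟩
  have hZsm : IsSmoothClosed J.cone Z := by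
    refine hsm J.cone (J.coneTransform X) Z hB (Set.ext fun p ↦ ⟨?_, ?_⟩)
    · rintro ⟨h, e⟩
      exact ⟨h, fun q ↦ (hmax q).trans e.ge⟩
    · rintro ⟨h, e⟩
      obtain ⟨h0, e0⟩ := hval
      exact ⟨h, le_antisymm (hmax _) (e0.symm.le.trans (e _))⟩
  obtain ⟨U, hU⟩ := IdealFiltration.exists_mem_affine (J.toBase b)
  obtain ⟨p, rfl⟩ : b ∈ (J.chart U).opensRange := by rw [← J.toBase_preimage]; exact hU
  change PrimeSpectrum (J.sections U).extendedRees at p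
  have hpp : p.asIdeal.IsPrime := p.2
  obtain ⟨n, f, hf, hfp⟩ := (J.chart_mem_awayFromVertex U p).mp hb
  have hf1 : f ∈ (J.sections U).ideal 1 := (J.sections U).antitone (by omega) hf
  let mon := (J.sections U).monomial (n + 1 : ℕ) f hf
  have hmon : mon * (J.sections U).exceptional ^ (n + 1) = (J.sections U).const f :=
    (J.sections U).monomial_mul_exceptional_pow (n + 1) f hf
  -- On the maximal locus s · f T^(n+1) vanishes: where s ≠ 0 the point lies over V(J̄), and there f
  -- = (f T^(n+1)) s^(n+1) is zero.
  have key : ∀ p' : PrimeSpectrum (J.sections U).extendedRees,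
      inv.HasVal J.cone (J.coneTransform X) (J.chart U p') m →
      (J.sections U).exceptional * mon ∈ p'.asIdeal := by
    intro p' hp'
    by_contra hcon
    have hprime : p'.asIdeal.IsPrime := p'.2
    have hs : (J.sections U).exceptional ∉ p'.asIdeal := fun h ↦
      hcon (Ideal.mul_mem_right _ _ h)
    have hm' : mon ∉ p'.asIdeal := fun h ↦ hcon (Ideal.mul_mem_left _ _ h)
    have h1 := (J.hasVal_coneTransform_subtype hinv hY X U p' hs m).mp hp'
    rw [← hJ, toBase_mem_zeroLocus] at h1
    have h2 := h1 f hf1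
    rw [← hmon] at h2
    exact (hprime.mem_or_mem h2).elim hm' fun h ↦ hs (hprime.mem_of_pow_mem _ h)
  have hsp : (J.sections U).exceptional ∈ p.asIdeal :=
    (hpp.mem_or_mem (key p hval)).resolve_right hfp
  -- `ph` is the generic point of the orbit closure of b. It has maximal invariant by
  -- 𝔾_m-invariance, and f T^(n+1) is nonzero at it because this element is homogeneous.
  obtain ⟨q, hqC, hqco⟩ := RingFiltration.exists_homogeneous_prime p
  have hqC' : PrimeSpectrum.comap C q = p := PrimeSpectrum.ext hqC
  let ph : PrimeSpectrum (J.sections U).extendedRees :=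
    PrimeSpectrum.comap (J.sections U).coaction q
  have hph : inv.HasVal J.cone (J.coneTransform X) (J.chart U ph) m := by
    rw [← J.hasVal_coneTransform_coaction hinv hY X U q m, hqC']
    exact hval
  obtain ⟨ψ, hψc, hψs, hψ0⟩ := RingFiltration.exists_ringHom_polynomial p hsp
  have hq0 : (p.asIdeal.comap (J.sections U).const).IsPrime := inferInstance
  have hdom : IsDomain (Γ(Y.left, U.1) ⧸ p.asIdeal.comap (J.sections U).const) := inferInstance
  -- `pv` is the generic point of the line with coordinate s in the vertex, over the image of b in
  -- Y, and `p0` is the origin of this line.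
  let pv : PrimeSpectrum (J.sections U).extendedRees := ⟨RingHom.ker ψ, RingHom.ker_isPrime ψ⟩
  let p0 : PrimeSpectrum (J.sections U).extendedRees :=
    ⟨RingHom.ker ((Polynomial.constantCoeff).comp ψ), RingHom.ker_isPrime _⟩
  have hpv0 : pv ≤ p0 := fun r hr ↦ by
    have hr' : ψ r = 0 := hr
    change Polynomial.constantCoeff (ψ r) = 0
    rw [hr', map_zero]
  have hph0 : ph ≤ p0 := fun r hr ↦ by
    have h1 := (hqco r).mp hr 0
    change (ψ r).coeff 0 = 0
    rw [hψ0, Ideal.Quotient.eq_zero_iff_mem, Ideal.mem_comap, RingFiltration.const_eq_monomial]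
    exact h1
  have hsv : (J.sections U).exceptional ∉ pv.asIdeal := fun h ↦ by
    have h' : ψ (J.sections U).exceptional = 0 := h
    rw [hψs] at h'
    exact Polynomial.X_ne_zero h'
  have hpv : inv.HasVal J.cone (J.coneTransform X) (J.chart U pv) m := by
    rw [J.hasVal_coneTransform_subtype hinv hY X U pv hsv m, ← hJ, toBase_mem_zeroLocus]
    intro f' hf'
    change ψ _ = 0
    rw [hψc, Ideal.Quotient.eq_zero_iff_mem.mpr, map_zero]
    rw [Ideal.mem_comap, ← (J.sections U).monomial_mul_exceptional_pow 1 f' hf', pow_one]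
    exact Ideal.mul_mem_left _ _ hsp
  have hmonh : mon ∉ ph.asIdeal := fun h ↦ hfp (by
    have h1 := (hqco mon).mp h (n + 1 : ℕ)
    have h2 : mon.1.coeff (n + 1 : ℕ) = f :=
      ((J.sections U).coeff_monomial _ _ hf _).trans (if_pos rfl)
    rwa [(J.sections U).monomial_congr h2] at h1)
  have hp0 : inv.HasVal J.cone (J.coneTransform X) (J.chart U p0) m :=
    (((PrimeSpectrum.le_iff_specializes ph p0).mp hph0).map
      (J.chart U).continuous).mem_closed Z.isClosed hph
  let Zs := reducedSubscheme J.cone Z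
  let i : Zs ⟶ J.normalCone := reducedSubschemeι J.cone Z
  have hred : IsReduced Zs := isReduced_subscheme_vanishingIdeal Z
  have hi : IsClosedImmersion i :=
    inferInstanceAs (IsClosedImmersion (Scheme.IdealSheafData.vanishingIdeal Z).subschemeι)
  have hirange : Set.range i = {p | inv.HasVal J.cone (J.coneTransform X) p m} :=
    (Scheme.IdealSheafData.range_subschemeι (Scheme.IdealSheafData.vanishingIdeal Z)).trans
      (Scheme.IdealSheafData.coe_support_vanishingIdeal Z)
  have hism : Smooth (i ≫ J.cone.hom) := hZsm
  let O : Zs.Opens := i ⁻¹ᵁ (J.chart U).opensRange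
  obtain ⟨φ, hφ⟩ := IdealFiltration.exists_eq_ofRingHom (J := J.toIdealFiltration) (U := U)
    (O.ι ≫ i) fun z ↦ by
      change (O.ι ≫ i) z ∈ J.toBase ⁻¹ᵁ U.1
      rw [J.toBase_preimage]
      exact z.2
  have hchart : ∀ z, J.chart U (toSpec φ z) = i z.1 := fun z ↦
    (congrArg (fun g : O.toScheme ⟶ J.normalCone ↦ g z) hφ).symm
  have hpoint : ∀ p', inv.HasVal J.cone (J.coneTransform X) (J.chart U p') m →
      ∃ z, toSpec φ z = p' := by
    intro p' hp'
    obtain ⟨x, hx⟩ : J.chart U p' ∈ Set.range i := by rw [hirange]; exact hp'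
    refine ⟨⟨x, ⟨p', hx.symm⟩⟩, (J.chart U).isOpenEmbedding.injective ?_⟩
    exact (hchart ⟨x, ⟨p', hx.symm⟩⟩).trans hx
  -- The maximal locus carries its reduced structure, so a function which vanishes at all its points
  -- is zero.
  have hgh : φ (J.sections U).exceptional * φ mon = 0 := by
    rw [← map_mul]
    refine eq_zero_of_basicOpen_eq_bot _ ?_
    rw [← toSpec_preimage_basicOpen, eq_bot_iff]
    intro z hz
    refine hz (key _ ?_)
    have h3 : i z.1 ∈ Set.range i := ⟨_, rfl⟩
    rw [hirange, ← hchart] at h3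
    exact h3
  obtain ⟨z0, hz0⟩ := hpoint p0 hp0
  obtain ⟨zh, hzh⟩ := hpoint ph hph
  obtain ⟨zv, hzv⟩ := hpoint pv hpv
  have hspec : ∀ (z) (p' : PrimeSpectrum (J.sections U).extendedRees), toSpec φ z = p' → p' ≤ p0 →
      z ⤳ z0 := by
    intro z p' hz hle
    have hind : Topology.IsInducing (O.ι ≫ i) :=
      hi.isClosedEmbedding.isInducing.comp O.ι.isOpenEmbedding.isInducing
    rw [← hind.specializes_iff]
    change i z.1 ⤳ i z0.1
    rw [← hchart, ← hchart, hz0, hz]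
    exact ((PrimeSpectrum.le_iff_specializes _ _).mp hle).map (J.chart U).continuous
  have hcontra : ∀ (V : O.toScheme.Opens) (z : O.toScheme) (g), z ⤳ z0 → z0 ∈ V →
      toSpec φ z ∈ (PrimeSpectrum.basicOpen g : (Spec (CommRingCat.of (J.sections U).extendedRees)).Opens) →
      O.toScheme.presheaf.map (homOfLE (le_top : V ≤ ⊤)).op (φ g) ≠ 0 := by
    intro V z g hz hV hg h0
    have h1 : z ∈ V := hz.mem_open V.2 hV
    have h2 : z ∈ O.toScheme.basicOpen (φ g) := by rw [← toSpec_preimage_basicOpen]; exact hg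
    have h3 : z ∈ O.toScheme.basicOpen (O.toScheme.presheaf.map
        (homOfLE (le_top : V ≤ ⊤)).op (φ g)) := by
      rw [Scheme.basicOpen_res]; exact ⟨h1, h2⟩
    rw [h0, Scheme.basicOpen_zero] at h3
    exact h3
  have hsmO : Smooth (O.ι ≫ i ≫ J.cone.hom) := inferInstance
  -- Local irreducibility at `p0` kills one of the two factors nearby. But s is nonzero at `pv`, f
  -- T^(n+1) is nonzero at `ph`, and both points specialize to `p0`.
  obtain ⟨V, hV, hzV, h0 | h0⟩ := exists_opens_eq_zero_of_mul_eq_zero (O.ι ≫ i ≫ J.cone.hom) z0 ⊤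
    trivial _ _ hgh
  · exact hcontra V zv _ (hspec zv pv hzv hpv0) hzV (by rw [hzv]; exact hsv) h0
  · exact hcontra V zh _ (hspec zh ph hzh hph0) hzV (by rw [hzh]; exact hmonh) h0

end Center

end

/-! ### Maxima of the invariant, the torus and the arrow groupoid -/

section

variable {k : Type u} [Field k]

/-- The invariant attains a maximum on every nonempty closed subvariety. -/
lemma SingularityInvariant.exists_isMax {Γ₀ : Type*} [LinearOrder Γ₀] [OrderBot Γ₀]
    (inv : SingularityInvariant k Γ₀) {Y : Sch k} (hY : IsSmoothVariety Y) (X : Closeds Y.left)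
    [Nonempty X] : ∃ x, ∀ y, inv.val Y X y ≤ inv.val Y X x := by
  have := hY.noetherianSpace
  have hX : NoetherianSpace X := Topology.IsInducing.subtypeVal.noetherianSpace
  have hwf : WellFoundedLT (Closeds X) := ((noetherianSpace_TFAE X).out 0 1).mp hX
  let c (x : X) : Closeds X :=
    ⟨inv.val Y X ⁻¹' Set.Ici (inv.val Y X x),
      (inv.upperSemicontinuous Y X hY).isClosed_preimage _⟩
  -- In a noetherian space some superlevel set {inv ≥ inv x} is minimal; a larger value at y would
  -- give a strictly smaller one.
  obtain ⟨_, ⟨x, rfl⟩, hx⟩ := hwf.wf.has_min (Set.range c) (Set.range_nonempty c)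
  refine ⟨x, fun y ↦ not_lt.mp fun hxy ↦ hx _ ⟨y, rfl⟩ ?_⟩
  refine lt_of_le_of_ne (fun z hz ↦ hxy.le.trans hz) fun h ↦ ?_
  have h1 : x ∈ c x := le_refl (inv.val Y X x)
  rw [← h] at h1
  exact hxy.not_ge h1

/-! ### Points of the torus -/

section Torus

variable {S S' : Sch k}

lemma toSpec_hom (S : Sch k) : S.hom = toSpec (scalars S ⊤) := by
  obtain ⟨φ, hφ⟩ := exists_eq_toSpec (R := k) S.hom
  rw [hφ]
  congr 1
  ext c
  have h1 : scalars S ⊤ c = S.left.presheaf.map (homOfLE (le_top : (⊤ : S.left.Opens) ≤ ⊤)).op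
      (S.hom.appTop ((Scheme.ΓSpecIso (CommRingCat.of k)).inv c)) := rfl
  rw [h1, hφ, toSpec_appTop]
  exact congr($(S.left.presheaf.map_id _) (φ c)).symm

/-- The product of the coordinates becomes a unit, so evaluation at t extends to the localization.
Together with `torus_hom_ext` this says that the torus represents tuples of units, so morphisms to
the scheme of arrows are pairs (t, u). -/
lemma exists_torus_hom (r : ℕ) (t : Fin r → Γ(S.left, ⊤)ˣ) :
    ∃ a : S ⟶ torus k r, pullbackUnits a (torusCoordinates k r) = t := by
  let φ : MvPolynomial (Fin r) k →+* Γ(S.left, ⊤) :=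
    MvPolynomial.eval₂Hom (scalars S ⊤) fun i ↦ (t i : Γ(S.left, ⊤))
  have hφ : IsUnit (φ (∏ i, MvPolynomial.X i)) := by
    rw [map_prod]
    have : ∏ i, φ (MvPolynomial.X i) = ((∏ i, t i : Γ(S.left, ⊤)ˣ) : Γ(S.left, ⊤)) := by
      rw [Units.coe_prod]
      exact Finset.prod_congr rfl fun i _ ↦ MvPolynomial.eval₂Hom_X' _ _ i
    rw [this]
    exact Units.isUnit _
  let ψ : torusRing k r →+* Γ(S.left, ⊤) := IsLocalization.Away.lift _ hφ
  have hψ (x) : ψ (algebraMap _ _ x) = φ x := IsLocalization.Away.lift_eq _ hφ x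
  refine ⟨Over.homMk (toSpec ψ) ?_, ?_⟩
  · change toSpec ψ ≫ Spec.map _ = _
    rw [toSpec_comp_map, toSpec_hom S]
    congr 1
    ext c
    change ψ (algebraMap k (torusRing k r) c) = _
    rw [IsScalarTower.algebraMap_apply k (MvPolynomial (Fin r) k) (torusRing k r), hψ]
    exact MvPolynomial.eval₂Hom_C _ _ c
  · ext i
    refine (toSpec_appTop ψ _).trans ?_
    exact (hψ _).trans (MvPolynomial.eval₂Hom_X' _ _ i)

lemma torus_hom_ext {r : ℕ} {a b : S ⟶ torus k r}
    (h : pullbackUnits a (torusCoordinates k r) = pullbackUnits b (torusCoordinates k r)) :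
    a = b := by
  ext1
  obtain ⟨φ, hφ⟩ := exists_eq_toSpec (R := torusRing k r) a.left
  obtain ⟨ψ, hψ⟩ := exists_eq_toSpec (R := torusRing k r) b.left
  have hk : φ.comp (algebraMap k (torusRing k r)) = ψ.comp (algebraMap k (torusRing k r)) := by
    have h1 : a.left ≫ (torus k r).hom = b.left ≫ (torus k r).hom := by rw [Over.w, Over.w]
    rw [hφ, hψ] at h1
    refine toSpec_injective ?_
    rw [← toSpec_comp_map, ← toSpec_comp_map]
    exact h1
  rw [hφ, hψ]
  congr 1
  refine IsLocalization.ringHom_ext (.powers (∏ i : Fin r, MvPolynomial.X i : MvPolynomial (Fin r) k))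
    (MvPolynomial.ringHom_ext (R := k) (fun c ↦ ?_) fun i ↦ ?_)
  · have := congr($hk c)
    rwa [RingHom.comp_apply, RingHom.comp_apply,
      IsScalarTower.algebraMap_apply k (MvPolynomial (Fin r) k) (torusRing k r)] at this
  · have h1 : a.left.appTop ((Scheme.ΓSpecIso (CommRingCat.of (torusRing k r))).inv
        (algebraMap _ _ (MvPolynomial.X i : MvPolynomial (Fin r) k))) = b.left.appTop
        ((Scheme.ΓSpecIso (CommRingCat.of (torusRing k r))).inv
          (algebraMap _ _ (MvPolynomial.X i : MvPolynomial (Fin r) k))) := congrArg Units.val (congrFun h i)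
    have h2 := toSpec_appTop φ (algebraMap (MvPolynomial (Fin r) k) (torusRing k r) (MvPolynomial.X i))
    have h3 := toSpec_appTop ψ (algebraMap (MvPolynomial (Fin r) k) (torusRing k r) (MvPolynomial.X i))
    rw [hφ, hψ] at h1
    exact h2.symm.trans (h1.trans h3)

lemma pullbackUnits_comp (g : S' ⟶ S) {S'' : Sch k} (g' : S'' ⟶ S') {r : ℕ}
    (t : Fin r → Γ(S.left, ⊤)ˣ) : pullbackUnits g' (pullbackUnits g t) = pullbackUnits (g' ≫ g) t :=
  rfl

lemma pullbackUnits_mul (g : S' ⟶ S) {r : ℕ} (t t' : Fin r → Γ(S.left, ⊤)ˣ) :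
    pullbackUnits g (t * t') = pullbackUnits g t * pullbackUnits g t' :=
  funext fun _ ↦ map_mul _ _ _

lemma pullbackUnits_inv (g : S' ⟶ S) {r : ℕ} (t : Fin r → Γ(S.left, ⊤)ˣ) :
    pullbackUnits g t⁻¹ = (pullbackUnits g t)⁻¹ :=
  funext fun _ ↦ map_inv _ _

lemma pullbackUnits_tail (g : S' ⟶ S) {r : ℕ} (t : Fin (r + 1) → Γ(S.left, ⊤)ˣ) :
    Fin.tail (pullbackUnits g t) = pullbackUnits g (Fin.tail t) := rfl

lemma smooth_torus (r : ℕ) : Smooth (torus k r).hom := by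
  have h1 : (MvPolynomial.C : k →+* MvPolynomial (Fin r) k).IsStandardSmoothOfRelativeDimension r :=
    (RingHom.isStandardSmoothOfRelativeDimension_algebraMap r).mpr
      (isStandardSmoothOfRelativeDimension_mvPolynomial k r)
  have h2 : (algebraMap (MvPolynomial (Fin r) k) (torusRing k r)).IsStandardSmoothOfRelativeDimension
      0 := RingHom.IsStandardSmoothOfRelativeDimension.algebraMap_isLocalizationAway
        (∏ i : Fin r, MvPolynomial.X i : MvPolynomial (Fin r) k)
  have h3 := smoothOfRelativeDimension_specMap (h2.comp h1)
  have h4 : (algebraMap (MvPolynomial (Fin r) k) (torusRing k r)).comp MvPolynomial.C =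
      algebraMap k (torusRing k r) :=
    (IsScalarTower.algebraMap_eq k (MvPolynomial (Fin r) k) (torusRing k r)).symm
  rw [h4] at h3
  exact h3.smooth

instance (r : ℕ) : IsAffineHom (torus k r).hom :=
  inferInstanceAs (IsAffineHom (Spec.map _))

end Torus

lemma smooth_prod_snd {X Y : Sch k} (h : Smooth X.hom) : Smooth (prod.snd : X ⨯ Y ⟶ Y).left := by
  rw [← Over.prodLeftIsoPullback_hom_snd]
  infer_instance

lemma isAffineHom_prod_snd {X Y : Sch k} (h : IsAffineHom X.hom) :
    IsAffineHom (prod.snd : X ⨯ Y ⟶ Y).left := by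
  have : IsAffineHom (pullback.snd X.hom Y.hom) :=
    isAffineHom_isStableUnderBaseChange.of_isPullback (IsPullback.of_hasPullback X.hom Y.hom) h
  rw [← Over.prodLeftIsoPullback_hom_snd]
  have h1 : IsAffineHom (Over.prodLeftIsoPullback X Y).hom := inferInstance
  infer_instance

lemma IsSmoothVariety.of_smooth_of_isAffineHom {W Y : Sch k} (hY : IsSmoothVariety Y) (a : W ⟶ Y)
    [Smooth a.left] [IsAffineHom a.left] : IsSmoothVariety W where
  smooth := by
    have := hY.smooth
    rw [← Over.w a]
    infer_instance
  separated := by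
    have := hY.separated
    rw [← Over.w a]
    infer_instance
  quasiCompact := by
    have := hY.quasiCompact
    rw [← Over.w a]
    infer_instance

namespace QuotientStack

variable (𝒴 : QuotientStack k) {S : Sch k}

/-- The torus coordinates on the scheme of arrows. -/
def arrowUnits : Fin 𝒴.rank → Γ(𝒴.arrows.left, ⊤)ˣ :=
  pullbackUnits (prod.fst : torus k 𝒴.rank ⨯ 𝒴.atlas ⟶ _) (torusCoordinates k 𝒴.rank)

lemma target_eq : 𝒴.target = 𝒴.action.smul 𝒴.arrowUnits 𝒴.source := rfl

lemma comp_target (a : S ⟶ 𝒴.arrows) :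
    a ≫ 𝒴.target = 𝒴.action.smul (pullbackUnits a 𝒴.arrowUnits) (a ≫ 𝒴.source) :=
  𝒴.action.comp_smul _ _ _

lemma exists_arrow (t : Fin 𝒴.rank → Γ(S.left, ⊤)ˣ) (u : S ⟶ 𝒴.atlas) :
    ∃ a : S ⟶ 𝒴.arrows, pullbackUnits a 𝒴.arrowUnits = t ∧ a ≫ 𝒴.source = u := by
  obtain ⟨b, hb⟩ := exists_torus_hom 𝒴.rank t
  refine ⟨prod.lift b u, ?_, prod.lift_snd _ _⟩
  exact (congrArg (fun g ↦ pullbackUnits g (torusCoordinates k 𝒴.rank)) (prod.lift_fst b u)).trans hb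

variable {𝒴}

lemma arrow_ext {a b : S ⟶ 𝒴.arrows}
    (h : pullbackUnits a 𝒴.arrowUnits = pullbackUnits b 𝒴.arrowUnits)
    (h' : a ≫ 𝒴.source = b ≫ 𝒴.source) : a = b :=
  Limits.prod.hom_ext (torus_hom_ext h) h'

variable (𝒴)

/-- The inversion `(t, u) ↦ (t⁻¹, t • u)` exchanges source and target. -/
lemma exists_arrow_inverse : ∃ e : 𝒴.arrows ≅ 𝒴.arrows,
    e.hom ≫ 𝒴.source = 𝒴.target ∧ e.hom ≫ 𝒴.target = 𝒴.source := by
  obtain ⟨a, ha, ha'⟩ := 𝒴.exists_arrow 𝒴.arrowUnits⁻¹ 𝒴.target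
  have h1 : a ≫ 𝒴.target = 𝒴.source := by
    rw [comp_target, ha, ha', target_eq, ← 𝒴.action.mul_smul, inv_mul_cancel, 𝒴.action.one_smul]
  have h2 : a ≫ a = 𝟙 _ := by
    refine arrow_ext ?_ ?_
    · rw [← pullbackUnits_comp, ha, pullbackUnits_inv, ha, inv_inv]
      ext i
      exact (congr($(Scheme.Hom.id_appTop (X := 𝒴.arrows.left)) (𝒴.arrowUnits i : Γ(𝒴.arrows.left, ⊤)))).symm
    · rw [Category.assoc, ha', h1, Category.id_comp]
  exact ⟨⟨a, a, h2, h2⟩, ha', h1⟩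

instance smooth_source : Smooth 𝒴.source.left := smooth_prod_snd (smooth_torus _)

instance isAffineHom_source : IsAffineHom 𝒴.source.left := isAffineHom_prod_snd inferInstance

instance smooth_target : Smooth 𝒴.target.left := by
  obtain ⟨e, h, -⟩ := 𝒴.exists_arrow_inverse
  rw [← h]
  have : IsIso e.hom.left := inferInstanceAs (IsIso ((Over.forget _).map e.hom))
  have : Smooth e.hom.left := inferInstance
  exact smooth_comp e.hom.left 𝒴.source.left

variable {𝒴}

lemma isSmoothVariety_arrows (h : IsSmoothVariety 𝒴.atlas) : IsSmoothVariety 𝒴.arrows :=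
  h.of_smooth_of_isAffineHom 𝒴.source

end QuotientStack

namespace SingularityInvariant

variable {Γ₀ : Type*} [LinearOrder Γ₀] [OrderBot Γ₀] {inv : SingularityInvariant k Γ₀}
  {𝒴 : QuotientStack k} {X : Closeds 𝒴.atlas.left}

/-- The value at a class is taken at a chosen representative. The choice is harmless because source
and target are smooth and pull the invariant set X back to the same set. -/
lemma onStack_mk (hinv : inv.IsFunctorial) (h𝒴 : IsSmoothVariety 𝒴.atlas) (hX : 𝒴.IsInvariant X)
    (p : X) : inv.onStack 𝒴 X (QuotientStack.Points.mk p) = inv.val 𝒴.atlas X p := by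
  have hq : ∀ x y : X, (∃ z : 𝒴.arrows.left, 𝒴.source.left z = x.1 ∧ 𝒴.target.left z = y.1) →
      inv.val 𝒴.atlas X x = inv.val 𝒴.atlas X y := by
    rintro ⟨_, hx⟩ ⟨_, hy⟩ ⟨z, rfl, rfl⟩
    have h1 := hinv.hasVal_iff (QuotientStack.isSmoothVariety_arrows h𝒴) h𝒴 h𝒴 𝒴.target 𝒴.source X X
      (congrArg (SetLike.coe) hX) z (inv.val 𝒴.atlas X ⟨_, hx⟩)
    obtain ⟨_, h2⟩ := h1.mpr ⟨hx, rfl⟩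
    exact h2.symm
  let f : 𝒴.Points X → Γ₀ := Quot.lift (inv.val 𝒴.atlas X) hq
  have h : ∀ x, f (QuotientStack.Points.mk x) = inv.val 𝒴.atlas X x := fun _ ↦ rfl
  rw [← h, onStack, ← h]
  exact congrArg f (Quot.out_eq _)

lemma isMax_iff (hinv : inv.IsFunctorial) (h𝒴 : IsSmoothVariety 𝒴.atlas) (hX : 𝒴.IsInvariant X)
    (m : Γ₀) : inv.IsMax 𝒴 X m ↔ IsGreatest (Set.range (inv.val 𝒴.atlas X)) m := by
  have : Set.range (inv.onStack 𝒴 X) = Set.range (inv.val 𝒴.atlas X) := by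
    ext γ
    constructor
    · rintro ⟨q, rfl⟩
      exact ⟨Quot.out q, rfl⟩
    · rintro ⟨p, rfl⟩
      exact ⟨_, onStack_mk hinv h𝒴 hX p⟩
  rw [IsMax, this]

lemma Criterion.mem_zeroLocus_iff (hinv : inv.IsFunctorial) (h𝒴 : IsSmoothVariety 𝒴.atlas)
    (hX : 𝒴.IsInvariant X) {J : Center 𝒴.atlas} (h : inv.Criterion 𝒴 X J) {m : Γ₀}
    (hm : inv.IsMax 𝒴 X m) (p : 𝒴.atlas.left) :
    p ∈ J.zeroLocus ↔ inv.HasVal 𝒴.atlas X p m := by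
  have h1 : p ∈ J.zeroLocus ↔ p ∈ {p | ∃ h : p ∈ X,
      inv.IsMax 𝒴 X (inv.onStack 𝒴 X (QuotientStack.Points.mk ⟨p, h⟩))} := by
    rw [← h.zeroLocus_eq]; rfl
  rw [h1]
  refine exists_congr fun hp ↦ ?_
  rw [onStack_mk hinv h𝒴 hX]
  exact ⟨fun h ↦ h.unique hm, fun h ↦ h ▸ hm⟩

end SingularityInvariant

end

/-! ### Strict decrease of the maximum under a weighted blowup -/

section

variable {k : Type u} [Field k] {𝒴 : QuotientStack k} {J : Center 𝒴.atlas}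

namespace QuotientStack

/-- Every pair (t, u) is an S-point of the scheme of arrows, with target t • u, so invariance along
the universal arrow gives it for all points. -/
lemma IsInvariant.mem_iff {X : Closeds 𝒴.atlas.left} (hX : 𝒴.IsInvariant X) {S : Sch k}
    (t : Fin 𝒴.rank → Γ(S.left, ⊤)ˣ) (u : S ⟶ 𝒴.atlas) (z : S.left) :
    (𝒴.action.smul t u).left z ∈ X ↔ u.left z ∈ X := by
  obtain ⟨a, ha, rfl⟩ := 𝒴.exists_arrow t u
  rw [← ha, ← comp_target]
  have h : ∀ w, w ∈ X.preimage 𝒴.target.left.continuous ↔ w ∈ X.preimage 𝒴.source.left.continuous :=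
    fun w ↦ by rw [hX]
  exact h (a.left z)

namespace WeightedBlowup

variable (W : 𝒴.WeightedBlowup J)

/-- The morphism from the atlas of a weighted blowup to the atlas of the stack. -/
def toAtlas (J : Center 𝒴.atlas) : J.puncturedCone ⟶ 𝒴.atlas := J.puncturedConeι ≫ J.coneToBase

/-- The restriction of `s` to the punctured cone. -/
def parameter (J : Center 𝒴.atlas) : Γ(J.puncturedCone.left, ⊤) :=
  J.puncturedConeι.left.appTop J.exceptional

lemma smul_toAtlas {S : Sch k} (t : Fin (𝒴.rank + 1) → Γ(S.left, ⊤)ˣ) (b : S ⟶ J.puncturedCone) :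
    W.action.smul t b ≫ toAtlas J = 𝒴.action.smul (Fin.tail t) (b ≫ toAtlas J) :=
  W.equivariant t b

lemma smul_parameter {S : Sch k} (t : Fin (𝒴.rank + 1) → Γ(S.left, ⊤)ˣ) (b : S ⟶ J.puncturedCone) :
    (W.action.smul t b).left.appTop (parameter J) =
      ((t 0)⁻¹ : Γ(S.left, ⊤)ˣ) * b.left.appTop (parameter J) :=
  W.weight t b

/-- B₊ is open in B, so the trace of the closure BX is a closure inside B₊. -/
lemma coe_puncturedConeTransform (X : Closeds 𝒴.atlas.left) :
    (J.puncturedConeTransform X : Set J.puncturedCone.left) =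
      closure ((toAtlas J).left ⁻¹' X ∩ J.puncturedCone.left.basicOpen (parameter J)) := by
  refine (preimage_closure_inter J.puncturedConeι.left _).trans ?_
  have := Scheme.preimage_basicOpen_top J.puncturedConeι.left J.exceptional
  exact congrArg (fun U : J.puncturedCone.left.Opens ↦
    closure ((toAtlas J).left ⁻¹' X ∩ (U : Set J.puncturedCone.left))) this

/-- The set whose closure is taken is cut out by σ ∈ X and s ≠ 0: σ is equivariant, X is invariant,
and the action multiplies s by a unit. -/
lemma isInvariant_puncturedConeTransform {X : Closeds 𝒴.atlas.left} (hX : 𝒴.IsInvariant X) :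
    W.stack.IsInvariant (J.puncturedConeTransform X) := by
  refine SetLike.coe_injective ?_
  change W.stack.target.left ⁻¹' (J.puncturedConeTransform X : Set J.puncturedCone.left) =
    W.stack.source.left ⁻¹' (J.puncturedConeTransform X : Set J.puncturedCone.left)
  rw [coe_puncturedConeTransform]
  refine (preimage_closure_inter W.stack.target.left _).trans
    (Eq.trans ?_ (preimage_closure_inter W.stack.source.left _).symm)
  congr 1
  ext z
  refine and_congr ?_ ?_
  · have h1 := W.smul_toAtlas W.stack.arrowUnits W.stack.source
    have h2 := hX.mem_iff (Fin.tail W.stack.arrowUnits) (W.stack.source ≫ toAtlas J) z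
    exact (iff_of_eq (congrArg (fun g : _ ⟶ 𝒴.atlas ↦ g.left z ∈ X) h1)).trans h2
  · have h1 := Scheme.preimage_basicOpen_top W.stack.target.left (parameter J)
    have h2 := Scheme.preimage_basicOpen_top W.stack.source.left (parameter J)
    have h3 := W.smul_parameter W.stack.arrowUnits W.stack.source
    have h4 : W.stack.target.left ⁻¹ᵁ (J.puncturedCone.left.basicOpen (parameter J)) =
        W.stack.source.left ⁻¹ᵁ (J.puncturedCone.left.basicOpen (parameter J)) := by
      refine h1.trans (Eq.trans ?_ h2.symm)
      refine (congrArg _ h3).trans ?_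
      rw [Scheme.basicOpen_mul, Scheme.basicOpen_of_isUnit _ (Units.isUnit _), top_inf_eq]
      rfl
    change z ∈ W.stack.target.left ⁻¹ᵁ (J.puncturedCone.left.basicOpen (parameter J)) ↔
      z ∈ W.stack.source.left ⁻¹ᵁ (J.puncturedCone.left.basicOpen (parameter J))
    rw [h4]

/-- The new maximum exists because B₊ is noetherian. It is at most m because the invariant of BX ∖ V
is that of BX restricted to an open subset, and it differs from m by
`Center.not_hasVal_coneTransform`. -/
theorem exists_isMax_lt {Γ₀ : Type*} [LinearOrder Γ₀] [OrderBot Γ₀]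
    {inv : SingularityInvariant k Γ₀} (hinv : inv.IsFunctorial) (hsm : inv.IsSmooth)
    (h𝒴 : IsSmoothVariety 𝒴.atlas) {X : Closeds 𝒴.atlas.left} (hX : 𝒴.IsInvariant X)
    (hJ : inv.Criterion 𝒴 X J) {m : Γ₀} (hm : inv.IsMax 𝒴 X m)
    (h : Nonempty (W.stack.Points (J.puncturedConeTransform X))) :
    ∃ m', inv.IsMax W.stack (J.puncturedConeTransform X) m' ∧ m' < m := by
  have hB := J.isSmoothVariety_cone h𝒴
  have hP := J.isSmoothVariety_puncturedCone h𝒴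
  have hP' : IsSmoothVariety W.stack.atlas := hP
  have hinvt := W.isInvariant_puncturedConeTransform hX
  have : Nonempty (J.puncturedConeTransform X) := h.map Quot.out
  obtain ⟨x, hx⟩ := inv.exists_isMax hP (J.puncturedConeTransform X)
  obtain ⟨m0, hm0, hm0'⟩ := hJ.max_eq
  obtain rfl := hm0.unique hm
  have hle : ∀ x, inv.val J.cone (J.coneTransform X) x ≤ m0 := fun x ↦ hm0'.2 ⟨x, rfl⟩
  have hval := (hinv.hasVal_comp hP hB J.puncturedConeι (J.coneTransform X) x.1
    (inv.val _ (J.puncturedConeTransform X) x)).mp ⟨x.2, rfl⟩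
  refine ⟨inv.val _ (J.puncturedConeTransform X) x,
    (SingularityInvariant.isMax_iff hinv hP' hinvt _).mpr
      ⟨⟨x, rfl⟩, by rintro _ ⟨y, rfl⟩; exact hx y⟩, lt_of_le_of_ne ?_ fun heq ↦ ?_⟩
  · obtain ⟨h1, h2⟩ := hval
    rw [← h2]
    exact hle _
  · rw [heq] at hval
    refine Center.not_hasVal_coneTransform hinv hsm h𝒴
      (hJ.mem_zeroLocus_iff hinv h𝒴 hX hm) hle (J.puncturedConeι.left x.1) ?_ hval
    exact (x.1 : J.awayFromVertex).2

end WeightedBlowup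

end QuotientStack

end

/-! ### Construction of the torus action on B and B₊ -/

section

lemma IsRegularSection.mul_cancel {Z : Scheme.{u}} {c : Γ(Z, ⊤)} (hc : IsRegularSection c) (n : ℕ)
    {x y : Γ(Z, ⊤)} (h : x * c ^ n = y * c ^ n) : x = y := by
  induction n with
  | zero => simpa using h
  | succ n ih =>
    refine ih (sub_eq_zero.mp (hc.eq_zero ?_))
    rw [pow_succ, ← mul_assoc, ← mul_assoc] at h
    linear_combination h

lemma flat_of_smooth {X Y : Scheme.{u}} (f : X ⟶ Y) [Smooth f] : Flat f := inferInstance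

namespace IdealFiltration

variable {Y Z : Scheme.{u}} (J : IdealFiltration Y)

/-- When s is regular, b(z) lies in the vertex exactly if for every n > 0 the pullback of I_n is
contained, near z, in s^n times the functions vanishing at z. This condition depends only on the
pulled back ideals and on s up to a unit. -/
lemma mem_awayFromVertex_of_comap_eq {b b' : Z ⟶ J.normalCone} (c : Γ(Z, ⊤)ˣ)
    (hb : IsRegularSection (b.appTop J.exceptional))
    (hs : b'.appTop J.exceptional = c * b.appTop J.exceptional)
    (h : ∀ n, (J.ideal n).comap (b' ≫ J.toBase) = (J.ideal n).comap (b ≫ J.toBase))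
    (z : Z) (hz : b z ∈ J.awayFromVertex) : b' z ∈ J.awayFromVertex := by
  obtain ⟨U, hU⟩ := exists_mem_affine (J.toBase (b' z))
  obtain ⟨U', hU'⟩ := exists_mem_affine (J.toBase (b z))
  obtain ⟨_, ⟨O, hO, rfl⟩, hzO, hle⟩ := Z.isBasis_affineOpens.exists_subset_of_mem_open
    (show z ∈ ((b' ≫ J.toBase) ⁻¹ᵁ U.1 ⊓ (b ≫ J.toBase) ⁻¹ᵁ U'.1 : Z.Opens) from ⟨hU, hU'⟩)
    ((b' ≫ J.toBase) ⁻¹ᵁ U.1 ⊓ (b ≫ J.toBase) ⁻¹ᵁ U'.1).2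
  let O : Z.Opens := O
  have : IsAffine O.toScheme := hO
  let z' : O.toScheme := ⟨z, hzO⟩
  obtain ⟨ψ, hψ⟩ := exists_eq_ofRingHom (U := U) (O.ι ≫ b') fun x ↦ (hle x.2).1
  obtain ⟨φ, hφ⟩ := exists_eq_ofRingHom (U := U') (O.ι ≫ b) fun x ↦ (hle x.2).2
  have hz1 : ofRingHom φ z' ∈ J.awayFromVertex := by rw [← hφ]; exact hz
  suffices hz2 : ofRingHom ψ z' ∈ J.awayFromVertex by rw [← hψ] at hz2; exact hz2
  obtain ⟨n, f, hf, hz1⟩ := (J.ofRingHom_mem_awayFromVertex φ _).mp hz1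
  refine (J.ofRingHom_mem_awayFromVertex ψ _).mpr ?_
  by_contra! hcon
  have h1 := congrArg (fun K : Z.IdealSheafData ↦
    (K.comap O.ι).ideal ⟨⊤, isAffineOpen_top O.toScheme⟩) (h (n + 1))
  dsimp only at h1
  rw [← Scheme.IdealSheafData.comap_comp, ← Scheme.IdealSheafData.comap_comp,
    ← Category.assoc, ← Category.assoc, hψ, hφ, ofRingHom_toBase, ofRingHom_toBase] at h1
  rw [ideal_comap_toSpec_fromSpec (J.ideal _) ⟨U.1, U.2⟩,
    ideal_comap_toSpec_fromSpec (J.ideal _) ⟨U'.1, U'.2⟩] at h1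
  let P : Ideal Γ(O.toScheme, ⊤) := (IsLocalRing.maximalIdeal
    (O.toScheme.presheaf.stalk z')).comap (O.toScheme.presheaf.germ ⊤ z' trivial).hom
  have hP (x) : x ∈ P ↔ z' ∉ O.toScheme.basicOpen x := by
    rw [Scheme.mem_basicOpen_top]
    rfl
  have h4 : ((J.ideal (n + 1)).ideal ⟨U.1, U.2⟩).map (ψ.comp (J.sections U).const) ≤
      Ideal.span {ψ (J.sections U).exceptional ^ (n + 1)} * P := by
    rw [Ideal.map_le_iff_le_comap]
    intro f' hf'
    rw [Ideal.mem_comap, Ideal.mem_span_singleton_mul, RingHom.comp_apply,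
      ← RingFiltration.map_monomial_mul_pow ψ (n + 1) f' hf']
    exact ⟨_, (hP _).mpr (hcon n f' hf'), mul_comm _ _⟩
  have h2 := h4 (h1.ge (Ideal.mem_map_of_mem (φ.comp (J.sections U').const) hf))
  obtain ⟨x, hx, h3⟩ := Ideal.mem_span_singleton_mul.mp h2
  rw [RingHom.comp_apply, ← RingFiltration.map_monomial_mul_pow φ (n + 1) f hf] at h3
  have hsO : ψ (J.sections U).exceptional =
      O.ι.appTop (c : Γ(Z, ⊤)) * φ (J.sections U').exceptional := by
    rw [← ofRingHom_exceptional, ← ofRingHom_exceptional, ← hψ, ← hφ, appTop_comp_apply, hs,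
      map_mul, ← appTop_comp_apply]
  have hreg : IsRegularSection (φ (J.sections U').exceptional) := by
    rw [← ofRingHom_exceptional, ← hφ, appTop_comp_apply]
    exact hb.comp_flat O.ι
  rw [hsO, mul_pow] at h3
  -- Cancelling the regular factor s^(n+1) shows that f T^(n+1), pulled back along b, would vanish
  -- at z.
  have h5 : O.ι.appTop (c : Γ(Z, ⊤)) ^ (n + 1) * x =
      φ ((J.sections U').monomial (n + 1 : ℕ) f hf) :=
    hreg.mul_cancel (n + 1) (by rw [← h3]; ring)
  refine (hP _).mp ?_ hz1
  rw [← h5]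
  exact P.mul_mem_left _ hx

end IdealFiltration

variable {k : Type u} [Field k] {𝒴 : QuotientStack k} {J : Center 𝒴.atlas}

/-- The morphism to the torus given by a tuple of units. -/
def torusHom {S : Sch k} {r : ℕ} (t : Fin r → Γ(S.left, ⊤)ˣ) : S ⟶ torus k r :=
  (exists_torus_hom r t).choose

lemma pullbackUnits_torusHom {S : Sch k} {r : ℕ} (t : Fin r → Γ(S.left, ⊤)ˣ) :
    pullbackUnits (torusHom t) (torusCoordinates k r) = t :=
  (exists_torus_hom r t).choose_spec

lemma comp_torusHom {S S' : Sch k} (g : S' ⟶ S) {r : ℕ} (t : Fin r → Γ(S.left, ⊤)ˣ) :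
    g ≫ torusHom t = torusHom (pullbackUnits g t) :=
  torus_hom_ext (by
    rw [← pullbackUnits_comp, pullbackUnits_torusHom, pullbackUnits_torusHom])

namespace Center

lemma hom_ext_of_regular {S : Sch k} {b b' : S ⟶ J.cone}
    (hreg : IsRegularSection (b.left.appTop J.exceptional))
    (h : b ≫ J.coneToBase = b' ≫ J.coneToBase)
    (h' : b.left.appTop J.exceptional = b'.left.appTop J.exceptional) : b = b' := by
  ext1
  exact J.hom_ext_of_isRegularSection (congrArg CommaMorphism.left h) h' hreg

lemma comap_smul (hJ : 𝒴.IsInvariantCenter J) {S : Sch k} (t : Fin 𝒴.rank → Γ(S.left, ⊤)ˣ)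
    (u : S ⟶ 𝒴.atlas) (n : ℕ) :
    (J.ideal n).comap (𝒴.action.smul t u).left = (J.ideal n).comap u.left := by
  obtain ⟨a, rfl, rfl⟩ := 𝒴.exists_arrow t u
  rw [← QuotientStack.comp_target, Over.comp_left, Over.comp_left,
    Scheme.IdealSheafData.comap_comp, Scheme.IdealSheafData.comap_comp, hJ n]

/-- The torus coordinates on `𝔾_m^{r+1} × B`. -/
abbrev universalUnits (r : ℕ) (B : Sch k) : Fin r → Γ((torus k r ⨯ B).left, ⊤)ˣ :=
  pullbackUnits (prod.fst : torus k r ⨯ B ⟶ _) (torusCoordinates k r)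

instance flat_prod_snd (r : ℕ) (B : Sch k) :
    Flat (prod.snd : torus k r ⨯ B ⟶ B).left := by
  have h : Smooth (prod.snd : torus k r ⨯ B ⟶ B).left := smooth_prod_snd (smooth_torus r)
  exact flat_of_smooth _

variable (J) in
lemma isRegularSection_snd (r : ℕ) :
    IsRegularSection ((prod.snd : torus k r ⨯ J.cone ⟶ J.cone).left.appTop J.exceptional) :=
  IsRegularSection.comp_flat (Z := J.cone.left) J.isRegularSection_exceptional
    (prod.snd : torus k r ⨯ J.cone ⟶ J.cone).left

/-- The action is built for the universal element of the torus acting on the universal point of B.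
There s is regular by flatness of the projection, so lifts are available; on a general S-point the
pullback of s may be a zero divisor. -/
lemma exists_coneAction (hJ : 𝒴.IsInvariantCenter J) :
    ∃ μ : torus k (𝒴.rank + 1) ⨯ J.cone ⟶ J.cone,
      μ ≫ J.coneToBase = 𝒴.action.smul (Fin.tail (universalUnits (𝒴.rank + 1) J.cone))
        (prod.snd ≫ J.coneToBase) ∧
      μ.left.appTop J.exceptional = ((universalUnits (𝒴.rank + 1) J.cone 0)⁻¹ : Γ((torus k (𝒴.rank + 1) ⨯ J.cone).left, ⊤)ˣ) *
        (prod.snd : torus k (𝒴.rank + 1) ⨯ J.cone ⟶ J.cone).left.appTop J.exceptional := by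
  let y := 𝒴.action.smul (Fin.tail (universalUnits (𝒴.rank + 1) J.cone)) (prod.snd ≫ J.coneToBase)
  obtain ⟨b, hb, hs⟩ := J.exists_lift_of_comap_eq (prod.snd : torus k _ ⨯ J.cone ⟶ J.cone).left
    y.left (universalUnits (𝒴.rank + 1) J.cone 0)⁻¹ (J.isRegularSection_snd _)
    (fun n ↦ comap_smul hJ _ _ n)
  refine ⟨Over.homMk b ?_, ?_, hs⟩
  · refine (Category.assoc _ _ _).symm.trans ((congrArg (· ≫ 𝒴.atlas.hom) hb).trans ?_)
    exact Over.w y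
  · ext1
    exact hb

/-- The action of `𝔾_m × T` on the universal point of `B`. -/
def coneAction (hJ : 𝒴.IsInvariantCenter J) : torus k (𝒴.rank + 1) ⨯ J.cone ⟶ J.cone :=
  (exists_coneAction hJ).choose

/-- The action of `𝔾_m × T` on `B`. -/
def coneSMul (hJ : 𝒴.IsInvariantCenter J) {S : Sch k} (t : Fin (𝒴.rank + 1) → Γ(S.left, ⊤)ˣ)
    (b : S ⟶ J.cone) : S ⟶ J.cone := prod.lift (torusHom t) b ≫ coneAction hJ

variable (hJ : 𝒴.IsInvariantCenter J) {S : Sch k}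

lemma comp_coneSMul {S' : Sch k} (g : S' ⟶ S) (t : Fin (𝒴.rank + 1) → Γ(S.left, ⊤)ˣ)
    (b : S ⟶ J.cone) : g ≫ coneSMul hJ t b = coneSMul hJ (pullbackUnits g t) (g ≫ b) := by
  rw [coneSMul, coneSMul, ← Category.assoc, prod.comp_lift, comp_torusHom]

lemma pullbackUnits_lift {B : Sch k} {r : ℕ} (t : Fin r → Γ(S.left, ⊤)ˣ) (b : S ⟶ B) :
    pullbackUnits (prod.lift (torusHom t) b) (universalUnits r B) = t := by
  rw [pullbackUnits_comp, prod.lift_fst, pullbackUnits_torusHom]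

lemma coneSMul_coneToBase (t : Fin (𝒴.rank + 1) → Γ(S.left, ⊤)ˣ) (b : S ⟶ J.cone) :
    coneSMul hJ t b ≫ J.coneToBase = 𝒴.action.smul (Fin.tail t) (b ≫ J.coneToBase) := by
  rw [coneSMul, Category.assoc, coneAction, (exists_coneAction hJ).choose_spec.1,
    𝒴.action.comp_smul, ← pullbackUnits_tail, pullbackUnits_lift, prod.lift_snd_assoc]

lemma coneSMul_exceptional (t : Fin (𝒴.rank + 1) → Γ(S.left, ⊤)ˣ) (b : S ⟶ J.cone) :
    (coneSMul hJ t b).left.appTop J.exceptional =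
      ((t 0)⁻¹ : Γ(S.left, ⊤)ˣ) * b.left.appTop J.exceptional := by
  have h1 := (exists_coneAction hJ).choose_spec.2
  have h2 := congrArg (prod.lift (torusHom t) b).left.appTop h1
  refine h2.trans ((map_mul _ _ _).trans ?_)
  congr 1
  · have h3 := congrFun (pullbackUnits_lift t b) 0
    have h4 := congrArg (fun x : Γ(S.left, ⊤)ˣ ↦ ((x⁻¹ : Γ(S.left, ⊤)ˣ) : Γ(S.left, ⊤))) h3
    exact h4
  · exact congrArg (fun g : S ⟶ J.cone ↦ g.left.appTop J.exceptional) (prod.lift_snd (torusHom t) b)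

/-- Both sides agree at the identity point of B, where s is regular, and every other point is a
pullback of it. -/
lemma one_coneSMul (b : S ⟶ J.cone) : coneSMul hJ 1 b = b := by
  have h : coneSMul hJ 1 (𝟙 J.cone) = 𝟙 _ := by
    symm
    refine hom_ext_of_regular ?_ ?_ ?_
    · have := Scheme.Hom.id_appTop (X := J.normalCone)
      have h2 : (𝟙 J.cone : J.cone ⟶ J.cone).left.appTop J.exceptional = J.exceptional :=
        congr($this J.exceptional)
      rw [h2]
      exact J.isRegularSection_exceptional
    · rw [coneSMul_coneToBase]
      exact (𝒴.action.one_smul _).symm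
    · rw [coneSMul_exceptional]
      simp
  have h2 := comp_coneSMul hJ b 1 (𝟙 _)
  rw [h, Category.comp_id] at h2
  have h3 : pullbackUnits b (1 : Fin (𝒴.rank + 1) → Γ(J.cone.left, ⊤)ˣ) = 1 :=
    funext fun _ ↦ map_one _
  rw [h3] at h2
  exact h2.symm

lemma mul_coneSMul_of_regular (t t' : Fin (𝒴.rank + 1) → Γ(S.left, ⊤)ˣ) (b : S ⟶ J.cone)
    (hb : IsRegularSection (b.left.appTop J.exceptional)) :
    coneSMul hJ (t * t') b = coneSMul hJ t (coneSMul hJ t' b) := by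
  refine hom_ext_of_regular ?_ ?_ ?_
  · rw [coneSMul_exceptional]
    exact .mul (.of_isUnit (Units.isUnit _)) hb
  · rw [coneSMul_coneToBase, coneSMul_coneToBase, coneSMul_coneToBase, ← 𝒴.action.mul_smul]
    rfl
  · rw [coneSMul_exceptional, coneSMul_exceptional, coneSMul_exceptional, Pi.mul_apply,
      mul_inv_rev, Units.val_mul]
    ring

/-- Associativity holds where s is regular. The general case is pulled back from the universal one
on torus × (torus × B). -/
lemma mul_coneSMul (t t' : Fin (𝒴.rank + 1) → Γ(S.left, ⊤)ˣ) (b : S ⟶ J.cone) :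
    coneSMul hJ (t * t') b = coneSMul hJ t (coneSMul hJ t' b) := by
  let Z := torus k (𝒴.rank + 1) ⨯ J.cone
  let Z' := torus k (𝒴.rank + 1) ⨯ Z
  let q : Z' ⟶ J.cone := prod.snd ≫ prod.snd
  let g : S ⟶ Z' := prod.lift (torusHom t) (prod.lift (torusHom t') b)
  have hq : IsRegularSection (q.left.appTop J.exceptional) :=
    (J.isRegularSection_snd (𝒴.rank + 1)).comp_flat (prod.snd : Z' ⟶ Z).left
  have h1 := congrArg (g ≫ ·) (mul_coneSMul_of_regular hJ (universalUnits _ Z)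
    (pullbackUnits (prod.snd : Z' ⟶ Z) (universalUnits _ J.cone)) q hq)
  have hg : g ≫ q = b := (prod.lift_snd_assoc _ _ _).trans (prod.lift_snd _ _)
  have hg1 : pullbackUnits g (universalUnits _ Z) = t := pullbackUnits_lift _ _
  have hg2 : pullbackUnits g (pullbackUnits (prod.snd : Z' ⟶ Z) (universalUnits _ J.cone)) = t' := by
    rw [pullbackUnits_comp, prod.lift_snd, pullbackUnits_lift]
  rwa [comp_coneSMul, comp_coneSMul, comp_coneSMul, hg, pullbackUnits_mul, hg1, hg2] at h1

/-- The comparison of vertices also needs s regular, so it is made at the universal point and then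
evaluated. -/
lemma coneSMul_mem_awayFromVertex (t : Fin (𝒴.rank + 1) → Γ(S.left, ⊤)ˣ) (b : S ⟶ J.cone)
    (z : S.left) (hz : b.left z ∈ J.awayFromVertex) :
    (coneSMul hJ t b).left z ∈ J.awayFromVertex := by
  let Z := torus k (𝒴.rank + 1) ⨯ J.cone
  let g : S ⟶ Z := prod.lift (torusHom t) b
  have h1 := J.mem_awayFromVertex_of_comap_eq (b := (prod.snd : Z ⟶ J.cone).left)
    (b' := (coneSMul hJ (universalUnits _ J.cone) (prod.snd : Z ⟶ J.cone)).left)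
    (universalUnits _ J.cone 0)⁻¹ (J.isRegularSection_snd _) (coneSMul_exceptional hJ _ _)
    (fun n ↦ by
      have h2 := congrArg CommaMorphism.left
        (coneSMul_coneToBase hJ (universalUnits _ J.cone) (prod.snd : Z ⟶ J.cone))
      exact (congrArg _ h2).trans (comap_smul hJ _ _ n)) (g.left z)
  have h3 : g ≫ (prod.snd : Z ⟶ J.cone) = b := prod.lift_snd _ _
  have h4 : g ≫ coneSMul hJ (universalUnits _ J.cone) (prod.snd : Z ⟶ J.cone) = coneSMul hJ t b := by
    rw [comp_coneSMul, h3, pullbackUnits_lift]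
  rw [← h4]
  refine h1 ?_
  rw [← h3] at hz
  exact hz

lemma exists_puncturedCone_lift (t : Fin (𝒴.rank + 1) → Γ(S.left, ⊤)ˣ) (b : S ⟶ J.puncturedCone) :
    ∃ b' : S ⟶ J.puncturedCone, b' ≫ J.puncturedConeι = coneSMul hJ t (b ≫ J.puncturedConeι) := by
  have hr : Set.range (coneSMul hJ t (b ≫ J.puncturedConeι)).left ⊆
      Set.range J.puncturedConeι.left := by
    rintro _ ⟨z, rfl⟩
    have h1 := coneSMul_mem_awayFromVertex hJ t (b ≫ J.puncturedConeι) z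
      (b.left z : J.awayFromVertex).2
    exact ⟨⟨_, h1⟩, rfl⟩
  refine ⟨Over.homMk (IsOpenImmersion.lift J.puncturedConeι.left _ hr) ?_, ?_⟩
  · rw [← Over.w J.puncturedConeι, ← Category.assoc, IsOpenImmersion.lift_fac, Over.w]
  · ext1
    exact IsOpenImmersion.lift_fac _ _ _

lemma puncturedCone_hom_ext {b b' : S ⟶ J.puncturedCone}
    (h : b ≫ J.puncturedConeι = b' ≫ J.puncturedConeι) : b = b' := by
  ext1
  exact (cancel_mono J.puncturedConeι.left).mp (congrArg CommaMorphism.left h)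

/-- The action of `𝔾_m × T` on `B₊`. -/
def puncturedConeAction : TorusAction (𝒴.rank + 1) J.puncturedCone where
  smul t b := (exists_puncturedCone_lift hJ t b).choose
  one_smul b := puncturedCone_hom_ext (by
    rw [(exists_puncturedCone_lift hJ _ b).choose_spec, one_coneSMul])
  mul_smul t t' b := puncturedCone_hom_ext (by
    rw [(exists_puncturedCone_lift hJ _ _).choose_spec, (exists_puncturedCone_lift hJ _ _).choose_spec,
      (exists_puncturedCone_lift hJ _ _).choose_spec, mul_coneSMul])
  comp_smul g t b := puncturedCone_hom_ext (by
    rw [(exists_puncturedCone_lift hJ _ _).choose_spec, Category.assoc,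
      (exists_puncturedCone_lift hJ _ _).choose_spec, comp_coneSMul, Category.assoc])

lemma smul_puncturedConeι (t : Fin (𝒴.rank + 1) → Γ(S.left, ⊤)ˣ) (b : S ⟶ J.puncturedCone) :
    (puncturedConeAction hJ).smul t b ≫ J.puncturedConeι = coneSMul hJ t (b ≫ J.puncturedConeι) :=
  (exists_puncturedCone_lift hJ t b).choose_spec

/-- The weighted blowup along an invariant center. -/
def weightedBlowup : 𝒴.WeightedBlowup J where
  action := puncturedConeAction hJ
  equivariant t b := by
    rw [← Category.assoc, smul_puncturedConeι, coneSMul_coneToBase, Category.assoc]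
  weight t b := by
    rw [smul_puncturedConeι, coneSMul_exceptional]

end Center

end

/-! ### The grading action in charts -/

section

namespace RingFiltration

variable {A S : Type u} [CommRing A] [CommRing S] {I : RingFiltration A}

/-- The translate of a point of the extended Rees algebra by a unit, acting by the grading. -/
def twist (φ : I.extendedRees →+* S) (c : Sˣ) : I.extendedRees →+* S :=
  (LaurentPolynomial.eval₂ φ c).comp I.coaction

lemma twist_const (φ : I.extendedRees →+* S) (c : Sˣ) (a : A) :
    twist φ c (I.const a) = φ (I.const a) := by
  rw [twist, RingHom.comp_apply, coaction_const, eval₂_C]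

lemma twist_monomial (φ : I.extendedRees →+* S) (c : Sˣ) (n : ℤ) (f : A) (hf) :
    twist φ c (I.monomial n f hf) = φ (I.monomial n f hf) * (c ^ n : Sˣ) := by
  rw [twist, RingHom.comp_apply, coaction_monomial, eval₂_C_mul_T]

end RingFiltration

variable {k : Type u} [Field k] {𝒴 : QuotientStack k} {J : Center 𝒴.atlas}

lemma isUnit_of_basicOpen_eq_top {Z : Scheme.{u}} {c : Γ(Z, ⊤)} (h : Z.basicOpen c = ⊤) :
    IsUnit c := by
  refine RingedSpace.isUnit_of_isUnit_germ Z.toLocallyRingedSpace.toRingedSpace ⊤ c fun x hx ↦ ?_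
  have h1 : x ∈ Z.basicOpen c := by rw [h]; trivial
  exact (Z.mem_basicOpen_top c x).mp h1

namespace Center

variable (hJ : 𝒴.IsInvariantCenter J) {S : Sch k}

/-- The action was obtained abstractly from its effect on σ and s, and this gives the formula f T^n
↦ t₀^n f T^n for the 𝔾_m factor. At the universal point Spec R[T, T⁻¹] of the chart, the coaction
has the same σ and the same s, and s is regular there. -/
lemma coneSMul_ofRingHom (t : Fin (𝒴.rank + 1) → Γ(S.left, ⊤)ˣ) (ht : Fin.tail t = 1)
    {U : 𝒴.atlas.left.AffineZariskiSite} (b : S ⟶ J.cone)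
    (φ : (J.sections U).extendedRees →+* Γ(S.left, ⊤)) (hφ : b.left = IdealFiltration.ofRingHom φ) :
    (coneSMul hJ t b).left = IdealFiltration.ofRingHom (RingFiltration.twist φ (t 0)) := by
  let R := LaurentPolynomial (J.sections U).extendedRees
  let a : Spec (CommRingCat.of R) ⟶ J.normalCone :=
    Spec.map (CommRingCat.ofHom (C : _ →+* R)) ≫ J.chart U
  let a' : Spec (CommRingCat.of R) ⟶ J.normalCone :=
    Spec.map (CommRingCat.ofHom (J.sections U).coaction) ≫ J.chart U
  let Z : Sch k := Over.mk (a ≫ J.toBase ≫ 𝒴.atlas.hom)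
  let b₀ : Z ⟶ J.cone := Over.homMk a
  let c : Γ(Z.left, ⊤)ˣ := Units.map (Scheme.ΓSpecIso (CommRingCat.of R)).inv.hom.toMonoidHom
    ⟨T 1, T (-1), by rw [← T_add]; simp, by rw [← T_add]; simp⟩
  let g : S.left ⟶ Spec (CommRingCat.of R) := toSpec (LaurentPolynomial.eval₂ φ (t 0))
  have hga : g ≫ a = b.left := by
    rw [hφ, ← Category.assoc, toSpec_comp_map, IdealFiltration.ofRingHom]
    congr 2
    ext x
    exact eval₂_C _ _ _
  let G : S ⟶ Z := Over.homMk g (by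
    change g ≫ a ≫ J.toBase ≫ 𝒴.atlas.hom = _
    rw [← Category.assoc, hga]
    exact Over.w b)
  have hG : G ≫ b₀ = b := by ext1; exact hga
  let t₀ : Fin (𝒴.rank + 1) → Γ(Z.left, ⊤)ˣ := Fin.cons c 1
  have ht₀ : pullbackUnits G t₀ = t := by
    have h1 : Fin.tail (pullbackUnits G t₀) = Fin.tail t := by
      rw [pullbackUnits_tail, Fin.tail_cons, ht]
      exact funext fun _ ↦ map_one _
    have h2 : pullbackUnits G t₀ 0 = t 0 := by
      ext
      refine (toSpec_appTop (LaurentPolynomial.eval₂ φ (t 0)) (T 1)).trans ?_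
      rw [eval₂_T, zpow_one]
    rw [← Fin.cons_self_tail (pullbackUnits G t₀), h1, h2, Fin.cons_self_tail]
  have key : (coneSMul hJ t₀ b₀).left = a' := by
    have hσ := congrArg CommaMorphism.left (coneSMul_coneToBase hJ t₀ b₀)
    have hone : Fin.tail t₀ = 1 := Fin.tail_cons _ _
    rw [hone, 𝒴.action.one_smul] at hσ
    have hex : b₀.left.appTop J.exceptional =
        (Scheme.ΓSpecIso (CommRingCat.of R)).inv (C (J.sections U).exceptional) := by
      refine (congrArg (Spec.map _).appTop (J.chart_exceptional U)).trans ?_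
      exact congr($(Scheme.ΓSpecIso_inv_naturality (CommRingCat.ofHom (C : _ →+* R)))
        (J.sections U).exceptional).symm
    have hex' : a'.appTop J.exceptional = (Scheme.ΓSpecIso (CommRingCat.of R)).inv
        ((J.sections U).coaction (J.sections U).exceptional) := by
      refine (congrArg (Spec.map _).appTop (J.chart_exceptional U)).trans ?_
      exact congr($(Scheme.ΓSpecIso_inv_naturality (CommRingCat.ofHom (J.sections U).coaction))
        (J.sections U).exceptional).symm
    have hs : (coneSMul hJ t₀ b₀).left.appTop J.exceptional = a'.appTop J.exceptional := by
      rw [hex', RingFiltration.coaction_exceptional, map_mul, ← hex, mul_comm]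
      exact coneSMul_exceptional hJ t₀ b₀
    refine (J.hom_ext_of_isRegularSection (b := a') (hσ.trans
      (J.chart_comp_toBase_hom_eq fun a ↦ ((J.sections U).coaction_const a).symm)).symm
      hs.symm ?_).symm
    rw [hex', RingFiltration.coaction_exceptional]
    exact .spec fun x ↦ RingFiltration.T_regular (fun x ↦ (J.sections U).exceptional_regular) _ x
  rw [← hG, ← ht₀, ← comp_coneSMul, Over.comp_left, key]
  change g ≫ a' = _
  rw [← Category.assoc, toSpec_comp_map, ht₀]
  rfl

/-- Locally, a point of `B₊` lies in a chart, with some `f Tⁿ` invertible. -/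
lemma exists_local_chart (b : S ⟶ J.puncturedCone) (z : S.left) :
    ∃ (U : 𝒴.atlas.left.AffineZariskiSite) (O : S.left.Opens) (n : ℕ) (f : _)
      (hf : f ∈ (J.sections U).ideal (n + 1))
      (φ : (J.sections U).extendedRees →+* Γ(O.toScheme, ⊤)), z ∈ O ∧
      O.ι ≫ (b ≫ J.puncturedConeι).left = IdealFiltration.ofRingHom φ ∧
      IsUnit (φ ((J.sections U).monomial (n + 1 : ℕ) f hf)) := by
  obtain ⟨U, hU⟩ := IdealFiltration.exists_mem_affine
    (J.toBase ((b ≫ J.puncturedConeι).left z))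
  let O₁ : S.left.Opens := ((b ≫ J.puncturedConeι).left ≫ J.toBase) ⁻¹ᵁ U.1
  obtain ⟨φ₁, hφ₁⟩ := IdealFiltration.exists_eq_ofRingHom (U := U)
    (O₁.ι ≫ (b ≫ J.puncturedConeι).left) fun x ↦ x.2
  have h1 : IdealFiltration.ofRingHom φ₁ ⟨z, hU⟩ ∈ J.awayFromVertex := by
    rw [← hφ₁]
    exact (b.left z : J.awayFromVertex).2
  obtain ⟨n, f, hf, h2⟩ := (J.ofRingHom_mem_awayFromVertex φ₁ _).mp h1
  let m := φ₁ ((J.sections U).monomial (n + 1 : ℕ) f hf)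
  -- Shrinking to the locus where f T^(n+1) is nonzero makes it a unit.
  let O : S.left.Opens := O₁.ι ''ᵁ (O₁.toScheme.basicOpen m)
  have hO : O ≤ O₁ := by
    rintro _ ⟨x, -, rfl⟩
    exact x.2
  let j : O.toScheme ⟶ O₁.toScheme := S.left.homOfLE hO
  refine ⟨U, O, n, f, hf, j.appTop.hom.comp φ₁, ⟨⟨z, hU⟩, h2, rfl⟩, ?_, ?_⟩
  · exact (congrArg (· ≫ (b ≫ J.puncturedConeι).left) (S.left.homOfLE_ι hO).symm).trans
      ((Category.assoc _ _ _).trans ((congrArg (j ≫ ·) hφ₁).trans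
        (IdealFiltration.comp_ofRingHom j φ₁)))
  · change IsUnit (j.appTop m)
    refine isUnit_of_basicOpen_eq_top ?_
    rw [eq_top_iff, ← Scheme.preimage_basicOpen_top]
    rintro ⟨_, x, hx, rfl⟩ -
    have h3 : j ⟨O₁.ι x, ⟨x, hx, rfl⟩⟩ = x := Subtype.ext (by
      change (j ≫ O₁.ι) _ = _
      rw [S.left.homOfLE_ι hO]; rfl)
    change j ⟨O₁.ι x, ⟨x, hx, rfl⟩⟩ ∈ O₁.toScheme.basicOpen m
    rw [h3]
    exact hx

end Center

end

/-! ### The diagonal of the blowup is unramified -/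

section

lemma isNilpotent_ker_specMap {R S : CommRingCat.{u}} (φ : R ⟶ S)
    (h : RingHom.ker φ.hom ^ 2 = ⊥) : IsNilpotent (Spec.map φ).ker := by
  refine ⟨2, Scheme.IdealSheafData.ext_of_isAffine ?_⟩
  change ((Spec.map φ).ker.ideal ^ 2) ⟨⊤, isAffineOpen_top _⟩ = ⊥
  rw [Pi.pow_apply, pow_two]
  have hmem (x) (hx : x ∈ (Spec.map φ).ker.ideal ⟨⊤, isAffineOpen_top _⟩) :
      (Scheme.ΓSpecIso R).hom x ∈ RingHom.ker φ.hom := by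
    have h1 : (Spec.map φ).appTop x = 0 := (Spec.map φ).ideal_ker_le _ hx
    have h2 := congr($(Scheme.ΓSpecIso_naturality φ) x)
    rw [RingHom.mem_ker]
    refine h2.symm.trans ?_
    rw [CommRingCat.comp_apply, h1, map_zero]
  refine le_bot_iff.mp (Ideal.mul_le.mpr fun x hx y hy ↦ ?_)
  have h1 : (Scheme.ΓSpecIso R).hom (x * y) = 0 := by
    rw [map_mul, ← Ideal.mem_bot, ← h, pow_two]
    exact Ideal.mul_mem_mul (hmem x hx) (hmem y hy)
  exact (map_eq_zero_iff _ (ConcreteCategory.bijective_of_isIso (Scheme.ΓSpecIso R).hom).1).mp h1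

variable {k : Type u} [Field k] {𝒴 : QuotientStack k} {J : Center 𝒴.atlas}

namespace QuotientStack

lemma comp_lift_eq_iff {A : Sch k} {G₁ G₂ : A ⟶ 𝒴.arrows} :
    G₁ ≫ prod.lift 𝒴.source 𝒴.target = G₂ ≫ prod.lift 𝒴.source 𝒴.target ↔
      G₁ ≫ 𝒴.source = G₂ ≫ 𝒴.source ∧ G₁ ≫ 𝒴.target = G₂ ≫ 𝒴.target := by
  refine ⟨fun h ↦ ⟨?_, ?_⟩, fun h ↦ ?_⟩
  · rw [prod.comp_lift, prod.comp_lift] at h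
    exact (prod.lift_fst _ _).symm.trans ((congrArg (· ≫ prod.fst) h).trans (prod.lift_fst _ _))
  · rw [prod.comp_lift, prod.comp_lift] at h
    exact (prod.lift_snd _ _).symm.trans ((congrArg (· ≫ prod.snd) h).trans (prod.lift_snd _ _))
  · rw [prod.comp_lift, prod.comp_lift, h.1, h.2]

/-- The pairs (t, u) and (t', u) are arrows with the same source and target which agree on an
infinitesimally near subscheme, so unramifiedness of the diagonal makes them equal. -/
lemma tail_units_eq (h : FormallyUnramified (prod.lift 𝒴.source 𝒴.target).left) {A A₀ : Sch k}
    (i : A₀ ⟶ A) [IsClosedImmersion i.left] (hi : IsNilpotent i.left.ker)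
    {t t' : Fin 𝒴.rank → Γ(A.left, ⊤)ˣ} (htt' : pullbackUnits i t = pullbackUnits i t')
    (u : A ⟶ 𝒴.atlas) (hu : 𝒴.action.smul t u = 𝒴.action.smul t' u) : t = t' := by
  obtain ⟨a, ha, hau⟩ := 𝒴.exists_arrow t u
  obtain ⟨a', ha', hau'⟩ := 𝒴.exists_arrow t' u
  have h1 : i ≫ a = i ≫ a' := by
    refine arrow_ext ?_ ?_
    · rw [← pullbackUnits_comp, ← pullbackUnits_comp, ha, ha', htt']
    · rw [Category.assoc, Category.assoc, hau, hau']
  have h2 : a ≫ prod.lift 𝒴.source 𝒴.target = a' ≫ prod.lift 𝒴.source 𝒴.target := by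
    rw [prod.comp_lift, prod.comp_lift, comp_target, comp_target, ha, ha', hau, hau', hu]
  have h3 : a = a' := by
    ext1
    exact FormallyUnramified.hom_ext i.left hi (prod.lift 𝒴.source 𝒴.target).left
      (congrArg CommaMorphism.left h1) (congrArg CommaMorphism.left h2)
  rw [← ha, ← ha', h3]

end QuotientStack

/-- With ε = x - 1 and ε² = 0, the power x^(n+1) is 1 + (n + 1)ε. Characteristic 0 enters the proof
through the invertibility of n + 1. -/
lemma eq_one_of_pow_eq_one {R : Type*} [CommRing R] (n : ℕ) (hn : IsUnit ((n + 1 : ℕ) : R)) {x : R}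
    (hx : (x - 1) * (x - 1) = 0) (h : x ^ (n + 1) = 1) : x = 1 := by
  have h1 : ∀ m : ℕ, x ^ m = 1 + m * (x - 1) := fun m ↦ by
    induction m with
    | zero => simp
    | succ m ih =>
      rw [pow_succ, ih]
      push_cast
      linear_combination (m : R) * hx
  have h2 : ((n + 1 : ℕ) : R) * (x - 1) = 0 := by
    have := h1 (n + 1)
    rw [h] at this
    linear_combination -this
  exact sub_eq_zero.mp ((hn.mul_right_eq_zero).mp h2)

namespace Center

variable (hJ : 𝒴.IsInvariantCenter J)

/-- Elements of `𝔾_m` which are infinitesimally close to `1` act freely on `B₊`. -/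
lemma eq_one_of_coneSMul_eq [CharZero k] {A : Sch k} (t : Fin (𝒴.rank + 1) → Γ(A.left, ⊤)ˣ)
    (ht : Fin.tail t = 1) (ht0 : ((t 0 : Γ(A.left, ⊤)) - 1) * ((t 0 : Γ(A.left, ⊤)) - 1) = 0)
    (b : A ⟶ J.puncturedCone)
    (hb : coneSMul hJ t (b ≫ J.puncturedConeι) = b ≫ J.puncturedConeι) : t 0 = 1 := by
  ext
  refine section_ext_of_forall fun z ↦ ?_
  obtain ⟨U, O, n, f, hf, φ, hz, hφ, hu⟩ := exists_local_chart b z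
  refine ⟨O, hz, ?_⟩
  let A' : Sch k := Over.mk (O.ι ≫ A.hom)
  let j : A' ⟶ A := Over.homMk O.ι
  have h1 := coneSMul_ofRingHom hJ (pullbackUnits j t)
    (by rw [pullbackUnits_tail, ht]; exact funext fun _ ↦ map_one _)
    (j ≫ b ≫ J.puncturedConeι) φ hφ
  have h2 := congrArg CommaMorphism.left (comp_coneSMul hJ j t (b ≫ J.puncturedConeι))
  rw [hb] at h2
  have h3 : IdealFiltration.ofRingHom φ = IdealFiltration.ofRingHom
      (RingFiltration.twist φ (pullbackUnits j t 0)) := hφ.symm.trans (h2.trans h1)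
  have h4 := congr($(IdealFiltration.ofRingHom_injective h3)
    ((J.sections U).monomial (n + 1 : ℕ) f hf))
  rw [RingFiltration.twist_monomial] at h4
  -- The invertible element f T^(n+1) is fixed and also multiplied by t₀^(n+1), which is therefore
  -- 1. The exponent is n + 1, never 0.
  have h5 := hu.mul_left_cancel ((mul_one _).trans h4)
  refine Eq.trans ?_ (map_one O.ι.appTop.hom).symm
  refine eq_one_of_pow_eq_one n ?_ ?_ ?_
  · rw [← map_natCast (scalars A' ⊤)]
    exact (Ne.isUnit (Nat.cast_ne_zero.mpr n.succ_ne_zero)).map _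
  · have := congrArg O.ι.appTop ht0
    rwa [map_mul, map_sub, map_one, map_zero] at this
  · rw [zpow_natCast, Units.val_pow_eq_pow_val] at h5
    exact h5.symm

/-- Let two infinitesimally close arrows have the same ends. Their components in the old torus agree
because the diagonal of 𝒴 is unramified. Their quotient is then an element of 𝔾_m, infinitesimally
close to 1, fixing a point of B₊, so it is 1. -/
theorem formallyUnramified_weightedBlowup [CharZero k]
    (h : FormallyUnramified (prod.lift 𝒴.source 𝒴.target).left) :
    FormallyUnramified (prod.lift (weightedBlowup hJ).stack.source
      (weightedBlowup hJ).stack.target).left := by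
  let 𝒲 := (weightedBlowup hJ).stack
  -- It suffices to treat an affine test scheme with a closed subscheme defined by an ideal of
  -- square zero.
  refine FormallyUnramified.of_hom_ext _ fun R S φ hφ hker g₁ g₂ hg hgf ↦ ?_
  let A : Sch k := Over.mk (g₁ ≫ 𝒲.arrows.hom)
  let A₀ : Sch k := Over.mk (Spec.map φ ≫ A.hom)
  let i : A₀ ⟶ A := Over.homMk (Spec.map φ)
  let G₁ : A ⟶ 𝒲.arrows := Over.homMk g₁
  let G₂ : A ⟶ 𝒲.arrows := Over.homMk g₂ (by
    change g₂ ≫ 𝒲.arrows.hom = g₁ ≫ 𝒲.arrows.hom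
    rw [← Over.w (prod.lift 𝒲.source 𝒲.target)]
    exact congrArg (· ≫ (𝒲.atlas ⨯ 𝒲.atlas).hom) hgf.symm)
  have hi : IsClosedImmersion i.left := IsClosedImmersion.spec_of_surjective φ hφ
  have hnil : IsNilpotent i.left.ker := isNilpotent_ker_specMap φ hker
  have hG : i ≫ G₁ = i ≫ G₂ := by ext1; exact hg
  have hGf : G₁ ≫ prod.lift 𝒲.source 𝒲.target = G₂ ≫ prod.lift 𝒲.source 𝒲.target := by
    apply Over.OverMorphism.ext; exact hgf
  obtain ⟨hsrc, htgt⟩ := QuotientStack.comp_lift_eq_iff.mp hGf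
  let t : Fin (𝒴.rank + 1) → Γ(A.left, ⊤)ˣ := pullbackUnits G₁ 𝒲.arrowUnits
  let t' : Fin (𝒴.rank + 1) → Γ(A.left, ⊤)ˣ := pullbackUnits G₂ 𝒲.arrowUnits
  let b : A ⟶ J.puncturedCone := G₁ ≫ 𝒲.source
  have htt' : pullbackUnits i t = pullbackUnits i t' := by
    exact congrArg (fun g ↦ pullbackUnits g 𝒲.arrowUnits) hG
  rw [𝒲.comp_target, 𝒲.comp_target, ← hsrc] at htgt
  have hbt : (weightedBlowup hJ).action.smul t b = (weightedBlowup hJ).action.smul t' b := htgt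
  have htail : Fin.tail t = Fin.tail t' := by
    refine QuotientStack.tail_units_eq h i hnil ?_ (b ≫ QuotientStack.WeightedBlowup.toAtlas J) ?_
    · exact congrArg Fin.tail htt'
    · have h1 := congrArg (· ≫ QuotientStack.WeightedBlowup.toAtlas J) hbt
      exact ((weightedBlowup hJ).smul_toAtlas t b).symm.trans
        (h1.trans ((weightedBlowup hJ).smul_toAtlas t' b))
  have hfix : coneSMul hJ (t'⁻¹ * t) (b ≫ J.puncturedConeι) = b ≫ J.puncturedConeι := by
    rw [mul_coneSMul, ← smul_puncturedConeι, show (puncturedConeAction hJ).smul t b =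
      (puncturedConeAction hJ).smul t' b from hbt, smul_puncturedConeι, ← mul_coneSMul,
      inv_mul_cancel, one_coneSMul]
  have h0 : (t'⁻¹ * t) 0 = 1 := by
    refine eq_one_of_coneSMul_eq hJ _ ?_ ?_ b hfix
    · have : Fin.tail (t'⁻¹ * t) = (Fin.tail t')⁻¹ * Fin.tail t := rfl
      rw [this, htail, inv_mul_cancel]
    · let x : Γ(A.left, ⊤) := ((t'⁻¹ * t) 0 : Γ(A.left, ⊤)) - 1
      have hmem : (Scheme.ΓSpecIso R).hom x ∈ RingHom.ker φ.hom := by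
        have h1 : i.left.appTop x = 0 := by
          have h2 : pullbackUnits i (t'⁻¹ * t) = 1 := by
            rw [pullbackUnits_mul, pullbackUnits_inv, htt', inv_mul_cancel]
          have h3 : i.left.appTop ((t'⁻¹ * t) 0 : Γ(A.left, ⊤)) = 1 :=
            congrArg Units.val (congrFun h2 0)
          rw [map_sub, h3, map_one, sub_self]
        have h2 := congr($(Scheme.ΓSpecIso_naturality φ) x)
        rw [RingHom.mem_ker]
        refine h2.symm.trans ?_
        refine (congrArg (Scheme.ΓSpecIso S).hom h1).trans (map_zero _)
      refine (map_eq_zero_iff _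
        (ConcreteCategory.bijective_of_isIso (Scheme.ΓSpecIso R).hom).1).mp ?_
      refine (map_mul (Scheme.ΓSpecIso R).hom.hom x x).trans ?_
      rw [← Ideal.mem_bot, ← hker, pow_two]
      exact Ideal.mul_mem_mul hmem hmem
  have hteq : t = t' := by
    rw [Pi.mul_apply, Pi.inv_apply, inv_mul_eq_one] at h0
    rw [← Fin.cons_self_tail t, ← Fin.cons_self_tail t', htail, h0]
  exact congrArg CommaMorphism.left (QuotientStack.arrow_ext hteq hsrc)

end Center

end

/-! ### Elements of 𝔾_m over valuation rings -/

section

variable {k : Type u} [Field k] {𝒴 : QuotientStack k} {J : Center 𝒴.atlas}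

/-- Valuation rings are integrally closed, so an element of K with a positive power in R lies in R.
-/
lemma exists_appTop_eq_of_pow_eq {R K : Type u} [CommRing R] [IsDomain R] [ValuationRing R] [Field K]
    [Algebra R K] [IsFractionRing R K] (n : ℕ) (c : Γ(Spec (CommRingCat.of K), ⊤))
    (x : Γ(Spec (CommRingCat.of R), ⊤))
    (h : c ^ (n + 1) = (Spec.map (CommRingCat.ofHom (algebraMap R K))).appTop x) :
    ∃ y, (Spec.map (CommRingCat.ofHom (algebraMap R K))).appTop y = c := by
  let a : R := (Scheme.ΓSpecIso (CommRingCat.of R)).hom x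
  let c' : K := (Scheme.ΓSpecIso (CommRingCat.of K)).hom c
  have h1 : c' ^ (n + 1) = algebraMap R K a := by
    have h2 := congr($(Scheme.ΓSpecIso_naturality (CommRingCat.ofHom (algebraMap R K))) x)
    refine Eq.trans ?_ h2
    rw [CommRingCat.comp_apply, ← h, map_pow]
  obtain ⟨y, hy⟩ := IsIntegrallyClosedIn.exists_algebraMap_eq_of_isIntegral_pow (R := R) (A := K)
    n.succ_pos (x := c') (h1 ▸ isIntegral_algebraMap)
  refine ⟨(Scheme.ΓSpecIso (CommRingCat.of R)).inv y, ?_⟩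
  have h2 := congr($(Scheme.ΓSpecIso_inv_naturality (CommRingCat.ofHom (algebraMap R K))) y)
  refine h2.symm.trans ?_
  refine (congrArg (Scheme.ΓSpecIso (CommRingCat.of K)).inv hy).trans ?_
  exact congr($((Scheme.ΓSpecIso (CommRingCat.of K)).hom_inv_id) c)

lemma appTop_specMap_injective {R K : Type u} [CommRing R] [Field K]
    [Algebra R K] [IsDomain R] [IsFractionRing R K] :
    Function.Injective (Spec.map (CommRingCat.ofHom (algebraMap R K))).appTop := by
  intro x y h
  have hx := congr($(Scheme.ΓSpecIso_naturality (CommRingCat.ofHom (algebraMap R K))) x)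
  have hy := congr($(Scheme.ΓSpecIso_naturality (CommRingCat.ofHom (algebraMap R K))) y)
  have h1 : algebraMap R K ((Scheme.ΓSpecIso (CommRingCat.of R)).hom x) =
      algebraMap R K ((Scheme.ΓSpecIso (CommRingCat.of R)).hom y) :=
    hx.symm.trans ((congrArg (Scheme.ΓSpecIso (CommRingCat.of K)).hom h).trans hy)
  exact (ConcreteCategory.bijective_of_isIso (Scheme.ΓSpecIso (CommRingCat.of R)).hom).1
    (IsFractionRing.injective R K h1)

lemma pullbackUnits_cons {S S' : Sch k} (g : S' ⟶ S) {r : ℕ} (c : Γ(S.left, ⊤)ˣ)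
    (t : Fin r → Γ(S.left, ⊤)ˣ) : pullbackUnits g (Fin.cons c t : Fin (r + 1) → Γ(S.left, ⊤)ˣ) =
      Fin.cons (Units.map g.left.appTop.hom.toMonoidHom c) (pullbackUnits g t) := by
  ext i
  refine Fin.cases ?_ (fun i ↦ ?_) i <;> rfl

namespace Center

section Valuative

open QuotientStack.WeightedBlowup (toAtlas)

variable (hJ : 𝒴.IsInvariantCenter J) {R K : Type u} [CommRing R] [IsDomain R] [ValuationRing R]
  [Field K] [Algebra R K] [IsFractionRing R K] (a : Spec (CommRingCat.of R) ⟶ Spec (CommRingCat.of k))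

/-- The generic point of the spectrum of a valuation ring over `k`. -/
abbrev genericPoint (K : Type u) [Field K] [Algebra R K] :
    Over.mk (Spec.map (CommRingCat.ofHom (algebraMap R K)) ≫ a) ⟶ Over.mk a :=
  Over.homMk (Spec.map (CommRingCat.ofHom (algebraMap R K)))

/-- Some f T^(n+1) is nonzero at the image of the closed point under b, hence a unit on Spec R. Over
K its values at b' and b differ by the factor c^(n+1), which is therefore in R; then so is c. -/
lemma exists_appTop_eq (b b' : Over.mk a ⟶ J.puncturedCone) (h : b ≫ toAtlas J = b' ≫ toAtlas J)
    (c : Γ((Over.mk (Spec.map (CommRingCat.ofHom (algebraMap R K)) ≫ a) : Sch k).left, ⊤)ˣ)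
    (hc : genericPoint a K ≫ b' ≫ J.puncturedConeι =
      coneSMul hJ (Fin.cons c 1) (genericPoint a K ≫ b ≫ J.puncturedConeι)) :
    ∃ y, (genericPoint a K).left.appTop y = c := by
  let p : Spec (CommRingCat.of R) := IsLocalRing.closedPoint R
  have hp (z : Spec (CommRingCat.of R)) : z ⤳ p := IsLocalRing.specializes_closedPoint z
  obtain ⟨U, hU⟩ := IdealFiltration.exists_mem_affine (J.toBase ((b ≫ J.puncturedConeι).left p))
  have hbU (z) : J.toBase ((b ≫ J.puncturedConeι).left z) ∈ U.1 :=
    ((hp z).map ((b ≫ J.puncturedConeι).left ≫ J.toBase).continuous).mem_open U.1.2 hU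
  have hbase : (b ≫ J.puncturedConeι).left ≫ J.toBase = (b' ≫ J.puncturedConeι).left ≫ J.toBase :=
    congrArg CommaMorphism.left h
  have hbU' (z) : J.toBase ((b' ≫ J.puncturedConeι).left z) ∈ U.1 := by
    have := congrArg (fun g : Spec (CommRingCat.of R) ⟶ 𝒴.atlas.left ↦ g z) hbase
    exact this ▸ hbU z
  obtain ⟨φ, hφ⟩ := IdealFiltration.exists_eq_ofRingHom (Z := Spec (CommRingCat.of R)) (U := U) (b ≫ J.puncturedConeι).left hbU
  obtain ⟨φ', hφ'⟩ := IdealFiltration.exists_eq_ofRingHom (Z := Spec (CommRingCat.of R)) (U := U) (b' ≫ J.puncturedConeι).left hbU'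
  have h1 : IdealFiltration.ofRingHom φ p ∈ J.awayFromVertex := by
    rw [← hφ]
    exact (b.left p : J.awayFromVertex).2
  obtain ⟨n, f, hf, h2⟩ := (J.ofRingHom_mem_awayFromVertex φ _).mp h1
  have hu : IsUnit (φ ((J.sections U).monomial (n + 1 : ℕ) f hf)) := by
    refine isUnit_of_basicOpen_eq_top (eq_top_iff.mpr fun z _ ↦ ?_)
    exact (hp z).mem_open (Scheme.basicOpen _ _).2 h2
  let i := Spec.map (CommRingCat.ofHom (algebraMap R K))
  have h3 := coneSMul_ofRingHom hJ (Fin.cons c 1) (Fin.tail_cons _ _)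
    (genericPoint a K ≫ b ≫ J.puncturedConeι) (i.appTop.hom.comp φ)
    ((congrArg (i ≫ ·) hφ).trans (IdealFiltration.comp_ofRingHom i φ))
  have h4 : IdealFiltration.ofRingHom (i.appTop.hom.comp φ') =
      IdealFiltration.ofRingHom (RingFiltration.twist (i.appTop.hom.comp φ) c) :=
    (IdealFiltration.comp_ofRingHom i φ').symm.trans ((congrArg (i ≫ ·) hφ').symm.trans
      ((congrArg CommaMorphism.left hc).trans h3))
  have h5 := congr($(IdealFiltration.ofRingHom_injective h4)
    ((J.sections U).monomial (n + 1 : ℕ) f hf))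
  rw [RingFiltration.twist_monomial, zpow_natCast, Units.val_pow_eq_pow_val] at h5
  obtain ⟨u, hu⟩ := hu
  refine exists_appTop_eq_of_pow_eq n _
    (φ' ((J.sections U).monomial (n + 1 : ℕ) f hf) * (u⁻¹ : Γ(Spec (CommRingCat.of R), ⊤)ˣ)) ?_
  let cK : Γ(Spec (CommRingCat.of K), ⊤) := c.1
  have h6 : i.appTop (u : Γ(Spec (CommRingCat.of R), ⊤)) *
      i.appTop ((u⁻¹ : Γ(Spec (CommRingCat.of R), ⊤)ˣ) : Γ(Spec (CommRingCat.of R), ⊤)) = 1 := by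
    rw [← map_mul, Units.mul_inv, map_one]
  rw [map_mul]
  have h7 : i.appTop (φ' ((J.sections U).monomial (n + 1 : ℕ) f hf)) =
    i.appTop (u : Γ(Spec (CommRingCat.of R), ⊤)) *
      cK ^ (n + 1) := by rw [hu]; exact h5
  rw [h7]
  change cK ^ (n + 1) = _
  linear_combination (-cK ^ (n + 1)) * h6

/-- Exchanging b and b' shows that c⁻¹ is integral as well. -/
lemma exists_units_map_eq (b b' : Over.mk a ⟶ J.puncturedCone) (h : b ≫ toAtlas J = b' ≫ toAtlas J)
    (c : Γ((Over.mk (Spec.map (CommRingCat.ofHom (algebraMap R K)) ≫ a) : Sch k).left, ⊤)ˣ)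
    (hc : genericPoint a K ≫ b' ≫ J.puncturedConeι =
      coneSMul hJ (Fin.cons c 1) (genericPoint a K ≫ b ≫ J.puncturedConeι)) :
    ∃ y, Units.map (genericPoint a K).left.appTop.hom.toMonoidHom y = c := by
  obtain ⟨x, hx⟩ := exists_appTop_eq hJ a b b' h c hc
  obtain ⟨y, hy⟩ := exists_appTop_eq hJ a b' b h.symm c⁻¹ (by
    rw [hc, ← mul_coneSMul]
    refine (one_coneSMul hJ _).symm.trans (congrArg (fun t ↦ coneSMul hJ t _) ?_)
    refine funext fun i ↦ Fin.cases ?_ (fun i ↦ ?_) i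
    · exact (inv_mul_cancel c).symm
    · exact (mul_one _).symm)
  have hxy : x * y = 1 := by
    refine appTop_specMap_injective (R := R) (K := K) ?_
    refine (map_mul _ _ _).trans (Eq.trans ?_ (map_one (Spec.map _).appTop.hom).symm)
    exact (congr($hx * $hy)).trans (Units.mul_inv c)
  exact ⟨⟨x, y, hxy, by rw [mul_comm, hxy]⟩, Units.ext hx⟩

end Valuative

end Center

end

/-! ### The diagonal of the blowup is proper -/

section

variable {k : Type u} [Field k] {𝒴 : QuotientStack k} {J : Center 𝒴.atlas}

lemma isSeparated_prod_snd {X Y : Sch k} (h : IsSeparated X.hom) :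
    IsSeparated (prod.snd : X ⨯ Y ⟶ Y).left := by
  have : IsSeparated (pullback.snd X.hom Y.hom) := inferInstance
  rw [← Over.prodLeftIsoPullback_hom_snd]
  have h1 : IsSeparated (Over.prodLeftIsoPullback X Y).hom := inferInstance
  infer_instance

lemma isSeparated_prod_hom {X Y : Sch k} (hX : IsSeparated X.hom) (hY : IsSeparated Y.hom) :
    IsSeparated (X ⨯ Y).hom := by
  have := isSeparated_prod_snd (Y := Y) hX
  rw [← Over.w (prod.snd : X ⨯ Y ⟶ Y)]
  infer_instance

/-- A valuative square for a morphism of `k`-schemes consists of morphisms of `k`-schemes. -/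
lemma existence_of_over {X Y : Sch k} (f : X ⟶ Y)
    (h : ∀ (R K : Type u) [CommRing R] [IsDomain R] [ValuationRing R] [Field K] [Algebra R K]
      [IsFractionRing R K] (a : Spec (CommRingCat.of R) ⟶ Spec (CommRingCat.of k))
      (x : Over.mk (Spec.map (CommRingCat.ofHom (algebraMap R K)) ≫ a) ⟶ X) (y : Over.mk a ⟶ Y),
      x ≫ f = Center.genericPoint a K ≫ y →
        ∃ z : Over.mk a ⟶ X, Center.genericPoint a K ≫ z = x ∧ z ≫ f = y) :
    ValuativeCriterion.Existence f.left := by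
  rintro ⟨R, K, i₁, i₂, ⟨w⟩⟩
  obtain ⟨z, hz, hz'⟩ := h R K (i₂ ≫ Y.hom) (Over.homMk i₁ (by
    change i₁ ≫ X.hom = _ ≫ _ ≫ _
    rw [← Over.w f, ← Category.assoc, w, Category.assoc])) (Over.homMk i₂)
    (by apply Over.OverMorphism.ext; exact w)
  exact ⟨⟨z.left, congrArg CommaMorphism.left hz, congrArg CommaMorphism.left hz'⟩⟩

lemma exists_lift_of_existence {X Y : Sch k} {f : X ⟶ Y}
    (h : ValuativeCriterion.Existence f.left)
    (R K : Type u) [CommRing R] [IsDomain R] [ValuationRing R] [Field K] [Algebra R K]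
    [IsFractionRing R K] (a : Spec (CommRingCat.of R) ⟶ Spec (CommRingCat.of k))
    (x : Over.mk (Spec.map (CommRingCat.ofHom (algebraMap R K)) ≫ a) ⟶ X) (y : Over.mk a ⟶ Y)
    (hxy : x ≫ f = Center.genericPoint a K ≫ y) :
    ∃ z : Over.mk a ⟶ X, Center.genericPoint a K ≫ z = x ∧ z ≫ f = y := by
  obtain ⟨⟨z, hz, hz'⟩⟩ := h ⟨R, K, x.left, y.left, ⟨congrArg CommaMorphism.left hxy⟩⟩
  refine ⟨Over.homMk z ?_, ?_, ?_⟩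
  · change z ≫ X.hom = a
    rw [← Over.w f, ← Category.assoc, hz']
    exact Over.w y
  · apply Over.OverMorphism.ext; exact hz
  · apply Over.OverMorphism.ext; exact hz'

/-- The generic point is dense in the reduced scheme Spec R, and Y is separated. -/
lemma hom_ext_of_genericPoint {R K : Type u} [CommRing R] [IsDomain R] [Field K] [Algebra R K]
    [IsFractionRing R K] (a : Spec (CommRingCat.of R) ⟶ Spec (CommRingCat.of k)) {Y : Sch k}
    (hY : IsSeparated Y.hom) {y y' : Over.mk a ⟶ Y}
    (h : Center.genericPoint a K ≫ y = Center.genericPoint a K ≫ y') : y = y' := by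
  ext1
  have : IsDominant (Spec.map (CommRingCat.ofHom (algebraMap R K))) :=
    ⟨(PrimeSpectrum.denseRange_comap_iff_ker_le_nilRadical (algebraMap R K)).mpr (by
      rw [(RingHom.injective_iff_ker_eq_bot _).mp (IsFractionRing.injective R K)]
      exact bot_le)⟩
  refine ext_of_isDominant_of_isSeparated (X := Spec (CommRingCat.of R)) Y.hom ?_
    (Spec.map (CommRingCat.ofHom (algebraMap R K))) (congrArg CommaMorphism.left h)
  exact (Over.w y).trans (Over.w y').symm

namespace QuotientStack

lemma separated_source_target (h : IsSmoothVariety 𝒴.atlas) :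
    IsSeparated (prod.lift 𝒴.source 𝒴.target).left ∧
      QuasiCompact (prod.lift 𝒴.source 𝒴.target).left ∧
      LocallyOfFiniteType (prod.lift 𝒴.source 𝒴.target).left := by
  have hA := isSmoothVariety_arrows h
  have := hA.separated
  have := hA.quasiCompact
  have := hA.smooth
  have hw : (prod.lift 𝒴.source 𝒴.target).left ≫ (𝒴.atlas ⨯ 𝒴.atlas).hom = 𝒴.arrows.hom :=
    Over.w (prod.lift 𝒴.source 𝒴.target)
  have h1 : IsSeparated (𝒴.atlas ⨯ 𝒴.atlas).hom := isSeparated_prod_hom h.separated h.separated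
  refine ⟨?_, ?_, ?_⟩
  · have : IsSeparated ((prod.lift 𝒴.source 𝒴.target).left ≫ (𝒴.atlas ⨯ 𝒴.atlas).hom) := by
      rw [hw]; infer_instance
    exact IsSeparated.of_comp _ (𝒴.atlas ⨯ 𝒴.atlas).hom
  · have : QuasiCompact ((prod.lift 𝒴.source 𝒴.target).left ≫ (𝒴.atlas ⨯ 𝒴.atlas).hom) := by
      rw [hw]; infer_instance
    exact QuasiCompact.of_comp _ (𝒴.atlas ⨯ 𝒴.atlas).hom
  · have : LocallyOfFiniteType ((prod.lift 𝒴.source 𝒴.target).left ≫ (𝒴.atlas ⨯ 𝒴.atlas).hom) := by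
      rw [hw]; infer_instance
    exact locallyOfFiniteType_of_comp _ (𝒴.atlas ⨯ 𝒴.atlas).hom

/-- The valuative criterion for (source, target): a K-arrow between two R-points of the atlas
extends to an R-arrow. -/
lemma exists_units_of_isProper (h : IsProper (prod.lift 𝒴.source 𝒴.target).left)
    {R K : Type u} [CommRing R] [IsDomain R] [ValuationRing R] [Field K] [Algebra R K]
    [IsFractionRing R K] (a : Spec (CommRingCat.of R) ⟶ Spec (CommRingCat.of k))
    (u u' : Over.mk a ⟶ 𝒴.atlas) (t : Fin 𝒴.rank → Γ((Over.mk (Spec.map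
      (CommRingCat.ofHom (algebraMap R K)) ≫ a) : Sch k).left, ⊤)ˣ)
    (ht : 𝒴.action.smul t (Center.genericPoint a K ≫ u) = Center.genericPoint a K ≫ u') :
    ∃ τ, pullbackUnits (Center.genericPoint a K) τ = t ∧ 𝒴.action.smul τ u = u' := by
  obtain ⟨x, hx, hxu⟩ := 𝒴.exists_arrow t (Center.genericPoint a K ≫ u)
  have hex : ValuativeCriterion.Existence (prod.lift 𝒴.source 𝒴.target).left := by
    have := IsProper.eq_valuativeCriterion
    rw [this] at h
    exact h.1.1.1.existence
  obtain ⟨z, hz, hz'⟩ := exists_lift_of_existence hex R K a x (prod.lift u u') (by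
    rw [prod.comp_lift, prod.comp_lift, comp_target, hx, hxu, ht])
  rw [prod.comp_lift] at hz'
  have h1 : z ≫ 𝒴.source = u := (prod.lift_fst _ _).symm.trans
    ((congrArg (· ≫ prod.fst) hz').trans (prod.lift_fst _ _))
  have h2 : z ≫ 𝒴.target = u' := (prod.lift_snd _ _).symm.trans
    ((congrArg (· ≫ prod.snd) hz').trans (prod.lift_snd _ _))
  refine ⟨pullbackUnits z 𝒴.arrowUnits, ?_, ?_⟩
  · rw [pullbackUnits_comp, hz, hx]
  · rw [← h2, comp_target, h1]

end QuotientStack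

namespace Center

open QuotientStack.WeightedBlowup (toAtlas)

variable (hJ : 𝒴.IsInvariantCenter J)

lemma smul_cons_one {S : Sch k} (t : Fin 𝒴.rank → Γ(S.left, ⊤)ˣ) (c : Γ(S.left, ⊤)ˣ) :
    (Fin.cons c 1 : Fin (𝒴.rank + 1) → Γ(S.left, ⊤)ˣ) * Fin.cons 1 t = Fin.cons c t :=
  funext fun i ↦ Fin.cases (mul_one _) (fun _ ↦ one_mul _) i

/-- Given a K-arrow between two R-points of B₊, its component in the old torus extends over R by
properness of the diagonal of 𝒴. After translating by the extension, the two points have the same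
image in the atlas of 𝒴 and differ by an element of 𝔾_m, which extends by `exists_units_map_eq`. -/
theorem isProper_weightedBlowup (h𝒴 : 𝒴.IsSmoothDM) :
    IsProper (prod.lift (weightedBlowup hJ).stack.source (weightedBlowup hJ).stack.target).left := by
  let 𝒲 := (weightedBlowup hJ).stack
  have h𝒲 : IsSmoothVariety 𝒲.atlas := J.isSmoothVariety_puncturedCone h𝒴.atlas
  obtain ⟨hsep, hqc, hlft⟩ := QuotientStack.separated_source_target h𝒲
  have hex : ValuativeCriterion.Existence (prod.lift 𝒲.source 𝒲.target).left := by
    refine existence_of_over (prod.lift 𝒲.source 𝒲.target) ?_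
    intro R K _ _ _ _ _ _ a x y hxy
    let i := genericPoint a K
    let b : Over.mk a ⟶ J.puncturedCone := y ≫ (prod.fst : 𝒲.atlas ⨯ 𝒲.atlas ⟶ 𝒲.atlas)
    let b' : Over.mk a ⟶ J.puncturedCone := y ≫ (prod.snd : 𝒲.atlas ⨯ 𝒲.atlas ⟶ 𝒲.atlas)
    have hb : x ≫ 𝒲.source = i ≫ b := by
      rw [prod.comp_lift] at hxy
      exact (prod.lift_fst _ _).symm.trans ((congrArg (· ≫ prod.fst) hxy).trans
        (Category.assoc _ _ _))
    have hb' : x ≫ 𝒲.target = i ≫ b' := by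
      rw [prod.comp_lift] at hxy
      exact (prod.lift_snd _ _).symm.trans ((congrArg (· ≫ prod.snd) hxy).trans
        (Category.assoc _ _ _))
    let t : Fin (𝒴.rank + 1) → Γ((Over.mk (Spec.map
      (CommRingCat.ofHom (algebraMap R K)) ≫ a) : Sch k).left, ⊤)ˣ := pullbackUnits x 𝒲.arrowUnits
    have ht : (puncturedConeAction hJ).smul t (i ≫ b) = i ≫ b' := by
      refine Eq.trans ?_ hb'
      rw [𝒲.comp_target, hb]
      rfl
    obtain ⟨τ, hτ, hτb⟩ := QuotientStack.exists_units_of_isProper h𝒴.separated a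
      (b ≫ toAtlas J) (b' ≫ toAtlas J) (Fin.tail t) (by
        have h1 := (weightedBlowup hJ).smul_toAtlas t (i ≫ b)
        rw [← Category.assoc, ← Category.assoc, ← ht]
        exact h1.symm)
    let b₁ := (puncturedConeAction hJ).smul (Fin.cons 1 τ) b
    have hb₁ : b₁ ≫ toAtlas J = b' ≫ toAtlas J := by
      refine ((weightedBlowup hJ).smul_toAtlas (Fin.cons 1 τ) b).trans ?_
      rw [Fin.tail_cons, hτb]
    have hib₁ : i ≫ b₁ = (puncturedConeAction hJ).smul (Fin.cons 1 (Fin.tail t)) (i ≫ b) := by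
      rw [(puncturedConeAction hJ).comp_smul, pullbackUnits_cons, map_one, hτ]
    have ht1 : (puncturedConeAction hJ).smul (Fin.cons (t 0) 1) (i ≫ b₁) = i ≫ b' := by
      rw [hib₁, ← (puncturedConeAction hJ).mul_smul, smul_cons_one, Fin.cons_self_tail, ht]
    obtain ⟨c, hc⟩ := exists_units_map_eq hJ a b₁ b' hb₁ (t 0) (by
      rw [← Category.assoc, ← Category.assoc, ← ht1, smul_puncturedConeι])
    obtain ⟨z, hz, hzb⟩ := 𝒲.exists_arrow (Fin.cons c τ : Fin (𝒴.rank + 1) → _) b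
    have hiz : i ≫ z = x := by
      refine QuotientStack.arrow_ext ?_ ?_
      · rw [← pullbackUnits_comp, hz]
        refine (pullbackUnits_cons i c τ).trans ?_
        rw [hc, hτ]
        exact Fin.cons_self_tail t
      · rw [Category.assoc, hzb, hb]
        rfl
    refine ⟨z, hiz, ?_⟩
    have hsepB := h𝒲.separated
    have hzb' : z ≫ 𝒲.target = b' := by
      refine hom_ext_of_genericPoint (K := K) a hsepB ?_
      rw [← Category.assoc, hiz]
      exact hb'
    rw [prod.comp_lift, hzb, hzb']
    exact Limits.prod.hom_ext (prod.lift_fst _ _) (prod.lift_snd _ _)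
  have := UniversallyClosed.of_valuativeCriterion _ hex
  exact {}

theorem isSmoothDM_weightedBlowup [CharZero k] (h𝒴 : 𝒴.IsSmoothDM) :
    (weightedBlowup hJ).stack.IsSmoothDM where
  atlas := J.isSmoothVariety_puncturedCone h𝒴.atlas
  unramified := formallyUnramified_weightedBlowup hJ h𝒴.unramified
  separated := isProper_weightedBlowup hJ h𝒴

end Center

end

/-! ### Making a point of B integral by a 𝔾_m-translation; closed images -/

section

namespace RingFiltration

section Monomial

variable {A K : Type u} [CommRing A] [Field K] {I : RingFiltration A} {d : ℕ} {x : Fin d → A}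
  {w : Fin d → ℕ} (hx : ∀ i, x i ∈ I.ideal (w i))

include hx in
lemma exists_monomial_eq (m : Fin d → ℕ) (n : ℕ) (hn : n ≤ ∑ i, w i * m i) (f : A)
    (hf : f = ∏ i, x i ^ m i) (hfI : f ∈ I.ideal n) :
    I.monomial n f hfI = (∏ i, I.monomial (w i) (x i) (hx i) ^ m i) *
      I.exceptional ^ (∑ i, w i * m i - n) := by
  have key : ((∏ i, I.monomial (w i) (x i) (hx i) ^ m i : I.extendedRees) : LaurentPolynomial A) =
      C (∏ i, x i ^ m i) * T ((∑ i, w i * m i : ℕ) : ℤ) := by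
    rw [← Subring.subtype_apply, map_prod, map_prod, Nat.cast_sum]
    have : (T (∑ i, ((w i * m i : ℕ) : ℤ)) : LaurentPolynomial A) = ∏ i, T ((w i * m i : ℕ) : ℤ) := by
      induction (Finset.univ : Finset (Fin d)) using Finset.induction_on with
      | empty => simp
      | insert a s ha ih => rw [Finset.sum_insert ha, Finset.prod_insert ha, T_add, ih]
    rw [this, ← Finset.prod_mul_distrib]
    refine Finset.prod_congr rfl fun i _ ↦ ?_
    rw [map_pow, map_pow]
    change (C (x i) * T (w i : ℤ)) ^ m i = _
    rw [mul_pow, T_pow, mul_comm (m i : ℤ)]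
    push_cast; rfl
  refine Subtype.ext ?_
  rw [Subring.coe_mul, key, exceptional_pow]
  change C f * T (n : ℤ) = C (∏ i, x i ^ m i) * T _ * (C 1 * T (-((_ : ℕ) : ℤ)))
  rw [map_one, one_mul, mul_assoc, ← T_add, hf]
  congr 2
  omega

variable (hI : ∀ n, I.ideal n =
  Ideal.span {f | ∃ m : Fin d → ℕ, n ≤ ∑ i, w i * m i ∧ f = ∏ i, x i ^ m i})

include hI in
lemma coordinate_mem (i : Fin d) : x i ∈ I.ideal (w i) := by
  classical
  rw [hI]
  refine Ideal.subset_span ⟨Pi.single i 1, ?_, ?_⟩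
  · rw [Finset.sum_eq_single i (fun j _ hj ↦ by simp [hj]) (by simp)]
    simp
  · rw [Finset.prod_eq_single i (fun j _ hj ↦ by simp [hj]) (by simp)]
    simp

include hI in
/-- A property of the elements `f Tⁿ` of a monomial filtration may be checked on monomials. -/
lemma monomial_span_induction (n : ℕ) {p : I.extendedRees → Prop} (h0 : p 0)
    (hadd : ∀ a b, p a → p b → p (a + b)) (hmul : ∀ a b, p b → p (I.const a * b))
    (hmon : ∀ m : Fin d → ℕ, n ≤ ∑ i, w i * m i → p ((∏ i, I.monomial (w i) (x i)
      (coordinate_mem hI i) ^ m i) * I.exceptional ^ (∑ i, w i * m i - n)))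
    (f : A) (hf : f ∈ I.ideal n) : p (I.monomial n f hf) := by
  suffices H : ∀ f (_ : f ∈ Ideal.span {f | ∃ m : Fin d → ℕ, n ≤ ∑ i, w i * m i ∧ f = ∏ i, x i ^ m i})
      (hf : f ∈ I.ideal n), p (I.monomial n f hf) from H f (hI n ▸ hf) hf
  intro f hf'
  induction hf' using Submodule.span_induction with
  | mem f h =>
    intro hf
    obtain ⟨m, hm, h⟩ := h
    rw [exists_monomial_eq (coordinate_mem hI) m n hm f h]
    exact hmon m hm
  | zero =>
    intro hf
    have : I.monomial n 0 hf = 0 := Subtype.ext (by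
      change C 0 * T (n : ℤ) = 0
      rw [map_zero, zero_mul])
    exact this ▸ h0
  | add f g hf hg ihf ihg =>
    intro h
    have hf : f ∈ I.ideal n := by rw [hI]; exact hf
    have hg : g ∈ I.ideal n := by rw [hI]; exact hg
    have : I.monomial n (f + g) h = I.monomial n f hf + I.monomial n g hg := Subtype.ext (by
      change C (f + g) * T (n : ℤ) = C f * T (n : ℤ) + C g * T (n : ℤ)
      rw [map_add, add_mul])
    exact this ▸ hadd _ _ (ihf hf) (ihg hg)
  | smul a f hf ih =>
    intro h
    have hf : f ∈ I.ideal n := by rw [hI]; exact hf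
    have : I.monomial n (a • f) h = I.const a * I.monomial n f hf := Subtype.ext (by
      change C (a * f) * T (n : ℤ) = C a * (C f * T (n : ℤ))
      rw [map_mul, mul_assoc])
    exact this ▸ hmul _ _ (ih hf)

include hI in
-- This is the limit in weighted projective space: the weighted coordinates x_i T^(w_i) are rescaled
-- until they are all integral and one of them is 1. Fractional weights require roots of
-- coordinates, so K is algebraically closed.
lemma exists_twist_integral {Γ₀ : Type*} [LinearOrderedCommGroupWithZero Γ₀] (v : Valuation K Γ₀)
    [IsAlgClosed K] (φ : I.extendedRees →+* K) (hφ : ∀ a, v (φ (I.const a)) ≤ 1) (n : ℕ) (f : A)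
    (hf : f ∈ I.ideal (n + 1)) (hne : φ (I.monomial (n + 1 : ℕ) f hf) ≠ 0) :
    ∃ t : Kˣ, (∀ r, v (twist φ t r) ≤ 1) ∧ ∃ (n : ℕ) (f : A) (hf : f ∈ I.ideal (n + 1)),
      v (twist φ t (I.monomial (n + 1 : ℕ) f hf)) = 1 := by
  have hx := coordinate_mem hI
  let X (i : Fin d) : I.extendedRees := I.monomial (w i) (x i) (hx i)
  -- Every monomial of weighted degree at least n + 1 contains a coordinate of positive weight, so
  -- if all these vanished at φ, then f T^(n+1) would too.
  have hex : ∃ i, 0 < w i ∧ φ (X i) ≠ 0 := by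
    by_contra! H
    refine hne (monomial_span_induction hI (n + 1) (p := fun r ↦ φ r = 0) (map_zero φ)
      (fun a b ha hb ↦ by rw [map_add, ha, hb, add_zero])
      (fun a b hb ↦ by rw [map_mul, hb, mul_zero]) (fun m hm ↦ ?_) f hf)
    obtain ⟨i, -, hi⟩ : ∃ i ∈ Finset.univ, 0 < w i * m i := by
      by_contra! h0
      have := Finset.sum_nonpos h0
      omega
    rw [map_mul, map_prod, Finset.prod_eq_zero (Finset.mem_univ i), zero_mul]
    rw [map_pow]
    change φ (X i) ^ m i = 0
    rw [H i (Nat.pos_of_mul_pos_right hi), zero_pow (Nat.pos_of_mul_pos_left hi).ne']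
  have hroot (i : Fin d) : ∃ r : K, 0 < w i → r ^ w i = φ (X i) := by
    by_cases hw : 0 < w i
    · obtain ⟨r, hr⟩ := IsAlgClosed.exists_pow_nat_eq (φ (X i)) hw
      exact ⟨r, fun _ ↦ hr⟩
    · exact ⟨0, fun h ↦ absurd h hw⟩
  choose r hr using hroot
  obtain ⟨i₀, hi₀, hne₀⟩ := hex
  obtain ⟨j, hj, hmax⟩ := (Finset.univ.filter fun i ↦ 0 < w i).exists_max_image (fun i ↦ v (r i))
    ⟨i₀, by simpa using hi₀⟩
  replace hj : 0 < w j := by simpa using hj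
  replace hmax (i) (hi : 0 < w i) : v (r i) ≤ v (r j) := hmax i (by simpa using hi)
  have hrj : r j ≠ 0 := by
    intro h0
    have h1 := hmax i₀ hi₀
    rw [h0, map_zero, le_zero_iff, map_eq_zero] at h1
    have h2 := hr i₀ hi₀
    rw [h1, zero_pow hi₀.ne'] at h2
    exact hne₀ h2.symm
  -- r_i is a w_i-th root of the i-th weighted coordinate and r_j has the largest valuation. Scaling
  -- by its inverse sends the i-th coordinate to (r_i / r_j)^(w_i).
  let t : Kˣ := (Units.mk0 (r j) hrj)⁻¹
  have ht : (t : K) = (r j)⁻¹ := rfl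
  have htX (i) : twist φ t (X i) = φ (X i) * (r j)⁻¹ ^ w i := by
    refine (twist_monomial φ t (w i) (x i) (hx i)).trans ?_
    rw [zpow_natCast, Units.val_pow_eq_pow_val, ht]
  have hX (i) : v (twist φ t (X i)) ≤ 1 := by
    rw [htX]
    rcases Nat.eq_zero_or_pos (w i) with hw | hw
    · have : X i = I.const (x i) := Subtype.ext (by
        change C (x i) * T (w i : ℤ) = C (x i)
        rw [hw, Nat.cast_zero, T_zero, mul_one])
      rw [hw, pow_zero, mul_one, this]
      exact hφ _
    · rw [← hr i hw, ← mul_pow, map_pow]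
      refine pow_le_one₀ zero_le ?_
      rw [map_mul, map_inv₀]
      exact mul_inv_le_one_of_le₀ (hmax i hw) zero_le
  have hXj : v (twist φ t (X j)) = 1 := by
    rw [htX, ← hr j hj, ← mul_pow, mul_inv_cancel₀ hrj, one_pow, map_one]
  -- The translate of s is φ(s) r_j. Its w_j-th power is φ(s^(w_j) · x_j T^(w_j)) = φ(x_j), which is
  -- integral by hypothesis.
  have hs : v (twist φ t I.exceptional) ≤ 1 := by
    have h1 : twist φ t I.exceptional = φ I.exceptional * r j := by
      refine (twist_monomial φ t (-1) 1 _).trans ?_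
      rw [zpow_neg_one, inv_inv]; rfl
    refine (pow_le_one_iff_of_nonneg zero_le hj.ne').mp ?_
    rw [← map_pow, h1, mul_pow, hr j hj, ← map_pow, ← map_mul, mul_comm]
    change v (φ (I.monomial (w j) (x j) (hx j) * _)) ≤ 1
    rw [monomial_mul_exceptional_pow]
    exact hφ _
  have hc (a) : v (twist φ t (I.const a)) ≤ 1 := by
    rw [twist_const]; exact hφ a
  have hmul {a b : K} (ha : v a ≤ 1) (hb : v b ≤ 1) : v (a * b) ≤ 1 := by
    rw [map_mul]; exact mul_le_one' ha hb
  refine ⟨t, fun y ↦ ?_, ?_⟩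
  · induction y using extendedRees_induction with
    | h0 => simp
    | hadd a b ha hb => rw [map_add]; exact (v.map_add _ _).trans (max_le ha hb)
    | hmon n f hf =>
      obtain ⟨n, rfl | rfl⟩ := n.eq_nat_or_neg
      · refine monomial_span_induction hI n (p := fun y ↦ v (twist φ t y) ≤ 1) (by simp)
          (fun a b ha hb ↦ by rw [map_add]; exact (v.map_add _ _).trans (max_le ha hb))
          (fun a b hb ↦ by rw [map_mul]; exact hmul (hc a) hb) (fun m hm ↦ ?_) f hf
        rw [map_mul, map_prod, map_pow]
        refine hmul ?_ (by rw [map_pow]; exact pow_le_one₀ zero_le hs)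
        rw [map_prod]
        refine Finset.prod_le_one' fun i _ ↦ ?_
        rw [map_pow, map_pow]
        exact pow_le_one₀ zero_le (hX i)
      · rw [monomial_eq_const_mul_exceptional_pow, map_mul, map_pow]
        exact hmul (hc f) (by rw [map_pow]; exact pow_le_one₀ zero_le hs)
  · obtain ⟨n', hn'⟩ := Nat.exists_eq_succ_of_ne_zero hj.ne'
    have hm : x j ∈ I.ideal (n' + 1) := by
      have := hx j
      rwa [hn'] at this
    refine ⟨n', x j, hm, ?_⟩
    have : I.monomial (n' + 1 : ℕ) (x j) hm = X j := Subtype.ext (by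
      change C (x j) * T ((n' + 1 : ℕ) : ℤ) = C (x j) * T (w j : ℤ)
      rw [hn'])
    rw [this]; exact hXj

end Monomial

lemma map_twist {A S S' : Type u} [CommRing A] [CommRing S] [CommRing S'] {I : RingFiltration A}
    (g : S →+* S') (φ : I.extendedRees →+* S) (c : Sˣ) :
    g.comp (twist φ c) = twist (g.comp φ) (Units.map g c) := by
  ext r
  induction r using extendedRees_induction with
  | h0 => simp
  | hadd a b ha hb => rw [map_add, map_add, ha, hb]
  | hmon n f hf =>
    rw [RingHom.comp_apply, twist_monomial, twist_monomial, map_mul, ← map_zpow]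
    rfl

end RingFiltration

/-- After localizing the target, the source is quasi-compact and is the image of one affine scheme,
which reduces the claim to prime spectra. It remains to lift specializations, a task for valuation
rings. -/
lemma isClosed_image_of_stableUnderSpecialization {X Y : Scheme.{u}} (f : X ⟶ Y) [QuasiCompact f]
    {Z : Set X} (hZ : IsClosed Z) (H : StableUnderSpecialization (f '' Z)) : IsClosed (f '' Z) := by
  wlog hY : ∃ R, Y = Spec R
  · have key : ∀ y : Y, ∃ (R : CommRingCat.{u}) (j : Spec R ⟶ Y), ∃ _ : IsOpenImmersion j, y ∈ j.opensRange :=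
      fun y ↦ ⟨_, Y.affineCover.f (Y.affineCover.idx y), Y.affineCover.map_prop _, Y.affineCover.covers y⟩
    choose R j hj hy using key
    have hcov : IsOpenCover fun y ↦ (j y).opensRange :=
      IsOpenCover.mk (eq_top_iff.mpr fun y _ ↦ Opens.mem_iSup.mpr ⟨y, hy y⟩)
    refine hcov.isClosed_iff_coe_preimage.mpr fun y ↦ ?_
    have h1 : j y ⁻¹' (f '' Z) = pullback.snd f (j y) '' (pullback.fst f (j y) ⁻¹' Z) := by
      ext z
      constructor
      · rintro ⟨x, hx, hxz⟩
        obtain ⟨p, hp, hp'⟩ := Scheme.Pullback.exists_preimage_pullback x z hxz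
        exact ⟨p, by rwa [Set.mem_preimage, hp], hp'⟩
      · rintro ⟨p, hp, rfl⟩
        refine ⟨_, hp, ?_⟩
        rw [← Scheme.Hom.comp_apply, pullback.condition]; rfl
    have h2 : IsClosed (j y ⁻¹' (f '' Z)) := by
      rw [h1]
      refine this (pullback.snd f (j y)) (hZ.preimage (pullback.fst f (j y)).continuous) ?_ ⟨_, rfl⟩
      rw [← h1]
      exact H.preimage (j y).continuous
    let e := (j y).isOpenEmbedding.toIsEmbedding.toHomeomorph
    have h3 : e ⁻¹' ((↑) ⁻¹' (f '' Z) : Set (Set.range (j y))) = j y ⁻¹' (f '' Z) := rfl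
    exact e.isClosed_preimage.mp (h3 ▸ h2)
  obtain ⟨S, rfl⟩ := hY
  obtain ⟨R, g, hg⟩ := compactSpace_iff_exists.mp (QuasiCompact.compactSpace_of_compactSpace f)
  obtain ⟨φ, hφ⟩ := Spec.homEquiv.symm.surjective (g ≫ f)
  have h1 : f '' Z = PrimeSpectrum.comap φ.hom '' (g ⁻¹' Z) := by
    have h2 : (g ≫ f) '' (g ⁻¹' Z) = f '' Z := by
      simp_rw [Scheme.Hom.comp_base, TopCat.comp_app, ← Set.image_image,
        Set.image_preimage_eq _ hg]
    rw [← h2, ← hφ]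
    rfl
  rw [h1] at H ⊢
  exact PrimeSpectrum.isClosed_image_of_stableUnderSpecialization φ.hom _
    (hZ.preimage g.continuous) H

end

/-! ### Extending points of B₊ over valuation rings -/

section

variable {k : Type u} [Field k] {𝒴 : QuotientStack k} {J : Center 𝒴.atlas}

namespace Center

open QuotientStack.WeightedBlowup (toAtlas)

lemma exists_monomial_chart {Y : Sch k} (J : Center Y) (y : Y.left) :
    ∃ (U : Y.left.AffineZariskiSite) (d : ℕ) (x : Fin d → Γ(Y.left, U.1)) (w : Fin d → ℕ),
      y ∈ U.1 ∧ ∀ n, (J.sections U).ideal n =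
        Ideal.span {f | ∃ m : Fin d → ℕ, n ≤ ∑ i, w i * m i ∧ f = ∏ i, x i ^ m i} := by
  obtain ⟨U, hy, h | ⟨d, x, w, -, h⟩⟩ := J.locally_monomial y
  -- A trivial center is also generated by monomials, in the single function 1 with weight 1;
  -- étaleness of the coordinates plays no role here.
  · refine ⟨⟨U.1, U.2⟩, 1, 1, 1, hy, fun n ↦ (h n).trans ?_⟩
    symm
    rw [Ideal.eq_top_iff_one]
    refine Ideal.subset_span ?_
    exact ⟨fun _ ↦ n, by simp, by simp⟩
  · exact ⟨⟨U.1, U.2⟩, d, x, w, hy, h⟩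

variable (hJ : 𝒴.IsInvariantCenter J) {R K : Type u} [CommRing R] [IsDomain R] [ValuationRing R]
  [Field K] [Algebra R K] [IsFractionRing R K] (a : Spec (CommRingCat.of R) ⟶ Spec (CommRingCat.of k))

/-- Up to the action of `𝔾_m`, the blowup satisfies the existence part of the valuative criterion
over an algebraically closed field. -/
lemma exists_extension [IsAlgClosed K]
    (b : Over.mk (Spec.map (CommRingCat.ofHom (algebraMap R K)) ≫ a) ⟶ J.puncturedCone)
    (y : Over.mk a ⟶ 𝒴.atlas) (h : b ≫ toAtlas J = genericPoint a K ≫ y) :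
    ∃ (t : Γ((Over.mk (Spec.map (CommRingCat.ofHom (algebraMap R K)) ≫ a) : Sch k).left, ⊤)ˣ)
      (β : Over.mk a ⟶ J.puncturedCone),
      genericPoint a K ≫ β = (puncturedConeAction hJ).smul (Fin.cons t 1) b ∧
      β ≫ toAtlas J = y := by
  let p : Spec (CommRingCat.of R) := IsLocalRing.closedPoint R
  have hp (z : Spec (CommRingCat.of R)) : z ⤳ p := IsLocalRing.specializes_closedPoint z
  obtain ⟨U, d, x, w, hU, hI⟩ := J.exists_monomial_chart (y.left p)
  have hyU (z) : y.left z ∈ U.1 := ((hp z).map y.left.continuous).mem_open U.1.2 hU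
  have hleft : (b ≫ J.puncturedConeι).left ≫ J.toBase =
      Spec.map (CommRingCat.ofHom (algebraMap R K)) ≫ y.left := congrArg CommaMorphism.left h
  have hbU (z) : J.toBase ((b ≫ J.puncturedConeι).left z) ∈ U.1 := by
    have := congrArg (fun g : Spec (CommRingCat.of K) ⟶ 𝒴.atlas.left ↦ g z) hleft
    exact this ▸ hyU (Spec.map (CommRingCat.ofHom (algebraMap R K)) z)
  obtain ⟨φ, hφ⟩ := IdealFiltration.exists_eq_ofRingHom (Z := Spec (CommRingCat.of K)) (U := U)
    (b ≫ J.puncturedConeι).left hbU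
  obtain ⟨g, hg⟩ := IdealFiltration.exists_eq_toSpec_fromSpec (Z := Spec (CommRingCat.of R)) y.left U hyU
  let i := Spec.map (CommRingCat.ofHom (algebraMap R K))
  let eK := Scheme.ΓSpecIso (CommRingCat.of K)
  let eR := Scheme.ΓSpecIso (CommRingCat.of R)
  have he (r : R) : i.appTop (eR.inv r) = eK.inv (algebraMap R K r) :=
    congr($(Scheme.ΓSpecIso_inv_naturality (CommRingCat.ofHom (algebraMap R K))) r).symm
  have he' (r : Γ(Spec (CommRingCat.of R), ⊤)) : eK.hom (i.appTop r) = algebraMap R K (eR.hom r) :=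
    congr($(Scheme.ΓSpecIso_naturality (CommRingCat.ofHom (algebraMap R K))) r)
  have heK (x : Γ(Spec (CommRingCat.of K), ⊤)) : eK.inv (eK.hom x) = x := congr($(eK.hom_inv_id) x)
  have heR (x : Γ(Spec (CommRingCat.of R), ⊤)) : eR.inv (eR.hom x) = x := congr($(eR.hom_inv_id) x)
  -- On functions from the atlas the K-point comes from the R-point y, so its values are integral.
  have hconst : φ.comp (J.sections U).const = i.appTop.hom.comp g := by
    refine toSpec_injective ((cancel_mono U.2.fromSpec).mp ?_)
    rw [← comp_toSpec, Category.assoc, ← hg, ← IdealFiltration.ofRingHom_toBase, ← hφ]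
    exact hleft
  have h1 : IdealFiltration.ofRingHom φ (IsLocalRing.closedPoint K) ∈ J.awayFromVertex := by
    rw [← hφ]
    exact (b.left (IsLocalRing.closedPoint K) : J.awayFromVertex).2
  obtain ⟨n, f, hf, h2⟩ := (J.ofRingHom_mem_awayFromVertex φ _).mp h1
  let φ' : (J.sections U).extendedRees →+* K := eK.hom.hom.comp φ
  obtain ⟨t, ht, n', f', hf', hu⟩ := RingFiltration.exists_twist_integral hI
    (ValuationRing.valuation R K) φ' (fun r ↦ (ValuationRing.mem_integer_iff R K _).mpr
      ⟨eR.hom (g r), by rw [← he']; exact congrArg eK.hom (RingHom.congr_fun hconst r).symm⟩)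
    n f hf (fun h0 ↦ by
      have h3 : φ ((J.sections U).monomial (n + 1 : ℕ) f hf) = 0 := by
        rw [← heK (φ _)]
        exact (congrArg eK.inv h0).trans (map_zero eK.inv.hom)
      rw [h3, Scheme.basicOpen_zero] at h2
      exact h2)
  -- The translated point takes values in R. The element of positive degree with valuation 1 becomes
  -- a unit of R, so the extension stays away from the vertex at the closed point too.
  obtain ⟨ψ, hψ⟩ := RingFiltration.exists_ringHom_comp_eq (j := algebraMap R K)
    (IsFractionRing.injective R K) (RingFiltration.twist φ' t)
    (fun r ↦ (ValuationRing.mem_integer_iff R K _).mp (ht r))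
  have hunit : IsUnit (ψ ((J.sections U).monomial (n' + 1 : ℕ) f' hf')) := by
    obtain ⟨c, hc⟩ := (ValuationRing.mem_integer_iff R K
      (RingFiltration.twist φ' t ((J.sections U).monomial (n' + 1 : ℕ) f' hf'))⁻¹).mp (by
        change ValuationRing.valuation R K _ ≤ 1
        rw [map_inv₀, hu, inv_one])
    refine IsUnit.of_mul_eq_one c (IsFractionRing.injective R K ?_)
    rw [map_mul, hψ, hc, map_one]
    refine mul_inv_cancel₀ fun h0 ↦ ?_
    rw [h0, map_zero] at hu
    exact zero_ne_one hu
  let Ψ : (J.sections U).extendedRees →+* Γ(Spec (CommRingCat.of R), ⊤) := eR.inv.hom.comp ψ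
  have hΨ : IdealFiltration.ofRingHom Ψ ≫ J.toBase = y.left := by
    rw [hg, IdealFiltration.ofRingHom_toBase]
    congr 2
    ext r
    have h3 : ψ ((J.sections U).const r) = eR.hom (g r) := by
      refine IsFractionRing.injective R K ?_
      rw [hψ, RingFiltration.twist_const, ← he']
      exact congrArg eK.hom (RingHom.congr_fun hconst r)
    exact (congrArg eR.inv h3).trans (heR _)
  have hr : Set.range (IdealFiltration.ofRingHom Ψ) ⊆ Set.range J.puncturedConeι.left := by
    rintro _ ⟨z, rfl⟩
    refine ⟨⟨_, (J.ofRingHom_mem_awayFromVertex Ψ z).mpr ⟨n', f', hf', ?_⟩⟩, rfl⟩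
    exact (Scheme.basicOpen_of_isUnit _ (hunit.map eR.inv.hom)).ge (Set.mem_univ z)
  have hfac := IsOpenImmersion.lift_fac J.puncturedConeι.left (IdealFiltration.ofRingHom Ψ) hr
  let β : Over.mk a ⟶ J.puncturedCone := Over.homMk
    (IsOpenImmersion.lift J.puncturedConeι.left (IdealFiltration.ofRingHom Ψ) hr) (by
      rw [← Over.w J.puncturedConeι, ← Category.assoc, hfac]
      refine (Category.assoc _ _ _).symm.trans ?_
      exact (congrArg (· ≫ 𝒴.atlas.hom) hΨ).trans (Over.w y))
  let τ : Γ((Over.mk (Spec.map (CommRingCat.ofHom (algebraMap R K)) ≫ a) : Sch k).left, ⊤)ˣ :=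
    Units.map eK.inv.hom.toMonoidHom t
  have hτ := coneSMul_ofRingHom hJ (Fin.cons τ 1) (Fin.tail_cons _ _) (b ≫ J.puncturedConeι) φ hφ
  rw [Fin.cons_zero] at hτ
  refine ⟨τ, β, ?_, ?_⟩
  · refine puncturedCone_hom_ext ?_
    rw [smul_puncturedConeι]
    ext1
    refine Eq.trans ?_ hτ.symm
    change (i ≫ IsOpenImmersion.lift J.puncturedConeι.left (IdealFiltration.ofRingHom Ψ) hr) ≫
      J.puncturedConeι.left = _
    refine (Category.assoc _ _ _).trans ((congrArg (i ≫ ·) hfac).trans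
      ((IdealFiltration.comp_ofRingHom i Ψ).trans (congrArg IdealFiltration.ofRingHom ?_)))
    have h4 : φ = eK.inv.hom.comp φ' := by
      ext r
      exact (heK _).symm
    rw [h4]
    refine Eq.trans ?_ (RingFiltration.map_twist eK.inv.hom φ' t)
    ext r
    exact (he _).trans (congrArg eK.inv (hψ r))
  · ext1
    exact (congrArg (· ≫ J.toBase) hfac).trans hΨ

end Center

end

/-! ### Properness of the blowup over Y -/

section

variable {k : Type u} [Field k] {𝒴 : QuotientStack k} {J : Center 𝒴.atlas}

lemma isPullback_left {P X Y Z : Sch k} {p : P ⟶ X} {q : P ⟶ Y} {f : X ⟶ Z} {g : Y ⟶ Z}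
    (h : IsPullback p q f g) : IsPullback p.left q.left f.left g.left :=
  h.map (Over.forget _)

/-- A specialization in the target of a morphism of `k`-schemes is induced by the spectrum of
a valuation ring with algebraically closed fraction field. -/
lemma exists_valuationRing_of_specializes {X Y : Sch k} (f : X ⟶ Y) {x : X.left} {y : Y.left}
    (h : f.left x ⤳ y) : ∃ (R K : Type u) (_ : CommRing R) (_ : IsDomain R) (_ : ValuationRing R)
      (_ : Field K) (_ : Algebra R K) (_ : IsFractionRing R K) (_ : IsAlgClosed K)
      (a : Spec (CommRingCat.of R) ⟶ Spec (CommRingCat.of k))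
      (b : Over.mk (Spec.map (CommRingCat.ofHom (algebraMap R K)) ≫ a) ⟶ X) (v : Over.mk a ⟶ Y),
      b ≫ f = Center.genericPoint a K ≫ v ∧ b.left (IsLocalRing.closedPoint K) = x ∧
      v.left (IsLocalRing.closedPoint R) = y := by
  -- Passing to the algebraic closure provides the roots needed for extending points of B₊.
  let K := AlgebraicClosure (X.left.residueField x)
  let j : X.left.residueField x ⟶ CommRingCat.of K :=
    CommRingCat.ofHom (algebraMap (X.left.residueField x) K)
  let ρ : Y.left.presheaf.stalk y ⟶ CommRingCat.of K :=
    Y.left.presheaf.stalkSpecializes h ≫ f.left.stalkMap x ≫ X.left.residue x ≫ j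
  -- A valuation ring of K receiving a local homomorphism from the stalk at y; locality sends its
  -- closed point to y.
  obtain ⟨A, hA, hA_local⟩ := IsLocalRing.exists_factor_valuationRing ρ.hom
  let ρA : Y.left.presheaf.stalk y ⟶ .of A := CommRingCat.ofHom (ρ.hom.codRestrict _ hA)
  let vl : Spec (CommRingCat.of A) ⟶ Y.left := Spec.map ρA ≫ Y.left.fromSpecStalk y
  let bl : Spec (CommRingCat.of K) ⟶ X.left := Spec.map j ≫ X.left.fromSpecResidueField x
  have w : bl ≫ f.left = Spec.map (CommRingCat.ofHom (algebraMap A K)) ≫ vl := by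
    simp only [bl, vl]
    rw [Scheme.fromSpecResidueField, Category.assoc, Category.assoc,
      ← Scheme.SpecMap_stalkMap_fromSpecStalk,
      ← Scheme.SpecMap_stalkSpecializes_fromSpecStalk h]
    simp_rw [← Spec.map_comp_assoc]
    rfl
  refine ⟨A, K, inferInstance, inferInstance, inferInstance, inferInstance, inferInstance,
    inferInstance, inferInstance, vl ≫ Y.hom, Over.homMk bl ?_, Over.homMk vl, ?_, ?_, ?_⟩
  · change bl ≫ X.hom = _ ≫ _ ≫ _
    rw [← Over.w f, ← Category.assoc, w, Category.assoc]
  · ext1; exact w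
  · exact X.left.fromSpecResidueField_apply x _
  · change vl _ = y
    have : Spec.map ρA (IsLocalRing.closedPoint A) = IsLocalRing.closedPoint (Y.left.presheaf.stalk y) :=
      IsLocalRing.comap_closedPoint (S := A) (ρ.hom.codRestrict A.toSubring hA)
    change Y.left.fromSpecStalk y (Spec.map ρA _) = y
    rw [this, Y.left.fromSpecStalk_closedPoint]

namespace Center

open QuotientStack.WeightedBlowup (toAtlas)

variable (hJ : 𝒴.IsInvariantCenter J)

lemma quasiCompact_toAtlas (h𝒴 : IsSmoothVariety 𝒴.atlas) : QuasiCompact (toAtlas J).left := by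
  have := (J.isSmoothVariety_puncturedCone h𝒴).quasiCompact
  have := h𝒴.separated
  have : QuasiCompact ((toAtlas J).left ≫ 𝒴.atlas.hom) := by rw [Over.w]; infer_instance
  exact QuasiCompact.of_comp _ 𝒴.atlas.hom

/-- A specialization of f(c) is traced by a valuation ring. The K-point c, translated by 𝔾_m,
extends to an R-point of B₊ over the given one. The translate stays in C by invariance and the
closed point does by closedness, so the specialization lies in the image. -/
lemma isClosed_image_of_invariant (h𝒴 : IsSmoothVariety 𝒴.atlas) {P P₁ : Sch k}
    {p : P ⟶ J.puncturedCone} {f : P ⟶ P₁} {p₁ : P₁ ⟶ 𝒴.atlas}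
    (sq : IsPullback p f (toAtlas J) p₁) {C : Set P.left} (hC : IsClosed C)
    (hinv : ∀ {S : Sch k} (c : Γ(S.left, ⊤)ˣ) (b b' : S ⟶ P),
      b' ≫ p = (puncturedConeAction hJ).smul (Fin.cons c 1) (b ≫ p) → b' ≫ f = b ≫ f →
      b.left ⁻¹' C = b'.left ⁻¹' C) : IsClosed (f.left '' C) := by
  have := quasiCompact_toAtlas (J := J) h𝒴
  have : QuasiCompact f.left :=
    MorphismProperty.of_isPullback (P := @QuasiCompact) (isPullback_left sq) inferInstance
  refine isClosed_image_of_stableUnderSpecialization f.left hC ?_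
  rintro _ y hxy ⟨c, hc, rfl⟩
  obtain ⟨R, K, _, _, _, _, _, _, _, a, b, v, hbv, hb, hv⟩ := exists_valuationRing_of_specializes f hxy
  obtain ⟨t, β, hβ, hβv⟩ := exists_extension hJ a (b ≫ p) (v ≫ p₁) (by
    rw [Category.assoc, sq.w, ← Category.assoc, hbv, Category.assoc])
  let z : Over.mk a ⟶ P := sq.lift β v hβv
  have h1 := hinv t b (genericPoint a K ≫ z) (by
    rw [Category.assoc, sq.lift_fst, hβ]) (by rw [Category.assoc, sq.lift_snd, hbv])
  have h2 : IsLocalRing.closedPoint K ∈ (genericPoint a K ≫ z).left ⁻¹' C := by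
    exact h1.subset ((congrArg (· ∈ C) hb).mpr hc)
  have h3 : z.left (IsLocalRing.closedPoint R) ∈ C :=
    ((IsLocalRing.specializes_closedPoint (R := R) _).map z.left.continuous).mem_closed hC h2
  refine ⟨_, h3, ?_⟩
  have h4 : z ≫ f = v := sq.lift_snd _ _ _
  rw [← hv, ← h4]
  rfl

end Center

lemma QuotientStack.Morphism.smul_hom {Y : Sch k} (π : 𝒴.Morphism Y) {S : Sch k}
    (t : Fin 𝒴.rank → Γ(S.left, ⊤)ˣ) (u : S ⟶ 𝒴.atlas) : 𝒴.action.smul t u ≫ π.hom = u ≫ π.hom := by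
  obtain ⟨a, ha, rfl⟩ := 𝒴.exists_arrow t u
  rw [← ha, ← comp_target, Category.assoc, Category.assoc, π.invariant]

lemma exists_preimage_of_isPullback {P X Y Z : Sch k} {p : P ⟶ X} {q : P ⟶ Y} {f : X ⟶ Z} {g : Y ⟶ Z}
    (h : IsPullback p q f g) {x : X.left} {y : Y.left} (hxy : f.left x = g.left y) :
    ∃ z : P.left, p.left z = x ∧ q.left z = y := by
  obtain ⟨z, hz, hz'⟩ := Scheme.Pullback.exists_preimage_pullback x y hxy
  refine ⟨(isPullback_left h).isoPullback.inv z, ?_, ?_⟩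
  · rw [← hz, ← Scheme.Hom.comp_apply, IsPullback.isoPullback_inv_fst]
  · rw [← hz', ← Scheme.Hom.comp_apply, IsPullback.isoPullback_inv_snd]

namespace Center

open QuotientStack.WeightedBlowup (toAtlas)

variable (hJ : 𝒴.IsInvariantCenter J) {Y : Sch k} (π : 𝒴.Morphism Y)

/-- The composite of the weighted blowup with a morphism to a `k`-scheme. -/
def blowupMorphism : (weightedBlowup hJ).stack.Morphism Y where
  hom := toAtlas J ≫ π.hom
  invariant := by
    rw [QuotientStack.target_eq]
    have h := (weightedBlowup hJ).smul_toAtlas (weightedBlowup hJ).stack.arrowUnits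
      (weightedBlowup hJ).stack.source
    exact (Category.assoc _ _ _).symm.trans
      (((congrArg (· ≫ π.hom) h).trans (π.smul_hom _ _)).symm.trans (Category.assoc _ _ _))

/-- To move a point of f(C) by t, base change to where b lifts to P and act on the lift by (1, t).
The translate lies over b' and, by invariance, still meets C at the relevant point. -/
lemma subset_preimage_of_invariant {P P₁ Z : Sch k}
    {p : P ⟶ J.puncturedCone} {f : P ⟶ P₁} {p₁ : P₁ ⟶ 𝒴.atlas} {q₁ : P₁ ⟶ Z}
    (sq : IsPullback p f (toAtlas J) p₁) {C : Set P.left}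
    (hinv : ∀ {S : Sch k} (t : Fin (𝒴.rank + 1) → Γ(S.left, ⊤)ˣ) (b b' : S ⟶ P),
      b' ≫ p = (puncturedConeAction hJ).smul t (b ≫ p) → b' ≫ f ≫ q₁ = b ≫ f ≫ q₁ →
      b.left ⁻¹' C = b'.left ⁻¹' C) {S : Sch k} (t : Fin 𝒴.rank → Γ(S.left, ⊤)ˣ) (b b' : S ⟶ P₁)
    (hb : b' ≫ p₁ = 𝒴.action.smul t (b ≫ p₁)) (hb' : b' ≫ q₁ = b ≫ q₁) :
    b.left ⁻¹' (f.left '' C) ⊆ b'.left ⁻¹' (f.left '' C) := by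
  rintro s ⟨c, hc, hcs⟩
  let β := pullback.fst b f
  let γ := pullback.snd b f
  have hβγ : β ≫ b = γ ≫ f := pullback.condition
  obtain ⟨w, hw, hw'⟩ := exists_preimage_of_isPullback (IsPullback.of_hasPullback b f) hcs.symm
  let γ' : pullback b f ⟶ P := sq.lift
    ((puncturedConeAction hJ).smul (Fin.cons 1 (pullbackUnits β t)) (γ ≫ p)) (β ≫ b') (by
      refine ((weightedBlowup hJ).smul_toAtlas _ (γ ≫ p)).trans ?_
      rw [Category.assoc, Category.assoc, sq.w, hb, 𝒴.action.comp_smul, ← Category.assoc γ f p₁, ← hβγ,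
        Category.assoc]
      rfl)
  have h3 : γ' ≫ f = β ≫ b' := sq.lift_snd _ _ _
  have h1 := hinv _ γ γ' (sq.lift_fst _ _ _) (by
    rw [← Category.assoc, h3, Category.assoc, hb', ← Category.assoc, hβγ, Category.assoc])
  have h2 : γ'.left w ∈ C := h1.subset ((congrArg (· ∈ C) hw').mpr hc)
  refine ⟨_, h2, ?_⟩
  rw [← Scheme.Hom.comp_apply, ← Over.comp_left, h3, ← hw]
  rfl

/-- Closed images are obtained in two stages: the image of C over the atlas of 𝒴 is closed because
only 𝔾_m is divided out, and being invariant under the old torus it has closed image in Z by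
properness of π. The relative diagonal, followed by a monomorphism into the absolute product, is the
diagonal of the blowup, so it is proper. -/
theorem isProper_blowupMorphism [CharZero k] (h𝒴 : 𝒴.IsSmoothDM) (hπ : π.IsProper) :
    (blowupMorphism hJ π).IsProper where
  quasiCompact := by
    have := quasiCompact_toAtlas (J := J) h𝒴.atlas
    have := hπ.quasiCompact
    change QuasiCompact ((toAtlas J).left ≫ π.hom.left)
    infer_instance
  finiteType := by
    have := (J.isSmoothVariety_puncturedCone h𝒴.atlas).smooth
    have h1 : LocallyOfFiniteType J.puncturedCone.hom := inferInstance
    have : LocallyOfFiniteType ((blowupMorphism hJ π).hom.left ≫ Y.hom) := by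
      rw [Over.w]; exact h1
    exact locallyOfFiniteType_of_comp _ Y.hom
  separated := by
    have h1 := (isSmoothDM_weightedBlowup hJ h𝒴).separated
    let ρ := blowupMorphism hJ π
    let j : pullback ρ.hom ρ.hom ⟶ _ := prod.lift (pullback.fst ρ.hom ρ.hom) (pullback.snd ρ.hom ρ.hom)
    have hj : Mono j := ⟨fun g h e ↦ by
      have e1 := congrArg (· ≫ prod.fst) e
      have e2 := congrArg (· ≫ prod.snd) e
      simp only [j, Category.assoc, prod.lift_fst, prod.lift_snd] at e1 e2
      exact pullback.hom_ext e1 e2⟩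
    have hd : ρ.diagonal ≫ j = prod.lift (weightedBlowup hJ).stack.source
        (weightedBlowup hJ).stack.target := by
      rw [prod.comp_lift, QuotientStack.Morphism.diagonal, pullback.lift_fst, pullback.lift_snd]
    have : IsProper (ρ.diagonal.left ≫ j.left) := by
      rw [← Over.comp_left, hd]; exact h1
    have : Mono j.left := inferInstance
    exact IsProper.of_comp _ j.left
  universallyClosed := by
    intro P Z p q g sq C hC hinv
    let f : P ⟶ pullback π.hom g := pullback.lift (p ≫ toAtlas J) q (by
      exact (Category.assoc _ _ _).trans sq.w)
    have hfq : f ≫ pullback.snd π.hom g = q := pullback.lift_snd _ _ _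
    have sq₁ : IsPullback p f (toAtlas J) (pullback.fst π.hom g) := by
      refine (IsPullback.of_right (h₁₂ := pullback.snd π.hom g) (v₁₃ := g) (h₂₂ := π.hom) ?_ ?_
        (IsPullback.of_hasPullback π.hom g).flip).flip
      · rw [hfq]; exact sq.flip
      · exact pullback.lift_fst _ _ _
    have hinv' {S : Sch k} (t : Fin (𝒴.rank + 1) → Γ(S.left, ⊤)ˣ) (b b' : S ⟶ P)
        (hb : b' ≫ p = (puncturedConeAction hJ).smul t (b ≫ p))
        (hb' : b' ≫ f ≫ pullback.snd π.hom g = b ≫ f ≫ pullback.snd π.hom g) :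
        b.left ⁻¹' C = b'.left ⁻¹' C :=
      hinv t b b' hb (by rwa [hfq] at hb')
    have h1 := isClosed_image_of_invariant hJ h𝒴.atlas sq₁ hC (fun c b b' hb hb' ↦
      hinv' _ b b' hb (by rw [← Category.assoc, hb', Category.assoc]))
    have h2 := hπ.universallyClosed _ _ g (IsPullback.of_hasPullback π.hom g) _ h1
      fun t b b' hb hb' ↦ (subset_preimage_of_invariant hJ sq₁ hinv' t b b' hb hb').antisymm
        (subset_preimage_of_invariant hJ sq₁ hinv' t⁻¹ b' b (by
          rw [hb, ← 𝒴.action.mul_smul, inv_mul_cancel, 𝒴.action.one_smul]) hb'.symm)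
    rw [← Set.image_comp, ← TopCat.coe_comp, ← Scheme.Hom.comp_base, ← Over.comp_left, hfq] at h2
    exact h2

end Center

end

/-! ### The blowup away from its center -/

section

lemma smooth_of_forall_exists {X Y : Scheme.{u}} (f : X ⟶ Y)
    (h : ∀ x : X, ∃ (W : Scheme.{u}) (j : W ⟶ X) (_ : IsOpenImmersion j), x ∈ Set.range j ∧
      Smooth (j ≫ f)) : Smooth f := by
  choose W j hj hx hs using h
  have hO : IsOpenCover fun x ↦ (j x).opensRange :=
    IsOpenCover.mk (eq_top_iff.mpr fun x _ ↦ Opens.mem_iSup.mpr ⟨x, hx x⟩)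
  refine (isZariskiLocalAtSource_smooth.iff_of_iSup_eq_top _ hO.iSup_eq_top).mpr fun x ↦ ?_
  have h1 : (j x).opensRange.ι = (j x).isoOpensRange.inv ≫ j x := by
    rw [Iso.eq_inv_comp, Scheme.Hom.isoOpensRange_hom_ι]
  rw [h1, Category.assoc]
  have := hs x
  infer_instance

lemma smooth_of_comp_isOpenImmersion {X Y Z : Scheme.{u}} (f : X ⟶ Y) (g : Y ⟶ Z)
    [IsOpenImmersion g] (h : Smooth (f ≫ g)) : Smooth f := by
  have h1 : IsPullback f (𝟙 X) g (f ≫ g) := by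
    simpa using (IsPullback.id_vert f).paste_horiz (IsKernelPair.id_of_mono g)
  exact MorphismProperty.of_isPullback h1.flip h

lemma of_morphismRestrict_le {P : MorphismProperty Scheme.{u}} [P.IsStableUnderBaseChange]
    {X Y : Scheme.{u}} (f : X ⟶ Y) {V W : Y.Opens} (h : W ≤ V) (hP : P (f ∣_ V)) : P (f ∣_ W) := by
  have h1 : IsPullback (f ∣_ W) (X.homOfLE (f.preimage_mono h)) (Y.homOfLE h) (f ∣_ V) := by
    refine IsPullback.of_right (h₁₂ := (f ⁻¹ᵁ V).ι) (h₂₂ := V.ι) ?_ (morphismRestrict_homOfLE f W V h).symm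
      (isPullback_morphismRestrict f V).flip |>.flip
    simpa using (isPullback_morphismRestrict f W).flip
  exact P.of_isPullback h1.flip hP

variable {k : Type u} [Field k] {𝒴 : QuotientStack k}

namespace Center

open QuotientStack.WeightedBlowup (toAtlas parameter)

section

variable {Y : Sch k} (J : Center Y)

/-- On a chart {s ≠ 0} is Spec A[T, T⁻¹], and σ is there the projection to Spec A. -/
lemma exists_smooth_toBase {x : J.normalCone} (hx : x ∈ J.normalCone.basicOpen J.exceptional) :
    ∃ (W : Scheme.{u}) (j : W ⟶ J.normalCone) (_ : IsOpenImmersion j), x ∈ Set.range j ∧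
      Smooth (j ≫ J.toBase) := by
  obtain ⟨U, hU⟩ := IdealFiltration.exists_mem_affine (J.toBase x)
  obtain ⟨p, rfl⟩ : x ∈ (J.chart U).opensRange := by
    rw [← IdealFiltration.toBase_preimage]; exact hU
  obtain ⟨q, rfl⟩ := exists_point_of_notMem_exceptional p ((J.mem_basicOpen_exceptional U p).mp hx)
  have hC := (smoothOfRelativeDimension_specMap
    (isStandardSmoothOfRelativeDimension_laurentC Γ(Y.left, U.1))).smooth
  have hsub : IsOpenImmersion (Spec.map (CommRingCat.ofHom (J.sections U).extendedRees.subtype)) := by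
    let _ := (J.sections U).extendedRees.subtype.toAlgebra
    have := (J.sections U).isLocalization_subtype
    exact IsOpenImmersion.of_isLocalization (J.sections U).exceptional
  have hfrom : IsOpenImmersion U.2.fromSpec := U.2.isOpenImmersion_fromSpec
  have hbase : (Spec.map (CommRingCat.ofHom (J.sections U).extendedRees.subtype) ≫ J.chart U) ≫
      J.toBase = Spec.map (CommRingCat.ofHom C) ≫ U.2.fromSpec := by
    rw [Category.assoc, J.chart_toBase, ← Category.assoc, ← Spec.map_comp]
    rfl
  refine ⟨_, Spec.map (CommRingCat.ofHom (J.sections U).extendedRees.subtype) ≫ J.chart U,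
    inferInstance, ⟨q, rfl⟩, ?_⟩
  rw [hbase]
  infer_instance

/-- Away from the zero locus of the center, `B` is `{s ≠ 0}`. -/
lemma exists_monomial_of_notMem_zeroLocus {x : J.normalCone} (hx : J.toBase x ∉ J.zeroLocus) :
    x ∈ J.normalCone.basicOpen J.exceptional ∧ x ∈ J.awayFromVertex := by
  obtain ⟨U, hU⟩ := IdealFiltration.exists_mem_affine (J.toBase x)
  obtain ⟨p, rfl⟩ : x ∈ (J.chart U).opensRange := by
    rw [← IdealFiltration.toBase_preimage]; exact hU
  replace hx := mt (J.toBase_mem_zeroLocus U p).mpr hx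
  push Not at hx
  obtain ⟨f, hf, hfp⟩ := hx
  rw [← (J.sections U).monomial_mul_exceptional_pow 1 f hf, pow_one] at hfp
  exact ⟨(J.mem_basicOpen_exceptional U p).mpr fun h ↦ hfp (Ideal.mul_mem_left _ _ h),
    (J.chart_mem_awayFromVertex U p).mpr ⟨0, f, hf, fun h ↦ hfp (Ideal.mul_mem_right _ _ h)⟩⟩

end

variable {J : Center 𝒴.atlas}

lemma mem_basicOpen_parameter {x : J.puncturedCone.left} (hx : (toAtlas J).left x ∉ J.zeroLocus) :
    x ∈ J.puncturedCone.left.basicOpen (parameter J) := by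
  have := Scheme.preimage_basicOpen_top J.puncturedConeι.left J.exceptional
  exact this.le (J.exists_monomial_of_notMem_zeroLocus (x := J.puncturedConeι.left x) hx).1

lemma smooth_toAtlas_restrict {W : 𝒴.atlas.left.Opens} (hW : ∀ u ∈ W, u ∉ J.zeroLocus) :
    Smooth ((toAtlas J).left ∣_ W) := by
  refine smooth_of_comp_isOpenImmersion _ W.ι ?_
  rw [morphismRestrict_ι]
  refine smooth_of_forall_exists _ fun x ↦ ?_
  obtain ⟨Z, j, hj, hx, hs⟩ := J.exists_smooth_toBase (x := J.puncturedConeι.left x.1)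
    (J.exists_monomial_of_notMem_zeroLocus (hW _ x.2)).1
  let i : ((toAtlas J).left ⁻¹ᵁ W).toScheme ⟶ J.normalCone :=
    ((toAtlas J).left ⁻¹ᵁ W).ι ≫ J.awayFromVertex.ι
  have hi : ((toAtlas J).left ⁻¹ᵁ W).ι ≫ (toAtlas J).left = i ≫ J.toBase := rfl
  have h1 : IsOpenImmersion J.puncturedConeι.left := inferInstance
  have : IsOpenImmersion i := @IsOpenImmersion.comp _ _ _ ((toAtlas J).left ⁻¹ᵁ W).ι
    J.puncturedConeι.left inferInstance h1
  refine ⟨pullback i j, pullback.fst i j, inferInstance, ?_, ?_⟩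
  · obtain ⟨y, hy⟩ := hx
    obtain ⟨z, hz, -⟩ := Scheme.Pullback.exists_preimage_pullback (f := i) (g := j) x y hy.symm
    exact ⟨z, hz⟩
  · rw [hi, ← Category.assoc, pullback.condition, Category.assoc]
    exact smooth_comp (pullback.snd i j) (j ≫ J.toBase)

/-- Away from the zero locus, the blowup has a section with `s = 1`. -/
lemma exists_section {S : Sch k} (u : S ⟶ 𝒴.atlas) (hu : ∀ z, u.left z ∉ J.zeroLocus) :
    ∃ b : S ⟶ J.puncturedCone, b ≫ toAtlas J = u := by
  obtain ⟨b, hb, -⟩ := J.exists_lift_toBase u.left 1 (.of_isUnit isUnit_one) fun z ↦ by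
    obtain ⟨U, hU⟩ := IdealFiltration.exists_mem_affine (u.left z)
    let O : S.left.Opens := u.left ⁻¹ᵁ U.1
    obtain ⟨g, hg⟩ := IdealFiltration.exists_eq_toSpec_fromSpec (O.ι ≫ u.left) U fun x ↦ x.2
    refine ⟨U, O, g, hU, hg, fun n f _ ↦ ?_⟩
    rw [map_one, one_pow]
    exact one_dvd _
  have hr : Set.range b ⊆ Set.range J.puncturedConeι.left := by
    rintro _ ⟨z, rfl⟩
    have h1 : J.toBase (b z) ∉ J.zeroLocus := by
      have := hu z
      rwa [← hb] at this
    exact ⟨⟨_, (J.exists_monomial_of_notMem_zeroLocus h1).2⟩, rfl⟩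
  have hfac := IsOpenImmersion.lift_fac J.puncturedConeι.left b hr
  refine ⟨Over.homMk (IsOpenImmersion.lift J.puncturedConeι.left b hr) ?_, ?_⟩
  · rw [← Over.w J.puncturedConeι, ← Category.assoc, hfac]
    refine (Category.assoc _ _ _).symm.trans ?_
    exact (congrArg (· ≫ 𝒴.atlas.hom) hb).trans (Over.w u)
  · ext1
    exact (congrArg (· ≫ J.toBase) hfac).trans hb

lemma isUnit_parameter {S : Sch k} (b : S ⟶ J.puncturedCone)
    (hb : ∀ z, (b ≫ toAtlas J).left z ∉ J.zeroLocus) : IsUnit (b.left.appTop (parameter J)) := by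
  refine isUnit_of_basicOpen_eq_top (eq_top_iff.mpr fun z _ ↦ ?_)
  rw [← Scheme.preimage_basicOpen_top]
  exact mem_basicOpen_parameter (hb z)

lemma puncturedCone_hom_ext_of_isUnit {S : Sch k} {b b' : S ⟶ J.puncturedCone}
    (h : b ≫ toAtlas J = b' ≫ toAtlas J)
    (hs : b.left.appTop (parameter J) = b'.left.appTop (parameter J))
    (hu : IsUnit (b.left.appTop (parameter J))) : b = b' := by
  refine puncturedCone_hom_ext (hom_ext_of_regular ?_ ?_ ?_)
  · refine .of_isUnit ?_
    exact (appTop_comp_apply b.left J.puncturedConeι.left J.exceptional) ▸ hu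
  · exact (Category.assoc _ _ _).trans (h.trans (Category.assoc _ _ _).symm)
  · exact (appTop_comp_apply b.left J.puncturedConeι.left J.exceptional).trans
      (hs.trans (appTop_comp_apply b'.left J.puncturedConeι.left J.exceptional).symm)

end Center

end

/-! ### The blowup is an isomorphism off the image of the center -/

section

variable {k : Type u} [Field k] {𝒴 : QuotientStack k} {J : Center 𝒴.atlas}

/-- A morphism is an isomorphism over an open `N` iff it induces a bijection on points over `N`. -/
lemma isIso_morphismRestrict_iff {A Q : Sch k} (D : A ⟶ Q) (N : Q.left.Opens) :
    IsIso (D.left ∣_ N) ↔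
      ∀ (T : Sch k) (g : T ⟶ Q), (∀ z, g.left z ∈ N) → ∃! a : T ⟶ A, a ≫ D = g := by
  constructor
  · intro h T g hg
    have hr : Set.range g.left ⊆ Set.range N.ι := by
      rintro _ ⟨z, rfl⟩
      rw [Scheme.Opens.range_ι]; exact hg z
    let g₁ := IsOpenImmersion.lift N.ι g.left hr
    have hg₁ : g₁ ≫ N.ι = g.left := IsOpenImmersion.lift_fac _ _ _
    let a := g₁ ≫ inv (D.left ∣_ N) ≫ (D.left ⁻¹ᵁ N).ι
    have ha : a ≫ D.left = g.left := by
      rw [Category.assoc, Category.assoc, ← morphismRestrict_ι, IsIso.inv_hom_id_assoc, hg₁]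
    refine ⟨Over.homMk a ?_, ?_, ?_⟩
    · rw [← Over.w D, ← Category.assoc, ha, Over.w]
    · ext1; exact ha
    · intro a' ha'
      ext1
      have hl := congrArg CommaMorphism.left ha'
      have sq := isPullback_morphismRestrict D.left N
      have h1 : sq.lift g₁ a'.left (hg₁.trans hl.symm) = g₁ ≫ inv (D.left ∣_ N) := by
        rw [IsIso.eq_comp_inv, sq.lift_fst]
      have h2 := sq.lift_snd g₁ a'.left (hg₁.trans hl.symm)
      rw [h1, Category.assoc] at h2
      exact h2.symm
  · intro h
    let S : Sch k := Over.mk (N.ι ≫ Q.hom)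
    let n : S ⟶ Q := Over.homMk N.ι
    obtain ⟨e, he, -⟩ := h S n fun z ↦ z.2
    have hel : e.left ≫ D.left = N.ι := congrArg CommaMorphism.left he
    have sq := isPullback_morphismRestrict D.left N
    let i := sq.lift (𝟙 N.toScheme) e.left ((Category.id_comp _).trans hel.symm)
    have hi : i ≫ D.left ∣_ N = 𝟙 _ := sq.lift_fst _ _ _
    have hi' : i ≫ (D.left ⁻¹ᵁ N).ι = e.left := sq.lift_snd _ _ _
    refine ⟨i, ?_, hi⟩
    rw [← cancel_mono (D.left ⁻¹ᵁ N).ι, Category.assoc, hi', Category.id_comp]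
    let S' : Sch k := Over.mk ((D.left ⁻¹ᵁ N).ι ≫ A.hom)
    let n' : S' ⟶ A := Over.homMk (D.left ⁻¹ᵁ N).ι
    let e' : S' ⟶ A := Over.homMk (D.left ∣_ N ≫ e.left) (by
      change (D.left ∣_ N ≫ e.left) ≫ A.hom = (D.left ⁻¹ᵁ N).ι ≫ A.hom
      rw [← Over.w D, ← Category.assoc, ← Category.assoc, Category.assoc (D.left ∣_ N), hel,
        morphismRestrict_ι])
    have h1 : e' ≫ D = n' ≫ D := by
      ext1
      change (D.left ∣_ N ≫ e.left) ≫ D.left = (D.left ⁻¹ᵁ N).ι ≫ D.left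
      rw [Category.assoc, hel, morphismRestrict_ι]
    exact congrArg CommaMorphism.left ((h S' (n' ≫ D) fun z ↦ z.2).unique h1 rfl)

namespace Center

open QuotientStack.WeightedBlowup (toAtlas parameter)

variable (hJ : 𝒴.IsInvariantCenter J) {Y : Sch k} (π : 𝒴.Morphism Y)

/-- The isomorphism condition on the diagonal in terms of points: two points over V with the same
image differ by a unique element of the torus. `isIso_diagonal_of_existsUnique` is the converse. -/
lemma existsUnique_comp_diagonal {V : Y.left.Opens}
    (hπ : IsIso (π.diagonal.left ∣_ ((pullback.fst π.hom π.hom ≫ π.hom).left ⁻¹ᵁ V)))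
    {T : Sch k} (b b' : T ⟶ 𝒴.atlas) (h : b ≫ π.hom = b' ≫ π.hom)
    (hb : ∀ z, (b ≫ π.hom).left z ∈ V) :
    ∃! t : Fin 𝒴.rank → Γ(T.left, ⊤)ˣ, 𝒴.action.smul t b = b' := by
  have hγ : pullback.lift b b' h ≫ pullback.fst π.hom π.hom ≫ π.hom = b ≫ π.hom := by
    rw [pullback.lift_fst_assoc]
  obtain ⟨a, ha, huniq⟩ := (isIso_morphismRestrict_iff _ _).mp hπ T (pullback.lift b b' h)
    fun z ↦ by
      have := hb z
      rw [← hγ] at this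
      exact this
  have h1 : a ≫ 𝒴.source = b := by
    rw [← pullback.lift_fst b b' h, ← ha, Category.assoc, QuotientStack.Morphism.diagonal,
      pullback.lift_fst]
  have h2 : a ≫ 𝒴.target = b' := by
    rw [← pullback.lift_snd b b' h, ← ha, Category.assoc, QuotientStack.Morphism.diagonal,
      pullback.lift_snd]
  refine ⟨pullbackUnits a 𝒴.arrowUnits, ?_, fun t ht ↦ ?_⟩
  · dsimp only
    rw [← h1, ← 𝒴.comp_target, h2]
  · obtain ⟨a', ha', hb'⟩ := 𝒴.exists_arrow t b
    rw [← ha', huniq a' (pullback.hom_ext ?_ ?_)]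
    · rw [Category.assoc, QuotientStack.Morphism.diagonal, pullback.lift_fst, pullback.lift_fst, hb']
    · rw [Category.assoc, QuotientStack.Morphism.diagonal, pullback.lift_snd, pullback.lift_snd,
        𝒴.comp_target, ha', hb', ht]

lemma isIso_diagonal_of_existsUnique {V : Y.left.Opens}
    (h : ∀ (T : Sch k) (b b' : T ⟶ 𝒴.atlas), b ≫ π.hom = b' ≫ π.hom →
      (∀ z, (b ≫ π.hom).left z ∈ V) →
      ∃! t : Fin 𝒴.rank → Γ(T.left, ⊤)ˣ, 𝒴.action.smul t b = b') :
    IsIso (π.diagonal.left ∣_ ((pullback.fst π.hom π.hom ≫ π.hom).left ⁻¹ᵁ V)) := by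
  refine (isIso_morphismRestrict_iff _ _).mpr fun T g hg ↦ ?_
  obtain ⟨t, ht, huniq⟩ := h T (g ≫ pullback.fst _ _) (g ≫ pullback.snd _ _)
    (by rw [Category.assoc, Category.assoc, pullback.condition])
    (fun z ↦ by rw [Category.assoc]; exact hg z)
  obtain ⟨a, ha, hb⟩ := 𝒴.exists_arrow t (g ≫ pullback.fst _ _)
  refine ⟨a, pullback.hom_ext ?_ ?_, fun a' ha' ↦ ?_⟩
  · rw [Category.assoc, QuotientStack.Morphism.diagonal, pullback.lift_fst, hb]
  · rw [Category.assoc, QuotientStack.Morphism.diagonal, pullback.lift_snd, 𝒴.comp_target, ha, hb, ht]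
  · have h1 : a' ≫ 𝒴.source = g ≫ pullback.fst _ _ := by
      rw [← ha', Category.assoc, QuotientStack.Morphism.diagonal, pullback.lift_fst]
    have h2 : a' ≫ 𝒴.target = g ≫ pullback.snd _ _ := by
      rw [← ha', Category.assoc, QuotientStack.Morphism.diagonal, pullback.lift_snd]
    refine QuotientStack.arrow_ext ?_ (h1.trans hb.symm)
    rw [ha]
    refine huniq _ ?_
    dsimp only
    rw [← h1, ← 𝒴.comp_target, h2]

/-- Off V(J̄) the function s is a unit on B₊, and a point of B₊ is a point of the old atlas with an
arbitrary unit as value of s. So B₊ is there a 𝔾_m-torsor over an open part of the old atlas, which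
is itself a torsor over V'. -/
theorem isIsoOver_blowupMorphism {V V' : Y.left.Opens} (hV : V' ≤ V) (hπ : π.IsIsoOver V)
    (hV' : ∀ u, π.hom.left u ∈ V' → u ∉ J.zeroLocus) : (blowupMorphism hJ π).IsIsoOver V' where
  smooth := by
    have h1 : Smooth ((toAtlas J).left ∣_ (π.hom.left ⁻¹ᵁ V')) := smooth_toAtlas_restrict hV'
    have h2 : Smooth (π.hom.left ∣_ V') := of_morphismRestrict_le _ hV hπ.smooth
    change Smooth (((toAtlas J).left ≫ π.hom.left) ∣_ V')
    rw [morphismRestrict_comp]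
    have := h1
    exact smooth_comp ((toAtlas J).left ∣_ (π.hom.left ⁻¹ᵁ V')) (π.hom.left ∣_ V')
  surjective := by
    have h2 : Surjective (π.hom.left ∣_ V') := of_morphismRestrict_le _ hV hπ.surjective
    refine ⟨fun y ↦ ?_⟩
    obtain ⟨u, rfl⟩ := h2.surj y
    let S : Sch k := Over.mk ((π.hom.left ⁻¹ᵁ V').ι ≫ 𝒴.atlas.hom)
    obtain ⟨b, hb⟩ := exists_section (J := J) (S := S) (Over.homMk (π.hom.left ⁻¹ᵁ V').ι)
      fun z ↦ hV' _ z.2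
    have hbu : (toAtlas J).left (b.left u) = u.1 :=
      congrArg (fun g : S ⟶ 𝒴.atlas ↦ g.left u) hb
    have hm : ((blowupMorphism hJ π).hom.left (b.left u)) = π.hom.left u.1 :=
      congrArg π.hom.left hbu
    refine ⟨⟨b.left u, (congrArg (· ∈ V') hm).mpr u.2⟩, Subtype.ext ?_⟩
    exact (morphismRestrict_base_coe _ _ _).trans (hm.trans (morphismRestrict_base_coe _ _ _).symm)
  isIso := isIso_diagonal_of_existsUnique (blowupMorphism hJ π) fun T b b' h hb ↦ by
    change T ⟶ J.puncturedCone at b b'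
    have hb₁ (z) : ((b ≫ toAtlas J) ≫ π.hom).left z ∈ V' := hb z
    have h₁ : (b ≫ toAtlas J) ≫ π.hom = (b' ≫ toAtlas J) ≫ π.hom :=
      (Category.assoc _ _ _).trans (h.trans (Category.assoc _ _ _).symm)
    have hb₁' (z) : ((b' ≫ toAtlas J) ≫ π.hom).left z ∈ V' := by
      rw [← h₁]; exact hb₁ z
    obtain ⟨t, ht, huniq⟩ := existsUnique_comp_diagonal π hπ.isIso (b ≫ toAtlas J) (b' ≫ toAtlas J) h₁
      fun z ↦ hV (hb₁ z)
    obtain ⟨c, hc⟩ := isUnit_parameter b fun z ↦ hV' _ (hb₁ z)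
    obtain ⟨c', hc'⟩ := isUnit_parameter b' fun z ↦ hV' _ (hb₁' z)
    -- As s has weight -1, carrying the value c of s to c' requires t₀ = c / c'.
    refine ⟨(Fin.cons (c * c'⁻¹) t : Fin (𝒴.rank + 1) → Γ(T.left, ⊤)ˣ), ?_, fun t' ht' ↦ ?_⟩
    · have h2 := (weightedBlowup hJ).smul_parameter (Fin.cons (c * c'⁻¹) t) b
      have h3 : ((weightedBlowup hJ).action.smul (Fin.cons (c * c'⁻¹) t) b).left.appTop (parameter J) =
          b'.left.appTop (parameter J) := by
        rw [h2, ← hc, ← hc', Fin.cons_zero, ← Units.val_mul]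
        congr 1
        rw [mul_inv, inv_inv, mul_comm, ← mul_assoc, mul_inv_cancel, one_mul]
      refine puncturedCone_hom_ext_of_isUnit ?_ h3 ?_
      · refine ((weightedBlowup hJ).smul_toAtlas _ b).trans ?_
        rw [Fin.tail_cons]
        exact ht
      · exact (h3.trans hc'.symm) ▸ c'.isUnit
    · let τ : Fin (𝒴.rank + 1) → Γ(T.left, ⊤)ˣ := t'
      have ht₁ : (weightedBlowup hJ).action.smul τ b = b' := ht'
      have h2 := (weightedBlowup hJ).smul_parameter τ b
      have h3 := (weightedBlowup hJ).smul_toAtlas τ b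
      rw [ht₁] at h2 h3
      have h4 : Fin.tail τ = t := huniq _ h3.symm
      have h5 : τ 0 = c * c'⁻¹ := by
        rw [← hc, ← hc', ← Units.val_mul, Units.val_inj] at h2
        rw [h2, mul_inv, inv_inv, mul_comm, mul_assoc, inv_mul_cancel, mul_one]
      change τ = _
      rw [← Fin.cons_self_tail τ, h4, h5]

end Center

end

/-! ### Generic points of the blowup of X -/

section

/-- The extension of a prime to the Laurent polynomials is the smallest prime above it. -/
lemma exists_laurent_prime {A : Type u} [CommRing A] (p : PrimeSpectrum A) :
    ∃ q : PrimeSpectrum (LaurentPolynomial A), PrimeSpectrum.comap C q = p ∧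
      ∀ q' : PrimeSpectrum (LaurentPolynomial A), p ⤳ PrimeSpectrum.comap C q' → q ⤳ q' := by
  let L := LaurentPolynomial (A ⧸ p.asIdeal)
  let θ : LaurentPolynomial A →+* L :=
    AddMonoidAlgebra.mapRingHom ℤ (Ideal.Quotient.mk p.asIdeal)
  have hθ : ∀ x n, (θ x).coeff n = Ideal.Quotient.mk _ (x.coeff n) := fun x n ↦
    AddMonoidAlgebra.coeff_mapRingHom _ _ _
  have hp : p.asIdeal.IsPrime := p.2
  have hL : IsDomain L := inferInstance
  have hθ0 (x) : θ x = 0 ↔ ∀ n, x.coeff n ∈ p.asIdeal := by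
    rw [LaurentPolynomial.ext_iff]
    refine forall_congr' fun n ↦ ?_
    rw [hθ, ← Ideal.Quotient.eq_zero_iff_mem]
    rfl
  refine ⟨⟨RingHom.ker θ, RingHom.ker_isPrime θ⟩, ?_, fun q' h ↦ ?_⟩
  · ext a
    change θ (C a) = 0 ↔ _
    rw [hθ0]
    refine ⟨fun h ↦ by simpa [← T_zero] using h 0, fun h n ↦ ?_⟩
    by_cases hn : n = 0
    · subst hn; simpa using h
    · simp [hn]
  · rw [← PrimeSpectrum.le_iff_specializes] at h ⊢
    intro x hx
    have hx' := (hθ0 x).mp hx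
    have key : x = ∑ n ∈ x.coeff.support, C (x.coeff n) * T n := by
      refine LaurentPolynomial.ext fun m ↦ ?_
      simp only [← single_eq_C_mul_T, AddMonoidAlgebra.coeff_sum, Finsupp.finsetSum_apply,
        AddMonoidAlgebra.coeff_single, Finsupp.single_apply, Finset.sum_ite_eq']
      split_ifs with hm
      · rfl
      · exact Finsupp.notMem_support_iff.mp hm
    change x ∈ q'.asIdeal
    rw [key]
    exact Ideal.sum_mem _ fun n _ ↦ Ideal.mul_mem_right _ _ (h (hx' n))

variable {k : Type u} [Field k] {𝒴 : QuotientStack k}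

namespace Center

open QuotientStack.WeightedBlowup (toAtlas parameter)

section

variable {Y : Sch k} (J : Center Y)

/-- In a chart {s ≠ 0} is Spec A[T, T⁻¹]. The extension of the prime of y is the smallest prime over
it, and it is contained in all primes above specializations of y. -/
lemma exists_generic_chart (U : Y.left.AffineZariskiSite) {y : Y.left} (hy : y ∈ U.1) :
    ∃ η ∈ J.normalCone.basicOpen J.exceptional, J.toBase η = y ∧
      ∀ x ∈ J.normalCone.basicOpen J.exceptional, J.toBase x ∈ U.1 → y ⤳ J.toBase x → η ⤳ x := by
  have hfrom : IsOpenImmersion U.2.fromSpec := U.2.isOpenImmersion_fromSpec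
  obtain ⟨p, rfl⟩ : y ∈ Set.range U.2.fromSpec := by rw [U.2.range_fromSpec]; exact hy
  obtain ⟨q, hq, hqmin⟩ := exists_laurent_prime p
  have hs (q' : PrimeSpectrum (LaurentPolynomial Γ(Y.left, U.1))) :
      (J.sections U).exceptional ∉ (PrimeSpectrum.comap (J.sections U).extendedRees.subtype q').asIdeal := by
    intro h0
    have h2 : C 1 * T (-1) ∈ q'.asIdeal := h0
    rw [map_one, one_mul] at h2
    exact q'.2.ne_top (Ideal.eq_top_of_isUnit_mem _ h2 (isUnit_T _))
  have hbase (q' : PrimeSpectrum (LaurentPolynomial Γ(Y.left, U.1))) :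
      J.toBase (J.chart U (PrimeSpectrum.comap (J.sections U).extendedRees.subtype q')) =
        U.2.fromSpec (PrimeSpectrum.comap C q') := J.toBase_chart U _
  refine ⟨J.chart U (PrimeSpectrum.comap (J.sections U).extendedRees.subtype q),
    (J.mem_basicOpen_exceptional U _).mpr (hs q), (hbase q).trans (congrArg U.2.fromSpec hq), ?_⟩
  intro x hx hxU hyx
  obtain ⟨px, rfl⟩ : x ∈ (J.chart U).opensRange := by
    rw [← IdealFiltration.toBase_preimage]; exact hxU
  obtain ⟨q', rfl⟩ := exists_point_of_notMem_exceptional px ((J.mem_basicOpen_exceptional U px).mp hx)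
  rw [hbase q'] at hyx
  refine ((hqmin q' ?_).map (PrimeSpectrum.continuous_comap _)).map (J.chart U).continuous
  exact U.2.fromSpec.isOpenEmbedding.toIsInducing.specializes_iff.mp hyx

/-- The fibre of `{s ≠ 0}` over `y` has a generic point, which also specializes to every point of
`{s ≠ 0}` above a specialization of `y`. -/
lemma exists_generic (y : Y.left) :
    ∃ η ∈ J.normalCone.basicOpen J.exceptional, J.toBase η = y ∧
      ∀ x ∈ J.normalCone.basicOpen J.exceptional, y ⤳ J.toBase x → η ⤳ x := by
  obtain ⟨U, hU⟩ := IdealFiltration.exists_mem_affine y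
  obtain ⟨η, hη, hηy, hmin⟩ := J.exists_generic_chart U hU
  refine ⟨η, hη, hηy, fun x hx hyx ↦ ?_⟩
  obtain ⟨U', hU'⟩ := IdealFiltration.exists_mem_affine (J.toBase x)
  obtain ⟨η', hη', hηy', hmin'⟩ := J.exists_generic_chart U' (hyx.mem_open U'.1.2 hU')
  -- The points η and η' from two charts both lie over y, so η specializes to η', and from there to
  -- x inside the second chart.
  refine (hmin η' hη' (hηy' ▸ hU) (hηy' ▸ specializes_rfl)).trans (hmin' x hx hU' hyx)

end

variable {J : Center 𝒴.atlas}

/-- The blowup of an irreducible subvariety which is not contained in the center is irreducible. -/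
lemma exists_generic_puncturedConeTransform {X : Closeds 𝒴.atlas.left} {ξ : 𝒴.atlas.left}
    (hξ : closure {ξ} = (X : Set 𝒴.atlas.left)) (hξJ : ξ ∉ J.zeroLocus) :
    ∃ η : J.puncturedCone.left, (toAtlas J).left η = ξ ∧
      closure {η} = (J.puncturedConeTransform X : Set J.puncturedCone.left) := by
  obtain ⟨η, hη, hηξ, hmin⟩ := J.exists_generic ξ
  have hη' : η ∈ J.awayFromVertex :=
    (J.exists_monomial_of_notMem_zeroLocus (by rw [hηξ]; exact hξJ)).2
  let η₀ : J.puncturedCone.left := (⟨η, hη'⟩ : J.awayFromVertex)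
  refine ⟨η₀, hηξ, ?_⟩
  have hmem (x : J.puncturedCone.left) : x ∈ J.puncturedCone.left.basicOpen (parameter J) ↔
      J.puncturedConeι.left x ∈ J.normalCone.basicOpen J.exceptional := by
    have := Scheme.preimage_basicOpen_top J.puncturedConeι.left J.exceptional
    exact (SetLike.ext_iff.mp this x).symm
  rw [QuotientStack.WeightedBlowup.coe_puncturedConeTransform]
  refine (closure_minimal ?_ isClosed_closure).antisymm (closure_minimal ?_ isClosed_closure)
  · refine Set.singleton_subset_iff.mpr (subset_closure ⟨?_, (hmem _).mpr hη⟩)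
    change (toAtlas J).left η₀ ∈ (X : Set 𝒴.atlas.left)
    rw [show (toAtlas J).left η₀ = ξ from hηξ, ← hξ]
    exact subset_closure rfl
  · rintro x ⟨hxX, hxs⟩
    have h1 : ξ ⤳ (toAtlas J).left x := by
      rw [specializes_iff_mem_closure, hξ]; exact hxX
    have h2 := hmin _ ((hmem x).mp hxs) h1
    rw [← specializes_iff_mem_closure]
    exact J.puncturedConeι.left.isOpenEmbedding.toIsInducing.specializes_iff.mp h2

end Center

end

/-! ### Modifications and strict transforms -/

section

variable {k : Type u} [Field k] {𝒴 : QuotientStack k} {J : Center 𝒴.atlas} {Y : Sch k}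

lemma Center.isInvariant_zeroLocus (hJ : 𝒴.IsInvariantCenter J) : 𝒴.IsInvariant J.zeroLocus := by
  have h := congrArg Scheme.IdealSheafData.support (hJ 1)
  rwa [Scheme.IdealSheafData.support_comap, Scheme.IdealSheafData.support_comap] at h

namespace QuotientStack.Morphism

variable (π : 𝒴.Morphism Y)

lemma IsProper.isClosed_image (hπ : π.IsProper) {Z : Closeds 𝒴.atlas.left} (hZ : 𝒴.IsInvariant Z) :
    IsClosed (π.hom.left '' Z) :=
  hπ.universallyClosed (𝟙 _) π.hom (𝟙 Y) (IsPullback.id_horiz π.hom) Z Z.isClosed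
    fun t b b' hb _ ↦ Set.ext fun z ↦ by
      rw [Category.comp_id, Category.comp_id] at hb
      rw [hb]
      exact (hZ.mem_iff t b z).symm

/-- Over V the diagonal is onto U ×_Y U, so points with the same image lie in one orbit, and an
invariant set is a union of fibres there. -/
lemma IsIsoOver.mem_of_mem {V : Y.left.Opens} (hπ : π.IsIsoOver V) {Z : Closeds 𝒴.atlas.left}
    (hZ : 𝒴.IsInvariant Z) {x y : 𝒴.atlas.left} (hxy : π.hom.left x = π.hom.left y)
    (hV : π.hom.left x ∈ V) (hx : x ∈ Z) : y ∈ Z := by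
  obtain ⟨z, rfl, rfl⟩ := exists_preimage_of_isPullback (IsPullback.of_hasPullback π.hom π.hom) hxy
  have := hπ.isIso
  obtain ⟨a, ha⟩ := (π.diagonal.left ∣_
    ((pullback.fst π.hom π.hom ≫ π.hom).left ⁻¹ᵁ V)).surjective ⟨z, hV⟩
  have ha' : π.diagonal.left a.1 = z := (morphismRestrict_base_coe _ _ a).symm.trans (congrArg Subtype.val ha)
  have h1 : 𝒴.source.left a.1 = (pullback.fst π.hom π.hom).left z := by
    have hs : π.diagonal ≫ pullback.fst _ _ = 𝒴.source := pullback.lift_fst _ _ _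
    rw [← ha', ← Scheme.Hom.comp_apply, ← Over.comp_left, hs]
  have h2 : 𝒴.target.left a.1 = (pullback.snd π.hom π.hom).left z := by
    have hs : π.diagonal ≫ pullback.snd _ _ = 𝒴.target := pullback.lift_snd _ _ _
    rw [← ha', ← Scheme.Hom.comp_apply, ← Over.comp_left, hs]
  rw [← h2]
  rw [← h1] at hx
  have h3 : a.1 ∈ Z.preimage 𝒴.source.left.continuous := hx
  rw [← hZ] at h3
  exact h3

/-- The open part of `V` outside the image of `Z`. -/
def removeImage (V : Y.left.Opens) (hπ : π.IsProper) {Z : Closeds 𝒴.atlas.left}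
    (hZ : 𝒴.IsInvariant Z) : Y.left.Opens :=
  V ⊓ ⟨(π.hom.left '' Z)ᶜ, (hπ.isClosed_image π hZ).isOpen_compl⟩

/-- If an open O met V only inside the image of Z, the preimage of O ∩ V would lie in Z, which over
V is a union of fibres. This preimage is open and nonempty, contrary to the empty interior of Z. -/
lemma dense_removeImage {V : Y.left.Opens} (hπ : π.IsProper) {Z : Closeds 𝒴.atlas.left}
    (hZ : 𝒴.IsInvariant Z) (hV : π.IsIsoOver V) (hdense : Dense (V : Set Y.left))
    (hZint : interior (Z : Set 𝒴.atlas.left) = ∅) :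
    Dense (π.removeImage V hπ hZ : Set Y.left) := by
  rw [dense_iff_inter_open]
  intro O hO hOne
  obtain ⟨y, hyO, hyV⟩ := hdense.inter_open_nonempty O hO hOne
  by_contra hempty
  have hsub : π.hom.left ⁻¹' (O ∩ V) ⊆ Z := by
    rintro u ⟨huO, huV⟩
    have h1 : π.hom.left u ∈ π.hom.left '' Z := by
      by_contra h
      exact hempty ⟨_, huO, huV, h⟩
    obtain ⟨z, hz, hzu⟩ := h1
    exact hV.mem_of_mem π hZ hzu (hzu ▸ huV) hz
  have hopen : IsOpen (π.hom.left ⁻¹' (O ∩ V)) := (hO.inter V.2).preimage π.hom.left.continuous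
  have := hV.surjective
  obtain ⟨u, hu⟩ := (π.hom.left ∣_ V).surjective ⟨y, hyV⟩
  have hu' : π.hom.left u.1 = y := (morphismRestrict_base_coe _ _ u).symm.trans (congrArg Subtype.val hu)
  have h2 : u.1 ∈ interior (Z : Set 𝒴.atlas.left) :=
    interior_maximal hsub hopen (by rw [Set.mem_preimage, hu']; exact ⟨hyO, hyV⟩)
  rw [hZint] at h2
  exact h2

/-- The strict transform of `X`. -/
def strictTransform (X : Closeds Y.left) (V : Y.left.Opens) : Closeds 𝒴.atlas.left :=
  Closeds.closure (π.hom.left ⁻¹' ((X : Set Y.left) ∩ V))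

lemma isInvariant_strictTransform (X : Closeds Y.left) (V : Y.left.Opens) :
    𝒴.IsInvariant (π.strictTransform X V) := by
  refine SetLike.coe_injective ?_
  refine (preimage_closure_inter 𝒴.target.left _).trans
    (Eq.trans ?_ (preimage_closure_inter 𝒴.source.left _).symm)
  rw [← Set.preimage_comp, ← Set.preimage_comp, ← TopCat.coe_comp, ← TopCat.coe_comp,
    ← Scheme.Hom.comp_base, ← Scheme.Hom.comp_base, ← Over.comp_left, ← Over.comp_left, π.invariant]

end QuotientStack.Morphism

/-- A modification `π` of `Y` by a quotient stack whose atlas has dimension at most `n + r`, where `r`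
is the rank of the torus, which is an isomorphism over the generic point of `X`. -/
structure IsModification (X : Closeds Y.left) (n : ℕ) (π : 𝒴.Morphism Y) (V : Y.left.Opens) : Prop where
  isSmoothDM : 𝒴.IsSmoothDM
  dim : IsSmoothOfDimLE 𝒴.atlas (n + 𝒴.rank)
  isProper : π.IsProper
  isIsoOver : π.IsIsoOver V
  dense : Dense (V : Set Y.left)
  generic : ∃ ξ, π.hom.left ξ ∈ (X : Set Y.left) ∩ V ∧
    closure {ξ} = (π.strictTransform X V : Set 𝒴.atlas.left)

open QuotientStack.WeightedBlowup (toAtlas parameter) in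
open QuotientStack.Morphism Center in
-- The center lies properly inside the irreducible strict transform, so it misses the generic point
-- ξ and has empty interior; removing its image from V leaves a dense open set containing the image
-- of ξ. The new strict transform and the blowup of the old one are both the closure of the generic
-- point η over ξ.
lemma IsModification.blowup [CharZero k] {X : Closeds Y.left} {n : ℕ} {π : 𝒴.Morphism Y}
    {V : Y.left.Opens} (h : IsModification X n π V) (hJ : 𝒴.IsInvariantCenter J)
    (hZ : (J.zeroLocus : Set 𝒴.atlas.left) ⊂ π.strictTransform X V) :
    ∃ V' : Y.left.Opens, IsModification X n (blowupMorphism hJ π) V' ∧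
      (blowupMorphism hJ π).strictTransform X V' = J.puncturedConeTransform (π.strictTransform X V) := by
  obtain ⟨ξ, hξ, hcl⟩ := h.generic
  have hinv := isInvariant_zeroLocus hJ
  have hξZ : ξ ∉ J.zeroLocus := fun hmem ↦ hZ.2 (by
    rw [← hcl]; exact closure_minimal (Set.singleton_subset_iff.mpr hmem) J.zeroLocus.isClosed)
  have hint : interior (J.zeroLocus : Set 𝒴.atlas.left) = ∅ := by
    refine Set.eq_empty_iff_forall_notMem.mpr fun u hu ↦ hξZ ?_
    have h1 : u ∈ closure {ξ} := by
      rw [hcl]; exact hZ.1 (interior_subset hu)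
    exact interior_subset ((specializes_iff_mem_closure.mpr h1).mem_open isOpen_interior hu)
  let V' := π.removeImage V h.isProper hinv
  have hV' : ∀ u, π.hom.left u ∈ V' → u ∉ J.zeroLocus := fun u hu hmem ↦ hu.2 ⟨u, hmem, rfl⟩
  have hξV' : π.hom.left ξ ∈ V' := ⟨hξ.2, by
    rintro ⟨z, hz, hzξ⟩
    exact hξZ (h.isIsoOver.mem_of_mem π hinv hzξ (hzξ ▸ hξ.2) hz)⟩
  obtain ⟨η, hη, hηcl⟩ := exists_generic_puncturedConeTransform hcl hξZ
  have hπη : (blowupMorphism hJ π).hom.left η ∈ (X : Set Y.left) ∩ V' := by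
    have h1 : (blowupMorphism hJ π).hom.left η = π.hom.left ξ := congrArg π.hom.left hη
    rw [h1]
    exact ⟨hξ.1, hξV'⟩
  have heq : (blowupMorphism hJ π).strictTransform X V' =
      J.puncturedConeTransform (π.strictTransform X V) := by
    refine SetLike.coe_injective (Set.Subset.antisymm ?_ ?_)
    · refine Set.Subset.trans (closure_mono fun x hx ↦ ?_)
        (QuotientStack.WeightedBlowup.coe_puncturedConeTransform _).ge
      have hx1 : π.hom.left ((toAtlas J).left x) ∈ (X : Set Y.left) ∩ V' := hx
      exact ⟨subset_closure ⟨hx1.1, hx1.2.1⟩, mem_basicOpen_parameter (hV' _ hx1.2)⟩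
    · refine Eq.trans_subset hηcl.symm (closure_mono (Set.singleton_subset_iff.mpr hπη))
  refine ⟨V', ⟨isSmoothDM_weightedBlowup hJ h.isSmoothDM, ?_, ?_, ?_, ?_, η, hπη, ?_⟩, heq⟩
  · exact J.isSmoothOfDimLE_puncturedCone h.dim
  · exact isProper_blowupMorphism hJ π h.isSmoothDM h.isProper
  · exact isIsoOver_blowupMorphism hJ π inf_le_left h.isIsoOver hV'
  · exact π.dense_removeImage h.isProper hinv h.isIsoOver h.dense hint
  · rw [heq]; exact hηcl

end

/-! ### Induction on the maximum of the invariant -/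

section

variable {k : Type u} [Field k] {Y : Sch k}

lemma IsSmoothVariety.exists_isSmoothOfDimLE (hY : IsSmoothVariety Y) : ∃ n, IsSmoothOfDimLE Y n := by
  have := hY.smooth
  have := hY.compactSpace
  choose V d hV hd using fun y ↦ exists_smoothOfRelativeDimension Y.hom y
  obtain ⟨t, -, ht⟩ := isCompact_univ.elim_nhds_subcover (fun y ↦ (V y : Set Y.left))
    fun y _ ↦ (V y).2.mem_nhds (hV y)
  refine ⟨t.sup d, fun y ↦ ?_⟩
  obtain ⟨z, hz, hyz⟩ := Set.mem_iUnion₂.mp (ht (Set.mem_univ y))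
  exact ⟨V z, d z, hyz, Finset.le_sup hz, hd z⟩

namespace QuotientStack

variable (Y) in
/-- A `k`-scheme as a quotient stack by the trivial torus. -/
def ofScheme : QuotientStack k where
  rank := 0
  atlas := Y
  action :=
    { smul _ b := b
      one_smul _ := rfl
      mul_smul _ _ _ := rfl
      comp_smul _ _ _ := rfl }

lemma ofScheme_target : (ofScheme Y).target = (ofScheme Y).source := rfl

instance isIso_source_ofScheme : IsIso (ofScheme Y).source := by
  obtain ⟨e, -, he⟩ := (ofScheme Y).exists_arrow (fun i : Fin 0 ↦ i.elim0) (𝟙 (ofScheme Y).atlas)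
  refine ⟨e, arrow_ext (funext fun i : Fin 0 ↦ i.elim0) ?_, he⟩
  rw [Category.assoc, Category.id_comp]
  exact (congrArg ((ofScheme Y).source ≫ ·) he).trans (Category.comp_id _)

/-- For the trivial torus, (source, target) followed by a projection is an isomorphism, so both
properties follow by cancellation. -/
lemma isSmoothDM_ofScheme (hY : IsSmoothVariety Y) : (ofScheme Y).IsSmoothDM := by
  have hsep : IsSeparated (prod.snd : (ofScheme Y).atlas ⨯ (ofScheme Y).atlas ⟶ _).left :=
    isSeparated_prod_snd hY.separated
  have hsrc : IsIso (ofScheme Y).source.left :=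
    inferInstanceAs (IsIso ((Over.forget _).map (ofScheme Y).source))
  have h : (prod.lift (ofScheme Y).source (ofScheme Y).target).left ≫
      (prod.snd : (ofScheme Y).atlas ⨯ (ofScheme Y).atlas ⟶ _).left = (ofScheme Y).source.left := by
    rw [← Over.comp_left, prod.lift_snd, ofScheme_target]
  refine ⟨hY, ?_, ?_⟩
  · have : FormallyUnramified ((prod.lift (ofScheme Y).source (ofScheme Y).target).left ≫
      (prod.snd : (ofScheme Y).atlas ⨯ (ofScheme Y).atlas ⟶ _).left) := by
      rw [h]; infer_instance
    exact FormallyUnramified.of_comp _ (prod.snd : (ofScheme Y).atlas ⨯ (ofScheme Y).atlas ⟶ _).left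
  · have : IsProper ((prod.lift (ofScheme Y).source (ofScheme Y).target).left ≫
      (prod.snd : (ofScheme Y).atlas ⨯ (ofScheme Y).atlas ⟶ _).left) := by
      rw [h]; infer_instance
    exact IsProper.of_comp _ (prod.snd : (ofScheme Y).atlas ⨯ (ofScheme Y).atlas ⟶ _).left

variable (Y) in
/-- The identity of a `k`-scheme, as a morphism from a quotient stack. -/
def Morphism.ofScheme : (ofScheme Y).Morphism Y where
  hom := 𝟙 Y
  invariant := rfl

lemma Morphism.isIso_diagonal_ofScheme : IsIso (Morphism.ofScheme Y).diagonal.left := by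
  let π := Morphism.ofScheme Y
  have h0 : IsIso π.hom := inferInstanceAs (IsIso (𝟙 Y))
  have h1 : IsIso (pullback.fst π.hom π.hom) := inferInstance
  have h2 : π.diagonal ≫ pullback.fst π.hom π.hom = (QuotientStack.ofScheme Y).source :=
    pullback.lift_fst _ _ _
  have h3 : IsIso (π.diagonal ≫ pullback.fst π.hom π.hom) := by
    rw [h2]; infer_instance
  have h4 : IsIso π.diagonal := IsIso.of_isIso_comp_right _ (pullback.fst π.hom π.hom)
  exact inferInstanceAs (IsIso ((Over.forget _).map π.diagonal))

lemma Morphism.isProper_ofScheme : (Morphism.ofScheme Y).IsProper where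
  quasiCompact := inferInstanceAs (QuasiCompact (𝟙 Y.left))
  finiteType := inferInstanceAs (LocallyOfFiniteType (𝟙 Y.left))
  separated := by
    have := isIso_diagonal_ofScheme (Y := Y)
    infer_instance
  universallyClosed := by
    intro P Z p q g sq C hC _
    have h1 : IsIso (Morphism.ofScheme Y).hom := inferInstanceAs (IsIso (𝟙 Y))
    have hq : IsIso q := sq.isIso_snd_of_isIso
    have hq' : IsIso q.left := inferInstanceAs (IsIso ((Over.forget _).map q))
    exact q.left.homeomorph.isClosedMap C hC

lemma Morphism.isIsoOver_ofScheme : (Morphism.ofScheme Y).IsIsoOver ⊤ := by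
  have h1 : IsIso (Morphism.ofScheme Y).hom.left := inferInstanceAs (IsIso (𝟙 Y.left))
  have := isIso_diagonal_ofScheme (Y := Y)
  exact ⟨inferInstance, inferInstance, inferInstance⟩

end QuotientStack

open QuotientStack in
lemma isModification_ofScheme (hY : IsSmoothVariety Y) {X : Closeds Y.left}
    (hX : IsIrreducible (X : Set Y.left)) {n : ℕ} (hn : IsSmoothOfDimLE Y n) :
    IsModification X n (Morphism.ofScheme Y) ⊤ := by
  obtain ⟨ξ, hξ⟩ := QuasiSober.sober hX X.isClosed
  refine ⟨isSmoothDM_ofScheme hY, hn, Morphism.isProper_ofScheme, Morphism.isIsoOver_ofScheme,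
    dense_univ, ξ, ⟨hξ.mem, trivial⟩, hξ.trans ?_⟩
  change _ = closure ((X : Set Y.left) ∩ Set.univ)
  rw [Set.inter_univ, X.isClosed.closure_eq]

section Induction

variable {Γ₀ : Type v} [LinearOrder Γ₀] [OrderBot Γ₀] {inv : SingularityInvariant k Γ₀}

/-- If the center were all of X, then X would be its own maximal locus, which is smooth. -/
lemma SingularityInvariant.Criterion.zeroLocus_ssubset (hinv : inv.IsFunctorial) (hsm : inv.IsSmooth)
    {𝒴 : QuotientStack k} {J : Center 𝒴.atlas} {X : Closeds 𝒴.atlas.left}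
    (h𝒴 : IsSmoothVariety 𝒴.atlas) (hX : 𝒴.IsInvariant X) (hsing : ¬ IsSmoothClosed 𝒴.atlas X)
    (hJ : inv.Criterion 𝒴 X J) : (J.zeroLocus : Set 𝒴.atlas.left) ⊂ X := by
  obtain ⟨m, hm, -⟩ := hJ.max_eq
  have hmem := hJ.mem_zeroLocus_iff hinv h𝒴 hX hm
  refine ⟨fun p hp ↦ ((hmem p).mp hp).1, fun hle ↦ hsing (hsm _ X X h𝒴 (Set.ext fun p ↦ ?_))⟩
  refine ⟨fun hp ↦ ?_, fun h ↦ h.1⟩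
  obtain ⟨h, hpm⟩ := (hmem p).mp (hle hp)
  exact ⟨h, fun q ↦ by
    rw [hpm]; exact ((SingularityInvariant.isMax_iff hinv h𝒴 hX m).mp hm).2 ⟨q, rfl⟩⟩

variable [CharZero k]

/-- Well-founded induction on the maximum over all modifications with the same bound n. The bound
survives blowing up because the dimension of the atlas and the rank of the torus both grow by one,
so all the maxima lie in one well-ordered set. -/
theorem IsModification.hasEmbeddedResolution (hwf : inv.IsWellOrdered) (hinv : inv.IsFunctorial)
    (hsm : inv.IsSmooth)
    (H : ∀ (𝒴 : QuotientStack k) (X : Closeds 𝒴.atlas.left),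
      𝒴.IsSmoothDM → 𝒴.IsInvariant X → IsIrreducible (X : Set 𝒴.atlas.left) →
      ¬ IsSmoothClosed 𝒴.atlas X →
      ∃ J : Center 𝒴.atlas, 𝒴.IsInvariantCenter J ∧ inv.Criterion 𝒴 X J)
    {X : Closeds Y.left} {n : ℕ} {𝒴 : QuotientStack k} {π : 𝒴.Morphism Y} {V : Y.left.Opens}
    (h : IsModification X n π V) : HasEmbeddedResolution Y X := by
  suffices key : ∀ m ∈ {γ : Γ₀ | ∃ (𝒴 : QuotientStack k) (X : Closeds 𝒴.atlas.left) (q : 𝒴.Points X),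
      𝒴.IsSmoothDM ∧ 𝒴.IsInvariant X ∧ IsSmoothOfDimLE 𝒴.atlas (n + 𝒴.rank) ∧
      inv.onStack 𝒴 X q = γ}, ∀ (𝒴 : QuotientStack k) (π : 𝒴.Morphism Y) (V : Y.left.Opens),
      IsModification X n π V → inv.IsMax 𝒴 (π.strictTransform X V) m → HasEmbeddedResolution Y X by
    obtain ⟨ξ, -, hξ⟩ := h.generic
    have : Nonempty (π.strictTransform X V) :=
      ⟨ξ, show ξ ∈ (π.strictTransform X V : Set _) from hξ ▸ subset_closure rfl⟩
    obtain ⟨x, hx⟩ := inv.exists_isMax h.isSmoothDM.atlas (π.strictTransform X V)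
    have hX := π.isInvariant_strictTransform X V
    have hm := (SingularityInvariant.isMax_iff hinv h.isSmoothDM.atlas hX _).mpr
      ⟨⟨x, rfl⟩, by rintro _ ⟨y, rfl⟩; exact hx y⟩
    obtain ⟨q, hq⟩ := hm.1
    exact key _ ⟨𝒴, _, q, h.isSmoothDM, hX, h.dim, hq⟩ 𝒴 π V h hm
  intro m hmS
  refine Set.WellFoundedOn.induction (P := fun m ↦ ∀ (𝒴 : QuotientStack k) (π : 𝒴.Morphism Y)
    (V : Y.left.Opens), IsModification X n π V → inv.IsMax 𝒴 (π.strictTransform X V) m →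
      HasEmbeddedResolution Y X) (hwf n) hmS fun m hmS ih ↦ ?_
  intro 𝒴 π V h hm
  have hX := π.isInvariant_strictTransform X V
  obtain ⟨ξ, hξV, hξ⟩ := h.generic
  by_cases hsing : IsSmoothClosed 𝒴.atlas (π.strictTransform X V)
  · exact ⟨𝒴, π, V, h.isSmoothDM, h.isProper, h.isIsoOver, h.dense, ⟨_, hξV⟩, hsing⟩
  · obtain ⟨J, hJ, hcrit⟩ := H 𝒴 _ h.isSmoothDM hX (by
      rw [← hξ]; exact isIrreducible_singleton.closure) hsing
    obtain ⟨V', hV', heq⟩ := h.blowup hJ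
      (hcrit.zeroLocus_ssubset hinv hsm h.isSmoothDM.atlas hX hsing)
    obtain ⟨η, -, hη⟩ := hV'.generic
    -- The strict decrease needs a nonempty blowup of X; the generic point of the new strict
    -- transform provides a point.
    have hmem : η ∈ J.puncturedConeTransform (π.strictTransform X V) := by
      rw [← heq]
      exact hη.le (subset_closure rfl)
    obtain ⟨m', hm', hlt⟩ := (Center.weightedBlowup hJ).exists_isMax_lt hinv hsm h.isSmoothDM.atlas hX
      hcrit hm ⟨QuotientStack.Points.mk (𝒴 := (Center.weightedBlowup hJ).stack) ⟨η, hmem⟩⟩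
    obtain ⟨q, hq⟩ := hm'.1
    refine ih m' ⟨_, _, q, hV'.isSmoothDM,
      (Center.weightedBlowup hJ).isInvariant_puncturedConeTransform hX, hV'.dim, hq⟩ hlt _ _ V' hV' ?_
    rw [heq]
    exact hm'

end Induction

end

end
end WeightedResolution

open WeightedResolution TopologicalSpace in
theorem mainTheorem5 {k : Type u} [Field k] [CharZero k]
    {Γ₀ : Type v} [LinearOrder Γ₀] [OrderBot Γ₀]
    (inv : SingularityInvariant k Γ₀) (hwellOrdered : inv.IsWellOrdered)
    (hfunctorial : inv.IsFunctorial) (hsmooth : inv.IsSmooth) :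
    (∀ (𝒴 : QuotientStack k) (X : Closeds 𝒴.atlas.left) (J : Center 𝒴.atlas),
      𝒴.IsSmoothDM → 𝒴.IsInvariant X → 𝒴.IsInvariantCenter J → inv.Criterion 𝒴 X J →
      Nonempty (𝒴.WeightedBlowup J) ∧
      ∀ (W : 𝒴.WeightedBlowup J) (m : Γ₀), inv.IsMax 𝒴 X m →
        Nonempty (W.stack.Points (J.puncturedConeTransform X)) →
        ∃ m', inv.IsMax W.stack (J.puncturedConeTransform X) m' ∧ m' < m) ∧
    ((∀ (𝒴 : QuotientStack k) (X : Closeds 𝒴.atlas.left),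
        𝒴.IsSmoothDM → 𝒴.IsInvariant X → IsIrreducible (X : Set 𝒴.atlas.left) →
        ¬ IsSmoothClosed 𝒴.atlas X →
        ∃ J : Center 𝒴.atlas, 𝒴.IsInvariantCenter J ∧ inv.Criterion 𝒴 X J) →
      ∀ (Y : Sch k) (X : Closeds Y.left),
        IsSmoothVariety Y → IsIrreducible (X : Set Y.left) → HasEmbeddedResolution Y X) := by
  refine ⟨fun 𝒴 X J h𝒴 hX hJ hcrit ↦ ⟨⟨Center.weightedBlowup hJ⟩, fun W m hm hne ↦
    W.exists_isMax_lt hfunctorial hsmooth h𝒴.atlas hX hcrit hm hne⟩, fun H Y X hY hX ↦ ?_⟩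
  obtain ⟨n, hn⟩ := hY.exists_isSmoothOfDimLE
  exact (isModification_ofScheme hY hX hn).hasEmbeddedResolution hwellOrdered hfunctorial hsmooth H
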